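/- Let $d\ge 2$, let $\gamma>0$, and let $\varphi$ be an even Borel probability measure on the unit sphere $\mathbb S^{d-1}$ of $\mathbb R^d$ whose support is not contained in a linear hyperplane. Assume that $\varphi$ is concentrated on finitely many points, and let $n_{\max}$ be the number of points of its support. Let $\eta$ be the Poisson process of hyperplanes $H(u,t)=\{x\in\mathbb R^d:\langle x,u\rangle=t\}$, $u\in\mathbb S^{d-1}$, $t>0$, with intensity measure $$\gamma\int_{\mathbb S^{d-1}}\int_0^\infty \mathbf 1\big(H(u,t)\in\cdot\big)\,dt\,\varphi(du),$$ and let $X$ be the hyperplane mosaic that it induces, i.e. the process of the cells (the closures of the connected components of the complement of $\bigcup_{H\in\eta}H$). Let $\mathcal K$ be the space of compact convex subsets of $\mathbb R^d$ with non-empty interior, with the Borel structure of the Hausdorff distance, and let $c:\mathcal K\to\mathbb R^d$ be a measurable map with $c(tK+x)=t\,c(K)+x$ for $t>0$, $x\in\mathbb R^d$, and $c(K)\in K$. Let $\Phi(K)=\int_{\mathbb S^{d-1}}\max_{x\in K}\langle x,u\rangle\,\varphi(du)$ and $\operatorname{shape}(K)=\Phi(K)^{-1}(K-c(K))$, and let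 $f(K)$ be the number of facets of $K$. Let $Z$ be the typical cell of $X$, i.e. a random element of $\mathcal K$ with distribution $$\mathbb P(Z\in C)=\frac{\mathbb E\,\#\{K\in X: c(K)\in[0,1]^d,\ K-c(K)\in C\}}{\mathbb E\,\#\{K\in X: c(K)\in[0,1]^d\}} .$$ Then this is a probability distribution, $f(Z)\le n_{\max}$ almost surely, $\mathbb P(f(Z)=n_{\max})>0$, $\mathbb P(\Phi(Z)\ge a)>0$ for every $a\in\mathbb R$, and for every Borel set $S$ of shapes $$\lim_{a\to\infty}\mathbb P\big(\operatorname{shape}(Z)\in S\mid \Phi(Z)\ge a\big)=\mathbb P\big(\operatorname{shape}(Z)\in S\mid f(Z)=n_{\max}\big).$$ -/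

import Mathlib

open MeasureTheory ProbabilityTheory Filter Topology Set
open scoped Pointwise ENNReal

noncomputable section

namespace HyperplaneMosaic

/-- The `d`-dimensional Euclidean space. -/
abbrev Space (d : ℕ) := EuclideanSpace ℝ (Fin d)

/-- The unit sphere of the `d`-dimensional Euclidean space. -/
abbrev Sphere (d : ℕ) := Metric.sphere (0 : Space d) 1

/-! ### Convex bodies -/

/-- Nonempty compact convex sets carry the Borel structure of the Hausdorff distance. -/
instance instMeasurableSpaceConvexBody (d : ℕ) : MeasurableSpace (ConvexBody (Space d)) :=
  borel _

instance instBorelSpaceConvexBody (d : ℕ) : BorelSpace (ConvexBody (Space d)) := ⟨rfl⟩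

/-- Convex bodies with non-empty interior, with the Hausdorff distance and its Borel structure. -/
abbrev FatBody (d : ℕ) :=
  {K : ConvexBody (Space d) // (interior (K : Set (Space d))).Nonempty}

/-- The convex body `t K + x`. -/
def smulAdd {d : ℕ} (t : ℝ) (x : Space d) (K : ConvexBody (Space d)) : ConvexBody (Space d) :=
  t • K + ⟨{x}, convex_singleton x, isCompact_singleton, singleton_nonempty x⟩

theorem coe_smulAdd {d : ℕ} (t : ℝ) (x : Space d) (K : ConvexBody (Space d)) :
    (smulAdd t x K : Set (Space d)) = (fun y => t • y + x) '' (K : Set (Space d)) := by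
  change t • (K : Set (Space d)) + {x} = _
  rw [add_singleton, ← image_smul, image_image]

/-- The convex body `t K + x` with non-empty interior, for `t > 0`. -/
def FatBody.smulAdd {d : ℕ} (t : ℝ) (ht : 0 < t) (x : Space d) (K : FatBody d) : FatBody d :=
  ⟨HyperplaneMosaic.smulAdd t x K.1, by
    obtain ⟨y, hy⟩ := K.2
    refine ⟨t • y + x, ?_⟩
    rw [mem_interior] at hy ⊢
    obtain ⟨U, hU, hUo, hyU⟩ := hy
    refine ⟨(fun y => t • y + x) '' U, ?_, ?_, mem_image_of_mem _ hyU⟩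
    · rw [coe_smulAdd]
      exact image_mono hU
    · exact ((Homeomorph.smulOfNeZero t ht.ne').trans (Homeomorph.addRight x)).isOpenMap U hUo⟩

/-- The support function `h(K, u) = max {⟨x, u⟩ : x ∈ K}`. -/
def supportFn {d : ℕ} (K : ConvexBody (Space d)) (u : Space d) : ℝ :=
  sSup ((fun x : Space d => inner ℝ x u) '' (K : Set (Space d)))

/-- The `Φ`-content of a convex body: the integral of its support function against the
directional distribution. -/
def phiContent {d : ℕ} (φ : Measure (Sphere d)) (K : ConvexBody (Space d)) : ℝ :=
  ∫ u, supportFn K (u : Space d) ∂φ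

/-- The facets of a convex body: its exposed faces of affine dimension `d - 1`. -/
def facets {d : ℕ} (K : ConvexBody (Space d)) : Set (Set (Space d)) :=
  {F | IsExposed ℝ (K : Set (Space d)) F ∧ Module.finrank ℝ (vectorSpan ℝ F) + 1 = d}

/-- The number of facets. -/
def facetNumber {d : ℕ} (K : ConvexBody (Space d)) : ℕ∞ := (facets K).encard

/-- Center functions: measurable maps on the convex bodies with non-empty interior that are
compatible with translations and positive scalings and select a point of the body. -/
structure IsCenterFunction {d : ℕ} (c : FatBody d → Space d) : Prop where
  measurable : Measurable c
  map_smulAdd : ∀ (t : ℝ) (ht : 0 < t) (x : Space d) (K : FatBody d),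
    c (FatBody.smulAdd t ht x K) = t • c K + x
  mem : ∀ K : FatBody d, c K ∈ (K.1 : Set (Space d))

/-- The shape `Φ(K)⁻¹ (K - c(K))` of a convex body. -/
def shape {d : ℕ} (φ : Measure (Sphere d)) (c : FatBody d → Space d) (K : FatBody d) :
    ConvexBody (Space d) :=
  (phiContent φ K.1)⁻¹ • smulAdd 1 (-(c K)) K.1

/-- The translate `K - c(K)` with center at the origin. -/
def centered {d : ℕ} (c : FatBody d → Space d) (K : FatBody d) : FatBody d :=
  FatBody.smulAdd 1 one_pos (-(c K)) K

/-! ### Poisson processes -/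

/-- A random set of points `η` is a (simple) Poisson process with intensity measure `L`: the
numbers of points in measurable sets are random variables, the number of points in a set of
finite intensity `L B` is Poisson distributed with parameter `L B`, and the numbers of points in
pairwise disjoint measurable sets are independent. -/
structure IsPoissonProcess {Ω α : Type*} [MeasurableSpace Ω] [MeasurableSpace α]
    (P : Measure Ω) (η : Ω → Set α) (L : Measure α) : Prop where
  measurable_count : ∀ B : Set α, MeasurableSet B → Measurable fun ω => (η ω ∩ B).encard
  law_count : ∀ B : Set α, MeasurableSet B → L B ≠ ∞ →
    P.map (fun ω => (η ω ∩ B).encard) =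
      (poissonMeasure (L B).toNNReal).map (fun k : ℕ => (k : ℕ∞))
  indep_count : ∀ (n : ℕ) (B : Fin n → Set α), (∀ i, MeasurableSet (B i)) →
    (Pairwise fun i j => Disjoint (B i) (B j)) →
    iIndepFun (fun i ω => (η ω ∩ B i).encard) P

/-! ### The hyperplane mosaic

The pair `(u, t)` with `u` in the unit sphere and `t > 0` stands for the hyperplane
`H(u, t) = {x : ⟨x, u⟩ = t}`; every hyperplane that avoids the origin arises from exactly one
such pair. -/

/-- The hyperplane `H(u, t) = {x : ⟨x, u⟩ = t}`. -/
def hyperplane {d : ℕ} (p : Sphere d × ℝ) : Set (Space d) :=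
  {x | inner ℝ x (p.1 : Space d) = p.2}

/-- The intensity measure of the hyperplane process with intensity `γ` and directional
distribution `φ`, in the coordinates `(u, t)`: it is `γ φ(du) dt` on `t > 0`. -/
def hyperplaneIntensity {d : ℕ} (γ : ℝ) (φ : Measure (Sphere d)) : Measure (Sphere d × ℝ) :=
  ENNReal.ofReal γ • φ.prod (volume.restrict (Ioi 0))

/-- The complement of the union of the hyperplanes of `A`. -/
def offHyperplanes {d : ℕ} (A : Set (Sphere d × ℝ)) : Set (Space d) :=
  (⋃ p ∈ A, hyperplane p)ᶜ

/-- The cells of the mosaic induced by the hyperplanes of `A`: the convex bodies that are the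
closure of a connected component of the complement of the union of the hyperplanes. -/
def cells {d : ℕ} (A : Set (Sphere d × ℝ)) : Set (FatBody d) :=
  {K | ∃ x ∈ offHyperplanes A,
    (K.1 : Set (Space d)) = closure (connectedComponentIn (offHyperplanes A) x)}

/-- The mosaic as a counting measure on the convex bodies: a set `D` gets as its mass the number
of cells in `D`. -/
def mosaic {d : ℕ} (A : Set (Sphere d × ℝ)) : Measure (FatBody d) :=
  Measure.sum fun K : cells A => Measure.dirac (K : FatBody d)

/-- The intensity measure `D ↦ 𝔼 X(D)` of the random mosaic `X` induced by the random set of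
hyperplanes `η`. -/
def mosaicIntensity {d : ℕ} {Ω : Type*} [MeasurableSpace Ω] (P : Measure Ω)
    (η : Ω → Set (Sphere d × ℝ)) : Measure (FatBody d) :=
  P.bind fun ω => mosaic (η ω)

/-- The bodies whose center lies in the unit cube `[0, 1]^d`. -/
def centerInCube {d : ℕ} (c : FatBody d → Space d) : Set (FatBody d) :=
  {K | ∀ i, c K i ∈ Icc (0 : ℝ) 1}

/-- The grain distribution, that is, the distribution of the typical cell of the mosaic:
`Q(C)` is the mean number of cells `K` with `c(K) ∈ [0, 1]^d` and `K - c(K) ∈ C`, divided by the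
mean number of cells `K` with `c(K) ∈ [0, 1]^d`. -/
def typicalCellLaw {d : ℕ} {Ω : Type*} [MeasurableSpace Ω] (P : Measure Ω)
    (η : Ω → Set (Sphere d × ℝ)) (c : FatBody d → Space d) : Measure (FatBody d) :=
  (mosaicIntensity P η (centerInCube c))⁻¹ •
    ((mosaicIntensity P η).restrict (centerInCube c)).map (centered c)

end HyperplaneMosaic

end

noncomputable section

namespace HyperplaneMosaic

set_option linter.unusedSectionVars false

/-! ### Support functions and the Hausdorff distance -/

section Bodies

variable {d : ℕ}

/-! An even measure with finite support is carried by finitely many pairs `± u i`, so `nmax` is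
twice the number of pairs. The signed distances of the hyperplanes in the `i`-th parallel class form
a Poisson process on the whole line with intensity `γ * φ.real {u i}`, and these processes are
independent. A cell is an intersection of slabs, one gap of consecutive points from each class. It
is encoded by `t`, with half-spaces `⟨x, v j⟩ ≤ t j`, where `v` lists the vectors `± u i`. With `l
j` the intensity of the class of `v j`, the mean number of gap systems with parameters in a set has
density proportional to `exp (-level l t)`, where `level l t = ∑ j, l j * t j`
(`IsPoissonSystem.lintegral_encard`, `IsPoissonProcess.mosaicIntensity_apply`).

Since `∑ j, l j • v j = 0`, the level is invariant under translation of the polytope, and it is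
homogeneous of degree one. Hence, for a homothety-invariant set `B` of parameters with centers
restricted to the cube, the volume of `{level ≤ r}` is `V_B * r ^ m` with `m = nmax - d`. The
weighted mass of `{level ≥ a}` is therefore `V_B` times a Gamma tail that does not depend on `B`
(`IsHomothetic.mass_level_ge`): shape and level decouple.

The size in the theorem is not the level but the content, which equals `γ * Φ`. It is at most the
level, with equality exactly when every half-space touches the polytope. Up to a null set of
parameters this means that no constraint is redundant, i.e. that there are `nmax` facets
(`volume_tight_diff_irredundant`, `facetNumber_body_eq_iff`). A cell with content at least `a` but
below `y * level`, `y < 1`, has level above `a / y`, and the Gamma tail at `a / y` is negligible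
against the tail at `a`. So the mass of `B` on `{content ≥ a}`, divided by the Gamma tail, tends to
`V` of the touching part of `B` (`IsHomothetic.tendsto_mass_div`). Quotients of such limits are the
conditional probabilities given `nmax` facets. -/

theorem bddAbove_inner (K : ConvexBody (Space d)) (u : Space d) :
    BddAbove ((fun x : Space d => inner ℝ x u) '' (K : Set (Space d))) :=
  (K.isCompact.image (by fun_prop)).bddAbove

theorem inner_le_supportFn {K : ConvexBody (Space d)} {x : Space d} (hx : x ∈ K) (u : Space d) :
    inner ℝ x u ≤ supportFn K u :=
  le_csSup (bddAbove_inner K u) (mem_image_of_mem _ hx)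

theorem exists_inner_eq_supportFn (K : ConvexBody (Space d)) (u : Space d) :
    ∃ x ∈ K, inner ℝ x u = supportFn K u := by
  obtain ⟨x, hx, h⟩ := (K.isCompact.image (f := fun x : Space d => inner ℝ x u)
    (by fun_prop)).sSup_mem (K.nonempty.image _)
  exact ⟨x, hx, h⟩

theorem supportFn_le {K : ConvexBody (Space d)} {u : Space d} {s : ℝ}
    (h : ∀ x ∈ K, inner ℝ x u ≤ s) : supportFn K u ≤ s := by
  obtain ⟨x, hx, h'⟩ := exists_inner_eq_supportFn K u
  exact h' ▸ h x hx

theorem mem_smulAdd {t : ℝ} {x y : Space d} {K : ConvexBody (Space d)} :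
    y ∈ smulAdd t x K ↔ ∃ z ∈ K, t • z + x = y := by
  rw [← SetLike.mem_coe, coe_smulAdd]; rfl

theorem supportFn_smulAdd {t : ℝ} (ht : 0 ≤ t) (x : Space d) (K : ConvexBody (Space d))
    (u : Space d) : supportFn (smulAdd t x K) u = t * supportFn K u + inner ℝ x u := by
  refine le_antisymm (supportFn_le fun y hy => ?_) ?_
  · obtain ⟨z, hz, rfl⟩ := mem_smulAdd.1 hy
    rw [inner_add_left, real_inner_smul_left]
    have := mul_le_mul_of_nonneg_left (inner_le_supportFn hz u) ht
    linarith
  · obtain ⟨z, hz, h⟩ := exists_inner_eq_supportFn K u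
    have := inner_le_supportFn (mem_smulAdd.2 ⟨z, hz, rfl⟩ : t • z + x ∈ smulAdd t x K) u
    rwa [inner_add_left, real_inner_smul_left, h] at this

theorem exists_dist_le_dist (K L : ConvexBody (Space d)) {x : Space d} (hx : x ∈ K) :
    ∃ y ∈ L, dist x y ≤ dist K L := by
  obtain ⟨y, hy, h⟩ := L.isCompact.exists_infDist_eq_dist L.nonempty x
  refine ⟨y, hy, ?_⟩
  rw [← h]
  exact Metric.infDist_le_hausdorffDist_of_mem hx ConvexBody.hausdorffEDist_ne_top

theorem dist_convexBody_le {K L : ConvexBody (Space d)} {r : ℝ} (hr : 0 ≤ r)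
    (h₁ : ∀ x ∈ K, ∃ y ∈ L, dist x y ≤ r) (h₂ : ∀ x ∈ L, ∃ y ∈ K, dist x y ≤ r) :
    dist K L ≤ r :=
  Metric.hausdorffDist_le_of_mem_dist hr h₁ h₂

theorem continuous_supportFn (u : Space d) :
    Continuous fun K : ConvexBody (Space d) => supportFn K u := by
  have key : ∀ K L : ConvexBody (Space d), supportFn K u ≤ supportFn L u + ‖u‖ * dist K L := by
    intro K L
    refine supportFn_le fun x hx => ?_
    obtain ⟨y, hy, h⟩ := exists_dist_le_dist K L hx
    have h1 : inner ℝ x u = inner ℝ y u + inner ℝ (x - y) u := by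
      rw [← inner_add_left]; congr 1; abel
    have h2 : inner ℝ (x - y) u ≤ ‖x - y‖ * ‖u‖ := real_inner_le_norm _ _
    rw [dist_eq_norm] at h
    nlinarith [inner_le_supportFn hy u, norm_nonneg u]
  refine (LipschitzWith.of_le_add_mul ‖u‖₊ key).continuous

/-- Needed so that the Borel structure of a product with this space is the product σ-algebra; joint
continuity then gives measurability. -/
instance instSecondCountableConvexBody : SecondCountableTopology (ConvexBody (Space d)) := by
  let f : ConvexBody (Space d) → TopologicalSpace.NonemptyCompacts (Space d) :=
    fun K => ⟨⟨K, K.isCompact⟩, K.nonempty⟩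
  have hf : Isometry f := Isometry.of_dist_eq fun K L => rfl
  exact hf.isEmbedding.secondCountableTopology

/-- Joint continuity is required because in `centered` and `shape` the factor and the translation
vector depend on the body itself. -/
theorem continuous_smulAdd :
    Continuous fun p : ℝ × Space d × ConvexBody (Space d) => smulAdd p.1 p.2.1 p.2.2 := by
  have key : ∀ (s t : ℝ) (x y : Space d) (K L : ConvexBody (Space d)) (R : ℝ),
      (∀ z ∈ L, ‖z‖ ≤ R) → ∀ z ∈ smulAdd s x K, ∃ w ∈ smulAdd t y L,
        dist z w ≤ |s| * dist K L + |s - t| * R + ‖x - y‖ := by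
    intro s t x y K L R hR z hz
    obtain ⟨z, hzK, rfl⟩ := mem_smulAdd.1 hz
    obtain ⟨w, hw, h⟩ := exists_dist_le_dist K L hzK
    refine ⟨t • w + y, mem_smulAdd.2 ⟨w, hw, rfl⟩, ?_⟩
    have : s • z + x - (t • w + y) = s • (z - w) + (s - t) • w + (x - y) := by module
    rw [dist_eq_norm, this]
    rw [dist_eq_norm] at h
    calc _ ≤ ‖s • (z - w)‖ + ‖(s - t) • w‖ + ‖x - y‖ := norm_add₃_le
      _ ≤ _ := by
        rw [norm_smul, norm_smul, Real.norm_eq_abs, Real.norm_eq_abs]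
        gcongr
        exact hR w hw
  rw [continuous_iff_continuousAt]
  rintro ⟨s, x, K⟩
  obtain ⟨R, hR0, hR⟩ := K.isBounded.exists_pos_norm_le
  have hbd : ∀ L : ConvexBody (Space d), ∀ z ∈ L, ‖z‖ ≤ R + dist L K := by
    intro L z hz
    obtain ⟨w, hw, h⟩ := exists_dist_le_dist L K hz
    have := norm_le_norm_add_norm_sub' z w
    rw [dist_eq_norm] at h
    linarith [hR w hw]
  have hle : ∀ p : ℝ × Space d × ConvexBody (Space d),
      dist (smulAdd p.1 p.2.1 p.2.2) (smulAdd s x K) ≤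
        (|p.1| + |s|) * dist p.2.2 K + |p.1 - s| * (R + dist p.2.2 K) + ‖p.2.1 - x‖ := by
    rintro ⟨t, y, L⟩
    have hd : 0 ≤ dist L K := dist_nonneg
    refine dist_convexBody_le (by positivity) (fun z hz => ?_) (fun z hz => ?_)
    · obtain ⟨w, hw, h⟩ := key t s y x L K R hR z hz
      refine ⟨w, hw, h.trans ?_⟩
      have := mul_nonneg (abs_nonneg s) hd
      have := mul_nonneg (abs_nonneg (t - s)) hd
      simp only; linarith
    · obtain ⟨w, hw, h⟩ := key s t x y K L _ (hbd L) z hz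
      refine ⟨w, hw, h.trans ?_⟩
      rw [abs_sub_comm s t, norm_sub_rev x y, dist_comm K L]
      have := mul_nonneg (abs_nonneg t) hd
      simp only; linarith
  rw [ContinuousAt, tendsto_iff_dist_tendsto_zero]
  refine squeeze_zero (fun _ => dist_nonneg) hle ?_
  have hc : Continuous fun p : ℝ × Space d × ConvexBody (Space d) =>
      (|p.1| + |s|) * dist p.2.2 K + |p.1 - s| * (R + dist p.2.2 K) + ‖p.2.1 - x‖ := by fun_prop
  have := hc.tendsto (s, x, K)
  simpa using this

theorem measurable_smulAdd {α : Type*} [MeasurableSpace α] {f : α → ℝ} {g : α → Space d}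
    {k : α → ConvexBody (Space d)} (hf : Measurable f) (hg : Measurable g) (hk : Measurable k) :
    Measurable fun a => smulAdd (f a) (g a) (k a) :=
  continuous_smulAdd.measurable.comp (hf.prodMk (hg.prodMk hk))

theorem smulAdd_smulAdd (s t : ℝ) (x y : Space d) (K : ConvexBody (Space d)) :
    smulAdd s x (smulAdd t y K) = smulAdd (s * t) (s • y + x) K := by
  apply ConvexBody.ext
  simp only [coe_smulAdd, image_image]
  congr 1
  ext1 z
  module

theorem smul_eq_smulAdd (s : ℝ) (K : ConvexBody (Space d)) : s • K = smulAdd s 0 K := by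
  apply ConvexBody.ext
  simp [coe_smulAdd]

theorem measurable_centered {c : FatBody d → Space d} (hc : IsCenterFunction c) :
    Measurable (centered c) :=
  (measurable_smulAdd measurable_const hc.measurable.neg measurable_subtype_coe).subtype_mk

theorem measurable_shape {φ : Measure (Sphere d)} {c : FatBody d → Space d}
    (hc : IsCenterFunction c) (hφ : Measurable fun K : ConvexBody (Space d) => phiContent φ K) :
    Measurable (shape φ c) := by
  unfold shape
  simp only [smul_eq_smulAdd]
  exact measurable_smulAdd (hφ.comp measurable_subtype_coe).inv measurable_const
    (measurable_smulAdd measurable_const hc.measurable.neg measurable_subtype_coe)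

/-- Center and content transform along with the body, so a set of shapes defines a
homothety-invariant set of bodies; this is all the limit argument uses about shapes. -/
theorem shape_smulAdd {φ : Measure (Sphere d)} {c : FatBody d → Space d}
    (hc : IsCenterFunction c)
    (hφ : ∀ (t : ℝ) (_ : 0 ≤ t) (x : Space d) (K : ConvexBody (Space d)),
      phiContent φ (smulAdd t x K) = t * phiContent φ K)
    {t : ℝ} (ht : 0 < t) (x : Space d) (K : FatBody d) :
    shape φ c (FatBody.smulAdd t ht x K) = shape φ c K := by
  unfold shape
  rw [hc.map_smulAdd]
  change (phiContent φ (smulAdd t x K.1))⁻¹ • smulAdd 1 _ (smulAdd t x K.1) = _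
  rw [hφ t ht.le, smul_eq_smulAdd, smul_eq_smulAdd, smulAdd_smulAdd, smulAdd_smulAdd,
    smulAdd_smulAdd]
  congr 1
  · field_simp
  · rw [mul_inv, mul_comm, ← sub_eq_zero]
    have h : t⁻¹ * (phiContent φ K.1)⁻¹ * t = (phiContent φ K.1)⁻¹ := by field_simp
    simp only [add_zero, one_mul, smul_add, smul_neg, smul_smul, h]
    abel

end Bodies

/-! ### Polytopes with prescribed facet normals -/

section Polytopes

variable {d : ℕ} {J : Type*} [Fintype J]

/-- A finite system of distinct unit vectors that span the space, with positive weights for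
which the weighted sum of the vectors vanishes. -/
structure IsBalanced (v : J → Space d) (l : J → ℝ) : Prop where
  norm_eq : ∀ j, ‖v j‖ = 1
  injective : Function.Injective v
  pos : ∀ j, 0 < l j
  sum_smul : ∑ j, l j • v j = 0
  span : ∀ x : Space d, x ≠ 0 → ∃ j, inner ℝ x (v j) ≠ 0

/-- The intersection of the half-spaces `⟨x, v j⟩ ≤ t j`. -/
def polytope (v : J → Space d) (t : J → ℝ) : Set (Space d) := {x | ∀ j, inner ℝ x (v j) ≤ t j}

/-- The parameters of polytopes with interior points. -/
def solid (v : J → Space d) : Set (J → ℝ) := {t | ∃ x, ∀ j, inner ℝ x (v j) < t j}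

/-- The action of a translation on the parameters. -/
def shift (v : J → Space d) (x : Space d) : J → ℝ := fun j => inner ℝ x (v j)

/-- The weighted sum of the parameters. -/
def level (l : J → ℝ) (t : J → ℝ) : ℝ := ∑ j, l j * t j

/-- The face of a polytope in the direction `v j`. -/
def face (v : J → Space d) (t : J → ℝ) (j : J) : Set (Space d) :=
  {x ∈ polytope v t | inner ℝ x (v j) = t j}

/-- The parameters for which no half-space is redundant. -/
def irredundant (v : J → Space d) : Set (J → ℝ) :=
  {t | ∀ j, ∃ y, (∀ k, k ≠ j → inner ℝ y (v k) < t k) ∧ t j < inner ℝ y (v j)}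

variable {v : J → Space d} {l : J → ℝ} {t : J → ℝ}

theorem shift_add (v : J → Space d) (x y : Space d) : shift v (x + y) = shift v x + shift v y := by
  ext j; simp [shift, inner_add_left]

/-- The translation term is the inner product of `x` with `∑ j, l j • v j = 0`. -/
theorem level_smul_add_shift (h : IsBalanced v l) (r : ℝ) (t : J → ℝ) (x : Space d) :
    level l (r • t + shift v x) = r * level l t := by
  have h0 : ∑ j, l j * inner ℝ x (v j) = 0 := by
    have := congrArg (fun y => inner ℝ x y) h.sum_smul
    simpa [inner_sum, real_inner_smul_right] using this
  simp only [level, shift, Pi.add_apply, Pi.smul_apply, smul_eq_mul, mul_add,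
    Finset.sum_add_distrib, h0, add_zero, Finset.mul_sum]
  exact Finset.sum_congr rfl fun j _ => by ring

theorem level_shift (h : IsBalanced v l) (x : Space d) : level l (shift v x) = 0 := by
  simpa using level_smul_add_shift h 0 0 x

theorem continuous_level (l : J → ℝ) : Continuous (level l) := by
  unfold level; fun_prop

theorem level_mono (h : IsBalanced v l) {s t : J → ℝ} (hst : ∀ j, s j ≤ t j) :
    level l s ≤ level l t :=
  Finset.sum_le_sum fun j _ => mul_le_mul_of_nonneg_left (hst j) (h.pos j).le

theorem level_pos (h : IsBalanced v l) [Nonempty J] (ht : t ∈ solid v) : 0 < level l t := by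
  obtain ⟨x, hx⟩ := ht
  rw [← level_shift h x]
  exact Finset.sum_lt_sum_of_nonempty Finset.univ_nonempty
    fun j _ => mul_lt_mul_of_pos_left (hx j) (h.pos j)

/-- Lower bounds on the parameters and an upper bound on the level give upper bounds. -/
theorem exists_bound_of_level_le (h : IsBalanced v l) (R r : ℝ) :
    ∃ M, 0 ≤ M ∧ ∀ t : J → ℝ, (∀ j, -R ≤ t j) → level l t ≤ r → ∀ j, t j ≤ M := by
  classical
  have hM : ∀ j, ∃ m, ∀ t : J → ℝ, (∀ j, -R ≤ t j) → level l t ≤ r → t j ≤ m := by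
    intro j
    -- The other coordinates are at least `-R`, so `l j * t j` can exceed `r` by at most the sum of
    -- the `l k * R`.
    refine ⟨(r + (∑ k ∈ Finset.univ.erase j, l k * R)) / l j, fun t ht hr => ?_⟩
    rw [le_div_iff₀ (h.pos j)]
    have h1 : level l t = l j * t j + ∑ k ∈ Finset.univ.erase j, l k * t k :=
      (Finset.add_sum_erase _ _ (Finset.mem_univ j)).symm
    have h2 : ∑ k ∈ Finset.univ.erase j, l k * (-R) ≤ ∑ k ∈ Finset.univ.erase j, l k * t k :=
      Finset.sum_le_sum fun k _ => mul_le_mul_of_nonneg_left (ht k) (h.pos k).le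
    simp only [mul_neg, Finset.sum_neg_distrib] at h2
    linarith
  choose m hm using hM
  refine ⟨∑ j, |m j|, by positivity, fun t ht hr j => (hm j t ht hr).trans ?_⟩
  exact (le_abs_self _).trans
    (Finset.single_le_sum (f := fun j => |m j|) (fun _ _ => abs_nonneg _) (Finset.mem_univ j))

/-- The inner products of a point with the `v j` are bounded above by `M`; as their weighted sum
vanishes, they are also bounded below. Since the `v j` span, these inner products control the norm.
The bound is uniform in `t`, as the continuity of `body` requires. -/
theorem exists_norm_le_of_mem_polytope (h : IsBalanced v l) (M : ℝ) :
    ∃ R, ∀ t : J → ℝ, (∀ j, t j ≤ M) → ∀ x ∈ polytope v t, ‖x‖ ≤ R := by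
  obtain ⟨B, hB0, hB⟩ := exists_bound_of_level_le h M 0
  let T : Space d →ₗ[ℝ] (J → ℝ) :=
    { toFun := shift v
      map_add' := shift_add v
      map_smul' := fun r x => by ext j; simp [shift, real_inner_smul_left] }
  have hT : LinearMap.ker T = ⊥ := by
    rw [LinearMap.ker_eq_bot']
    intro x hx
    by_contra hne
    obtain ⟨j, hj⟩ := h.span x hne
    exact hj (congrFun hx j)
  obtain ⟨K, _, hK⟩ := T.exists_antilipschitzWith hT
  refine ⟨K * (|M| + B), fun t ht x hx => ?_⟩
  have h1 : ‖x‖ ≤ K * ‖T x‖ := by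
    simpa [dist_eq_norm] using hK.le_mul_dist x 0
  refine h1.trans (mul_le_mul_of_nonneg_left ?_ K.2)
  rw [pi_norm_le_iff_of_nonneg (by positivity)]
  intro j
  change |inner ℝ x (v j)| ≤ _
  have hu : ∀ k, inner ℝ x (v k) ≤ M := fun k => (hx k).trans (ht k)
  have hl : -inner ℝ x (v j) ≤ B := by
    have h' := hB (shift v (-x)) (fun k => by
      simp only [shift, inner_neg_left]; linarith [hu k]) (level_shift h _).le j
    simpa only [shift, inner_neg_left] using h'
  rw [abs_le]
  constructor <;> linarith [hu j, le_abs_self M, abs_nonneg M]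

theorem convex_polytope (v : J → Space d) (t : J → ℝ) : Convex ℝ (polytope v t) := by
  intro x hx y hy a b ha hb hab j
  rw [inner_add_left, real_inner_smul_left, real_inner_smul_left]
  calc _ ≤ a * t j + b * t j :=
        add_le_add (mul_le_mul_of_nonneg_left (hx j) ha) (mul_le_mul_of_nonneg_left (hy j) hb)
    _ = t j := by rw [← add_mul, hab, one_mul]

theorem isClosed_polytope (v : J → Space d) (t : J → ℝ) : IsClosed (polytope v t) := by
  simp only [polytope, ofPred_forall]
  exact isClosed_iInter fun j => isClosed_le (by fun_prop) continuous_const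

theorem isCompact_polytope (h : IsBalanced v l) (t : J → ℝ) : IsCompact (polytope v t) := by
  obtain ⟨R, hR⟩ := exists_norm_le_of_mem_polytope h (∑ j, |t j|)
  refine Metric.isCompact_of_isClosed_isBounded (isClosed_polytope v t) ?_
  refine isBounded_iff_forall_norm_le.2 ⟨R, hR t fun j => (le_abs_self _).trans ?_⟩
  exact Finset.single_le_sum (f := fun j => |t j|) (fun _ _ => abs_nonneg _) (Finset.mem_univ j)

theorem interior_polytope (h : IsBalanced v l) (t : J → ℝ) :
    interior (polytope v t) = {x | ∀ j, inner ℝ x (v j) < t j} := by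
  apply Subset.antisymm
  · intro x hx j
    refine lt_of_le_of_ne (interior_subset hx j) fun heq => ?_
    have hc : Tendsto (fun s : ℝ => x + s • v j) (𝓝[>] 0) (𝓝 x) := by
      have : Continuous fun s : ℝ => x + s • v j := by fun_prop
      simpa using (this.tendsto 0).mono_left nhdsWithin_le_nhds
    obtain ⟨s, hs, hs0⟩ := ((hc.eventually (mem_interior_iff_mem_nhds.1 hx)).and
      self_mem_nhdsWithin).exists
    have := hs j
    rw [inner_add_left, real_inner_smul_left, real_inner_self_eq_norm_sq, h.norm_eq, heq] at this
    have : 0 < s := hs0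
    linarith
  · refine interior_maximal (fun x hx j => (hx j).le) ?_
    simp only [ofPred_forall]
    exact isOpen_iInter_of_finite fun j => isOpen_lt (by fun_prop) continuous_const

theorem isOpen_solid (v : J → Space d) : IsOpen (solid v) := by
  simp only [solid, ofPred_exists, ofPred_forall]
  exact isOpen_iUnion fun x => isOpen_iInter_of_finite fun j =>
    isOpen_lt continuous_const (by fun_prop)

theorem isOpen_irredundant (v : J → Space d) : IsOpen (irredundant v) := by
  simp only [irredundant, ofPred_exists, ofPred_forall, ofPred_and]
  exact isOpen_iInter_of_finite fun j => isOpen_iUnion fun x =>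
    (isOpen_iInter_of_finite fun k => isOpen_iInter_of_finite fun _ =>
      isOpen_lt continuous_const (by fun_prop)).inter (isOpen_lt (by fun_prop) continuous_const)

theorem smul_add_shift_mem_solid {r : ℝ} (hr : 0 < r) (x : Space d) (ht : t ∈ solid v) :
    r • t + shift v x ∈ solid v := by
  obtain ⟨y, hy⟩ := ht
  refine ⟨r • y + x, fun j => ?_⟩
  rw [inner_add_left, real_inner_smul_left]
  exact add_lt_add_left (mul_lt_mul_of_pos_left (hy j) hr) _

theorem smul_add_shift_mem_irredundant {r : ℝ} (hr : 0 < r) (x : Space d)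
    (ht : t ∈ irredundant v) : r • t + shift v x ∈ irredundant v := by
  intro j
  obtain ⟨y, hy, hj⟩ := ht j
  refine ⟨r • y + x, fun k hk => ?_, ?_⟩ <;> rw [inner_add_left, real_inner_smul_left]
  · exact add_lt_add_left (mul_lt_mul_of_pos_left (hy k hk) hr) _
  · exact add_lt_add_left (mul_lt_mul_of_pos_left hj hr) _

theorem polytope_smul_add_shift {r : ℝ} (hr : 0 < r) (x : Space d) (t : J → ℝ) :
    polytope v (r • t + shift v x) = (fun y => r • y + x) '' polytope v t := by
  ext z
  constructor
  · intro hz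
    refine ⟨r⁻¹ • (z - x), fun j => ?_, ?_⟩
    · have := hz j
      simp only [Pi.add_apply, Pi.smul_apply, smul_eq_mul, shift] at this
      rw [real_inner_smul_left, inner_sub_left, inv_mul_le_iff₀ hr]
      linarith
    · simp [smul_smul, mul_inv_cancel₀ hr.ne']
  · rintro ⟨y, hy, rfl⟩ j
    simp only [inner_add_left, real_inner_smul_left, Pi.add_apply, Pi.smul_apply, smul_eq_mul,
      shift]
    linarith [mul_le_mul_of_nonneg_left (hy j) hr.le]

instance instInhabitedFatBody : Inhabited (FatBody d) :=
  ⟨⟨⟨Metric.closedBall 0 1, convex_closedBall 0 1, isCompact_closedBall 0 1, ⟨0, by simp⟩⟩,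
    ⟨0, mem_interior.2 ⟨Metric.ball 0 1, Metric.ball_subset_closedBall, Metric.isOpen_ball,
      by simp⟩⟩⟩⟩

open Classical in
/-- The polytope as a convex body with interior points; a default body if it is not one. -/
def body (v : J → Space d) (t : J → ℝ) : FatBody d :=
  if h : IsCompact (polytope v t) ∧ (interior (polytope v t)).Nonempty then
    ⟨⟨polytope v t, convex_polytope v t, h.1, h.2.mono interior_subset⟩, h.2⟩
  else default

theorem coe_body (h : IsBalanced v l) (ht : t ∈ solid v) :
    ((body v t).1 : Set (Space d)) = polytope v t := by
  have : IsCompact (polytope v t) ∧ (interior (polytope v t)).Nonempty :=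
    ⟨isCompact_polytope h t, by rw [interior_polytope h]; exact ht⟩
  unfold body
  rw [dif_pos this]
  rfl

theorem mem_body (h : IsBalanced v l) (ht : t ∈ solid v) {x : Space d} :
    x ∈ (body v t).1 ↔ ∀ j, inner ℝ x (v j) ≤ t j := by
  rw [← SetLike.mem_coe, coe_body h ht]; rfl

theorem body_smul_add_shift (h : IsBalanced v l) (ht : t ∈ solid v) {r : ℝ} (hr : 0 < r)
    (x : Space d) : body v (r • t + shift v x) = FatBody.smulAdd r hr x (body v t) := by
  apply Subtype.ext
  apply ConvexBody.ext
  change _ = ((smulAdd r x (body v t).1 : ConvexBody (Space d)) : Set (Space d))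
  rw [coe_body h (smul_add_shift_mem_solid hr x ht), coe_smulAdd, coe_body h ht,
    polytope_smul_add_shift hr]

/-- Fix a point `x₀` with slack at least `δ` in every constraint of `t₀`. Contracting towards `x₀`
by a fraction of order `‖t - t₀‖ / δ` absorbs the perturbation of the constraints and moves points
by at most that fraction of the diameter bound `2 * R`. -/
theorem continuousOn_body (h : IsBalanced v l) : ContinuousOn (body v) (solid v) := by
  intro t₀ ht₀
  obtain ⟨x₀, hx₀⟩ := id ht₀
  have : ∃ δ > 0, ∀ j, δ ≤ t₀ j - inner ℝ x₀ (v j) := by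
    have hev : ∀ᶠ δ : ℝ in 𝓝[>] 0, ∀ j, δ ≤ t₀ j - inner ℝ x₀ (v j) :=
      eventually_all.2 fun j => (Iic_mem_nhds (sub_pos.2 (hx₀ j))) |> mem_nhdsWithin_of_mem_nhds
    obtain ⟨δ, h1, h2⟩ := (hev.and self_mem_nhdsWithin).exists
    exact ⟨δ, h2, h1⟩
  obtain ⟨δ, hδ, hδj⟩ := this
  obtain ⟨R, hR⟩ := exists_norm_le_of_mem_polytope h (∑ j, |t₀ j| + 1)
  have ht₀R : ∀ x ∈ polytope v t₀, ‖x‖ ≤ R := hR t₀ fun j => by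
    have := Finset.single_le_sum (f := fun j => |t₀ j|) (fun _ _ => abs_nonneg _)
      (Finset.mem_univ j)
    linarith [le_abs_self (t₀ j)]
  have hx₀R : ‖x₀‖ ≤ R := ht₀R x₀ fun j => (hx₀ j).le
  have hR0 : 0 ≤ R := (norm_nonneg _).trans hx₀R
  have key : ∀ t ∈ solid v, ‖t - t₀‖ ≤ 1 → ‖t - t₀‖ ≤ δ →
      dist (body v t) (body v t₀) ≤ ‖t - t₀‖ / δ * (2 * R) := by
    intro t ht ht1 htδ
    set ε := ‖t - t₀‖ with hε
    have hε0 : 0 ≤ ε := norm_nonneg _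
    have hj : ∀ j, |t j - t₀ j| ≤ ε := fun j => norm_le_pi_norm (t - t₀) j
    have htR : ∀ x ∈ polytope v t, ‖x‖ ≤ R := hR t fun j => by
      have := Finset.single_le_sum (f := fun j => |t₀ j|) (fun _ _ => abs_nonneg _)
        (Finset.mem_univ j)
      linarith [le_abs_self (t₀ j), (abs_le.1 (hj j)).2]
    have hq0 : 0 ≤ ε / δ := by positivity
    have hq1 : ε / δ ≤ 1 := (div_le_one hδ).2 htδ
    have hqj : ∀ j, ε ≤ ε / δ * (t₀ j - inner ℝ x₀ (v j)) := fun j => by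
      calc ε = ε / δ * δ := by field_simp
        _ ≤ _ := mul_le_mul_of_nonneg_left (hδj j) hq0
    have hdist : ∀ x, ‖x‖ ≤ R → ‖x₀ - x‖ ≤ 2 * R := fun x hx =>
      (norm_sub_le _ _).trans (by linarith)
    refine dist_convexBody_le (by positivity) (fun x hx => ?_) (fun x hx => ?_)
    · rw [mem_body h ht] at hx
      -- With `q = ε / δ`, the remaining factor is `1 - a = 1 / (1 + q)`. It compensates exactly the
      -- growth by `1 + q` of the slack of `x₀` when each constraint is relaxed by `ε ≤ q * slack`.
      set a := ε / δ / (1 + ε / δ) with ha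
      have hpos : 0 < 1 + ε / δ := by positivity
      have ha0 : 0 ≤ a := by positivity
      have haq : a ≤ ε / δ := div_le_self hq0 (by linarith)
      refine ⟨x + a • (x₀ - x), ?_, ?_⟩
      · rw [mem_body h ht₀]
        intro j
        rw [inner_add_left, real_inner_smul_left, inner_sub_left]
        have h1 : inner ℝ x (v j) ≤ t₀ j + ε := (hx j).trans (by linarith [(abs_le.1 (hj j)).2])
        have h2 := hqj j
        have h3 : a = 1 - 1 / (1 + ε / δ) := by rw [ha]; field_simp; ring
        have h4 : (1 / (1 + ε / δ)) * (inner ℝ x (v j) - inner ℝ x₀ (v j)) ≤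
            t₀ j - inner ℝ x₀ (v j) := by
          rw [div_mul_eq_mul_div, one_mul, div_le_iff₀ hpos]
          linarith
        rw [h3]
        linarith
      · rw [dist_eq_norm, show x - (x + a • (x₀ - x)) = -(a • (x₀ - x)) by abel, norm_neg,
          norm_smul, Real.norm_eq_abs, abs_of_nonneg ha0]
        exact mul_le_mul haq (hdist x (htR x hx)) (norm_nonneg _) hq0
    · rw [mem_body h ht₀] at hx
      refine ⟨x + (ε / δ) • (x₀ - x), ?_, ?_⟩
      · rw [mem_body h ht]
        intro j
        rw [inner_add_left, real_inner_smul_left, inner_sub_left]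
        have h1 := (abs_le.1 (hj j)).1
        have h2 := hqj j
        have h3 : (1 - ε / δ) * inner ℝ x (v j) ≤ (1 - ε / δ) * t₀ j :=
          mul_le_mul_of_nonneg_left (hx j) (by linarith)
        linarith
      · rw [dist_eq_norm, show x - (x + (ε / δ) • (x₀ - x)) = -((ε / δ) • (x₀ - x)) by abel,
          norm_neg, norm_smul, Real.norm_eq_abs, abs_of_nonneg hq0]
        exact mul_le_mul_of_nonneg_left (hdist x (ht₀R x hx)) hq0
  rw [ContinuousWithinAt, tendsto_iff_dist_tendsto_zero]
  have hlim : Tendsto (fun t : J → ℝ => ‖t - t₀‖ / δ * (2 * R)) (𝓝[solid v] t₀) (𝓝 0) := by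
    have : Continuous fun t : J → ℝ => ‖t - t₀‖ / δ * (2 * R) := by fun_prop
    simpa using (this.tendsto t₀).mono_left nhdsWithin_le_nhds
  have hsmall : ∀ ε > 0, ∀ᶠ t in 𝓝[solid v] t₀, ‖t - t₀‖ ≤ ε := fun ε hε => by
    have : Metric.closedBall t₀ ε ∈ 𝓝 t₀ := Metric.closedBall_mem_nhds t₀ hε
    filter_upwards [mem_nhdsWithin_of_mem_nhds this] with t ht
    rwa [Metric.mem_closedBall, dist_eq_norm] at ht
  refine squeeze_zero' (Eventually.of_forall fun _ => dist_nonneg) ?_ hlim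
  filter_upwards [hsmall 1 one_pos, hsmall δ hδ, self_mem_nhdsWithin] with t h1 h2 h3
  exact key t h3 h1 h2

theorem body_of_notMem (h : IsBalanced v l) (ht : t ∉ solid v) : body v t = default := by
  unfold body
  rw [dif_neg]
  rintro ⟨-, x, hx⟩
  rw [interior_polytope h] at hx
  exact ht ⟨x, hx⟩

theorem measurable_body (h : IsBalanced v l) : Measurable (body v) := by
  have hS := (isOpen_solid v).measurableSet
  refine measurable_of_restrict_of_restrict_compl hS ?_ ?_
  · exact (continuousOn_iff_continuous_domRestrict.1 (continuousOn_body h)).measurable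
  · have : (solid v)ᶜ.domRestrict (body v) = fun _ => default :=
      funext fun t => body_of_notMem h t.2
    rw [this]
    exact measurable_const

theorem supportFn_body_le (h : IsBalanced v l) (ht : t ∈ solid v) (j : J) :
    supportFn (body v t).1 (v j) ≤ t j :=
  supportFn_le fun _ hx => (mem_body h ht).1 hx j

/-- A convex body that is the polytope of a parameter is that of its support function. -/
theorem body_supportFn (h : IsBalanced v l) (ht : t ∈ solid v) :
    (fun j => supportFn (body v t).1 (v j)) ∈ solid v ∧
      body v (fun j => supportFn (body v t).1 (v j)) = body v t := by
  have hs : (fun j => supportFn (body v t).1 (v j)) ∈ solid v := by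
    obtain ⟨x, hx⟩ := (body v t).2
    refine ⟨x, fun j => ?_⟩
    have hc : Tendsto (fun s : ℝ => x + s • v j) (𝓝[>] 0) (𝓝 x) := by
      have : Continuous fun s : ℝ => x + s • v j := by fun_prop
      simpa using (this.tendsto 0).mono_left nhdsWithin_le_nhds
    obtain ⟨s, hs, hs0⟩ := ((hc.eventually (mem_interior_iff_mem_nhds.1 hx)).and
      self_mem_nhdsWithin).exists
    have := inner_le_supportFn hs (v j)
    rw [inner_add_left, real_inner_smul_left, real_inner_self_eq_norm_sq, h.norm_eq] at this
    have : 0 < s := hs0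
    linarith
  refine ⟨hs, Subtype.ext (ConvexBody.ext (Subset.antisymm ?_ ?_))⟩
  · intro x hx
    rw [coe_body h hs] at hx
    rw [coe_body h ht]
    exact fun j => (hx j).trans (supportFn_body_le h ht j)
  · intro x hx
    rw [coe_body h hs]
    exact fun j => inner_le_supportFn hx (v j)

end Polytopes

/-! ### Facets of polytopes -/

section Facets

variable {d : ℕ} {J : Type*} [Fintype J] {v : J → Space d} {l : J → ℝ} {t : J → ℝ}

/-- If each constraint is slack somewhere on a convex subset of the polytope, then all of them
are slack simultaneously. -/
theorem exists_forall_inner_lt {F : Set (Space d)} (hF : Convex ℝ F) (hne : F.Nonempty)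
    (hP : F ⊆ polytope v t) (s : Finset J) (hs : ∀ j ∈ s, ∃ x ∈ F, inner ℝ x (v j) < t j) :
    ∃ x ∈ F, ∀ j ∈ s, inner ℝ x (v j) < t j := by
  classical
  induction s using Finset.induction_on with
  | empty => exact hne.imp fun x hx => ⟨hx, by simp⟩
  | insert j s _ ih =>
    obtain ⟨x, hx, hxs⟩ := ih fun k hk => hs k (Finset.mem_insert_of_mem hk)
    obtain ⟨y, hy, hyj⟩ := hs j (Finset.mem_insert_self j s)
    -- At the midpoint a constraint is slack as soon as it is slack at one end, because both ends
    -- satisfy it weakly.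
    refine ⟨(1 / 2 : ℝ) • x + (1 / 2 : ℝ) • y,
      hF hx hy (by norm_num) (by norm_num) (by norm_num), fun k hk => ?_⟩
    rw [inner_add_left, real_inner_smul_left, real_inner_smul_left]
    have h1 := hP hx k
    have h2 := hP hy k
    rcases Finset.mem_insert.1 hk with rfl | hk
    · linarith
    · linarith [hxs k hk]

theorem finrank_orthogonal_singleton {w : Space d} (hw : w ≠ 0) :
    Module.finrank ℝ (ℝ ∙ w)ᗮ + 1 = d := by
  have := Submodule.finrank_add_finrank_orthogonal (𝕜 := ℝ) (ℝ ∙ w)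
  rw [finrank_span_singleton hw, finrank_euclideanSpace, Fintype.card_fin] at this
  omega

theorem vectorSpan_le_orthogonal {F : Set (Space d)} {w : Space d} {s : ℝ}
    (hF : ∀ x ∈ F, inner ℝ x w = s) : vectorSpan ℝ F ≤ (ℝ ∙ w)ᗮ := by
  rw [vectorSpan_def, Submodule.span_le]
  rintro _ ⟨x, hx, y, hy, rfl⟩
  rw [SetLike.mem_coe, Submodule.mem_orthogonal_singleton_iff_inner_left]
  simp [vsub_eq_sub, inner_sub_left, hF x hx, hF y hy]

theorem convex_face (v : J → Space d) (t : J → ℝ) (j : J) : Convex ℝ (face v t j) := by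
  refine fun x hx y hy a b ha hb hab => ⟨convex_polytope v t hx.1 hy.1 ha hb hab, ?_⟩
  rw [inner_add_left, real_inner_smul_left, real_inner_smul_left, hx.2, hy.2, ← add_mul, hab,
    one_mul]

theorem IsBalanced.ne_zero (h : IsBalanced v l) (j : J) : v j ≠ 0 := by
  intro h0
  simpa [h0] using h.norm_eq j

/-- A facet of a solid polytope is one of its faces in the given directions. -/
theorem exists_eq_face_of_mem_facets (hd : 2 ≤ d) (h : IsBalanced v l) (ht : t ∈ solid v)
    {F : Set (Space d)} (hF : F ∈ facets (body v t).1) :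
    ∃ j, F = face v t j ∧ Module.finrank ℝ (vectorSpan ℝ F) + 1 = d := by
  obtain ⟨hexp, hdim⟩ := hF
  rw [coe_body h ht] at hexp
  -- The empty set is an exposed face whose vector span has dimension zero; `2 ≤ d` excludes it as a
  -- facet.
  have hne : F.Nonempty := by
    rw [nonempty_iff_ne_empty]
    rintro rfl
    rw [vectorSpan_empty, finrank_bot] at hdim
    omega
  obtain ⟨L, hL⟩ := hexp hne
  have hFP : F ⊆ polytope v t := by rw [hL]; exact fun x hx => hx.1
  have hint : (interior (polytope v t)).Nonempty := by rw [interior_polytope h]; exact ht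
  have hL0 : L ≠ 0 := by
    rintro rfl
    have hFe : F = polytope v t := by rw [hL]; simp
    have h1 : affineSpan ℝ (interior (polytope v t)) = ⊤ := isOpen_interior.affineSpan_eq_top hint
    have h2 : affineSpan ℝ (polytope v t) = ⊤ :=
      top_unique (h1 ▸ affineSpan_mono ℝ interior_subset)
    rw [AffineSubspace.affineSpan_eq_top_iff_vectorSpan_eq_top_of_nonempty ℝ _ _
      (hint.mono interior_subset), ← hFe] at h2
    rw [h2, finrank_top, finrank_euclideanSpace, Fintype.card_fin] at hdim
    omega
  -- Otherwise every constraint is slack somewhere on `F`, so `F` contains an interior point of the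
  -- polytope, where the nonzero functional `L` cannot be maximal.
  have hj : ∃ j, ∀ x ∈ F, inner ℝ x (v j) = t j := by
    by_contra! hcon
    obtain ⟨x, hx, hxs⟩ := exists_forall_inner_lt
      (hexp.convex (convex_polytope v t)) hne hFP Finset.univ
      fun j _ => (hcon j).imp fun y hy => ⟨hy.1, lt_of_le_of_ne (hFP hy.1 j) hy.2⟩
    have hxi : x ∈ interior (polytope v t) := by
      rw [interior_polytope h]; exact fun j => hxs j (Finset.mem_univ j)
    have hmax : IsLocalMax L x := by
      filter_upwards [mem_interior_iff_mem_nhds.1 hxi] with y hy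
      rw [hL] at hx
      exact hx.2 y hy
    have := hmax.hasFDerivAt_eq_zero L.hasFDerivAt
    exact hL0 this
  obtain ⟨j, hj⟩ := hj
  refine ⟨j, Subset.antisymm (fun x hx => ⟨hFP hx, hj x hx⟩) fun y hy => ?_, hdim⟩
  -- By dimension `F` spans every direction orthogonal to `v j`. As `L` is constant on `F`, it is
  -- constant on the whole face in direction `v j`, so that face lies in `F`.
  have hspan : vectorSpan ℝ F = (ℝ ∙ v j)ᗮ := by
    refine Submodule.eq_of_le_of_finrank_eq (vectorSpan_le_orthogonal hj) ?_
    have := finrank_orthogonal_singleton (h.ne_zero j)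
    omega
  have hker : vectorSpan ℝ F ≤ LinearMap.ker (L : Space d →ₗ[ℝ] ℝ) := by
    rw [vectorSpan_def, Submodule.span_le]
    rintro _ ⟨x, hx, z, hz, rfl⟩
    rw [hL] at hx hz
    have := le_antisymm (hx.2 z hz.1) (hz.2 x hx.1)
    simp [vsub_eq_sub, this]
  obtain ⟨x, hx⟩ := hne
  have hyx : y - x ∈ vectorSpan ℝ F := by
    rw [hspan, Submodule.mem_orthogonal_singleton_iff_inner_left, inner_sub_left, hy.2, hj x hx,
      sub_self]
  have hLyx : L y = L x := by
    have := hker hyx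
    simpa [sub_eq_zero] using this
  rw [hL] at hx ⊢
  exact ⟨hy.1, fun z hz => (hx.2 z hz).trans hLyx.ge⟩

/-- A relatively interior point of the face of an irredundant constraint. -/
theorem exists_mem_face_of_irredundant (ht : t ∈ solid v) {j : J}
    (hj : ∃ y, (∀ k, k ≠ j → inner ℝ y (v k) < t k) ∧ t j < inner ℝ y (v j)) :
    ∃ z, inner ℝ z (v j) = t j ∧ ∀ k, k ≠ j → inner ℝ z (v k) < t k := by
  obtain ⟨x, hx⟩ := ht
  obtain ⟨y, hy, hyj⟩ := hj
  set p := inner ℝ x (v j) with hp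
  set q := inner ℝ y (v j) with hq
  have hpt : p < t j := hx j
  have hpq : 0 < q - p := by linarith
  -- This is the point where the segment from `x` to `y` crosses the hyperplane of the `j`-th
  -- constraint.
  refine ⟨((q - t j) / (q - p)) • x + ((t j - p) / (q - p)) • y, ?_, fun k hk => ?_⟩
  · rw [inner_add_left, real_inner_smul_left, real_inner_smul_left, ← hp, ← hq]
    field_simp
    ring
  · rw [inner_add_left, real_inner_smul_left, real_inner_smul_left]
    have h1 : (q - t j) / (q - p) * inner ℝ x (v k) < (q - t j) / (q - p) * t k :=
      mul_lt_mul_of_pos_left (hx k) (div_pos (by linarith) hpq)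
    have h2 : (t j - p) / (q - p) * inner ℝ y (v k) < (t j - p) / (q - p) * t k :=
      mul_lt_mul_of_pos_left (hy k hk) (div_pos (by linarith) hpq)
    have h3 : (q - t j) / (q - p) * t k + (t j - p) / (q - p) * t k = t k := by
      field_simp
      ring
    linarith

/-- A point of the face at which all other constraints are strict can be moved slightly in any
direction orthogonal to `v j` without leaving the face, so the face has full dimension `d - 1`. -/
theorem face_mem_facets (h : IsBalanced v l) (ht : t ∈ solid v) {j : J}
    (hj : ∃ y, (∀ k, k ≠ j → inner ℝ y (v k) < t k) ∧ t j < inner ℝ y (v j)) :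
    face v t j ∈ facets (body v t).1 := by
  obtain ⟨z, hzj, hz⟩ := exists_mem_face_of_irredundant ht hj
  have hzP : z ∈ polytope v t := fun k => by
    by_cases hk : k = j
    · subst hk; exact hzj.le
    · exact (hz k hk).le
  constructor
  · intro _
    refine ⟨innerSL ℝ (v j), ?_⟩
    rw [coe_body h ht]
    ext x
    simp only [face, mem_ofPred_eq, innerSL_apply_apply]
    refine and_congr_right fun hx => ⟨fun hxj y hy => ?_, fun hmax => ?_⟩
    · rw [real_inner_comm, real_inner_comm x, hxj]; exact hy j
    · refine le_antisymm (hx j) ?_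
      have := hmax z hzP
      rwa [real_inner_comm, hzj, real_inner_comm] at this
  · have hspan : vectorSpan ℝ (face v t j) = (ℝ ∙ v j)ᗮ := by
      refine le_antisymm (vectorSpan_le_orthogonal fun x hx => hx.2) fun w hw => ?_
      rw [Submodule.mem_orthogonal_singleton_iff_inner_left] at hw
      have hev : ∀ᶠ s : ℝ in 𝓝[>] 0, ∀ k, k ≠ j → inner ℝ (z + s • w) (v k) < t k := by
        refine eventually_all.2 fun k => ?_
        by_cases hk : k = j
        · exact Eventually.of_forall fun _ hk' => absurd hk hk'
        have hc : Continuous fun s : ℝ => inner ℝ (z + s • w) (v k) := by fun_prop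
        have := (hc.tendsto 0).mono_left (nhdsWithin_le_nhds (s := Ioi 0))
        simp only [zero_smul, add_zero] at this
        filter_upwards [this.eventually_lt_const (hz k hk)] with s hs _ using hs
      obtain ⟨s, hs, hs0⟩ := (hev.and self_mem_nhdsWithin).exists
      have hs0 : (0 : ℝ) < s := hs0
      have hzs : inner ℝ (z + s • w) (v j) = t j := by
        rw [inner_add_left, real_inner_smul_left, hw, hzj, mul_zero, add_zero]
      have hmem : z + s • w ∈ face v t j := ⟨fun k => by
        by_cases hk : k = j
        · subst hk; exact hzs.le
        · exact (hs k hk).le, hzs⟩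
      have := vsub_mem_vectorSpan ℝ hmem (⟨hzP, hzj⟩ : z ∈ face v t j)
      rw [vsub_eq_sub, add_sub_cancel_left] at this
      simpa [smul_smul, inv_mul_cancel₀ hs0.ne'] using Submodule.smul_mem _ s⁻¹ this
    rw [hspan, finrank_orthogonal_singleton (h.ne_zero j)]

/-- The constraint that defines a facet is irredundant. -/
theorem irredundant_of_finrank_face (h : IsBalanced v l) (hd : 2 ≤ d) (ht : t ∈ solid v) {j : J}
    (hj : Module.finrank ℝ (vectorSpan ℝ (face v t j)) + 1 = d) :
    ∃ y, (∀ k, k ≠ j → inner ℝ y (v k) < t k) ∧ t j < inner ℝ y (v j) := by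
  classical
  have hne : (face v t j).Nonempty := by
    rw [nonempty_iff_ne_empty]
    intro h0
    rw [h0, vectorSpan_empty, finrank_bot] at hj
    omega
  have hslack : ∀ k ∈ Finset.univ.erase j, ∃ x ∈ face v t j, inner ℝ x (v k) < t k := by
    intro k hk
    by_contra! hcon
    have heq : ∀ x ∈ face v t j, inner ℝ x (v k) = t k :=
      fun x hx => le_antisymm (hx.1 k) (hcon x hx)
    have h1 := finrank_orthogonal_singleton (h.ne_zero j)
    have h2 := finrank_orthogonal_singleton (h.ne_zero k)
    have e1 : vectorSpan ℝ (face v t j) = (ℝ ∙ v j)ᗮ :=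
      Submodule.eq_of_le_of_finrank_eq (vectorSpan_le_orthogonal fun x hx => hx.2) (by omega)
    have e2 : vectorSpan ℝ (face v t j) = (ℝ ∙ v k)ᗮ :=
      Submodule.eq_of_le_of_finrank_eq (vectorSpan_le_orthogonal heq) (by omega)
    -- Two constraints active on a set of dimension `d - 1` have proportional normals. Equal normals
    -- contradict injectivity; opposite ones would give a slab of width zero, which has no interior
    -- point.
    have e3 : (ℝ ∙ v j) = (ℝ ∙ v k) := by
      rw [← Submodule.orthogonal_orthogonal (ℝ ∙ v j), ← e1, e2, Submodule.orthogonal_orthogonal]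
    obtain ⟨r, hr⟩ := Submodule.mem_span_singleton.1 (e3 ▸ Submodule.mem_span_singleton_self (v j))
    have hr1 : |r| = 1 := by
      have := congrArg norm hr
      rwa [norm_smul, h.norm_eq, h.norm_eq, mul_one, Real.norm_eq_abs] at this
    rcases eq_or_eq_neg_of_abs_eq hr1 with rfl | rfl
    · rw [one_smul] at hr
      exact Finset.ne_of_mem_erase hk (h.injective hr)
    · obtain ⟨x, hx⟩ := hne
      obtain ⟨y, hy⟩ := ht
      have a1 := hx.2
      have a2 := heq x hx
      have a3 := hy j
      have a4 := hy k
      rw [← hr, real_inner_smul_right] at a1 a3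
      linarith
  obtain ⟨z, hz, hzk⟩ := exists_forall_inner_lt (convex_face v t j) hne (fun x hx => hx.1)
    (Finset.univ.erase j) hslack
  -- A small push along `v j` from a relatively interior point of the face violates the `j`-th
  -- constraint only.
  have hev : ∀ᶠ s : ℝ in 𝓝[>] 0, ∀ k, k ≠ j → inner ℝ (z + s • v j) (v k) < t k := by
    refine eventually_all.2 fun k => ?_
    by_cases hk : k = j
    · exact Eventually.of_forall fun _ hk' => absurd hk hk'
    have hc : Continuous fun s : ℝ => inner ℝ (z + s • v j) (v k) := by fun_prop
    have := (hc.tendsto 0).mono_left (nhdsWithin_le_nhds (s := Ioi 0))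
    simp only [zero_smul, add_zero] at this
    filter_upwards [this.eventually_lt_const (hzk k (by simp [hk]))] with s hs _ using hs
  obtain ⟨s, hs, hs0⟩ := (hev.and self_mem_nhdsWithin).exists
  have hs0 : (0 : ℝ) < s := hs0
  refine ⟨z + s • v j, hs, ?_⟩
  rw [inner_add_left, real_inner_smul_left, real_inner_self_eq_norm_sq, h.norm_eq, hz.2]
  linarith

theorem facetNumber_body_le (hd : 2 ≤ d) (h : IsBalanced v l) (ht : t ∈ solid v) :
    facetNumber (body v t).1 ≤ Fintype.card J := by
  have : facets (body v t).1 ⊆ face v t '' univ := fun F hF => by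
    obtain ⟨j, hj, -⟩ := exists_eq_face_of_mem_facets hd h ht hF
    exact ⟨j, mem_univ j, hj.symm⟩
  calc _ ≤ (face v t '' univ).encard := encard_le_encard this
    _ ≤ (univ : Set J).encard := encard_image_le _ _
    _ = _ := by simp [encard_univ, ENat.card_eq_coe_fintype_card]

/-- A solid polytope has the maximal number of facets if and only if no constraint is
redundant. -/
theorem facetNumber_body_eq_iff (hd : 2 ≤ d) (h : IsBalanced v l) (ht : t ∈ solid v) :
    facetNumber (body v t).1 = Fintype.card J ↔ t ∈ irredundant v := by
  classical
  have huniv : (univ : Set J).encard = Fintype.card J := by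
    simp [encard_univ, ENat.card_eq_coe_fintype_card]
  constructor
  · intro hcard j
    by_contra hj
    have hsub : facets (body v t).1 ⊆ face v t '' {j}ᶜ := fun F hF => by
      obtain ⟨k, rfl, hk⟩ := exists_eq_face_of_mem_facets hd h ht hF
      refine ⟨k, ?_, rfl⟩
      rintro rfl
      exact hj (irredundant_of_finrank_face h hd ht hk)
    have hle : (Fintype.card J : ℕ∞) ≤ ({j}ᶜ : Set J).encard := by
      rw [← hcard]
      exact (encard_le_encard hsub).trans (encard_image_le _ _)
    have hlt : ({j}ᶜ : Set J).encard < (univ : Set J).encard :=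
      (toFinite _).encard_lt_encard (ssubset_univ_iff.2 (by simp))
    exact absurd hle (not_le.2 (huniv ▸ hlt))
  · intro hirr
    have heq : facets (body v t).1 = face v t '' univ := by
      refine Subset.antisymm (fun F hF => ?_) ?_
      · obtain ⟨j, hj, -⟩ := exists_eq_face_of_mem_facets hd h ht hF
        exact ⟨j, mem_univ j, hj.symm⟩
      · rintro _ ⟨j, -, rfl⟩
        exact face_mem_facets h ht (hirr j)
    rw [facetNumber, heq, InjOn.encard_image, huniv]
    -- A relatively interior point of one face satisfies all other constraints strictly, so
    -- different indices give different faces.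
    intro j _ k _ hjk
    by_contra hne
    obtain ⟨z, hzj, hz⟩ := exists_mem_face_of_irredundant ht (hirr j)
    have hzf : z ∈ face v t j := ⟨fun i => by
      by_cases hi : i = j
      · subst hi; exact hzj.le
      · exact (hz i hi).le, hzj⟩
    rw [hjk] at hzf
    exact (hz k (Ne.symm hne)).ne hzf.2

/-- The parameters for which every half-space touches the polytope. -/
def tight (v : J → Space d) : Set (J → ℝ) := {t | ∀ j, (face v t j).Nonempty}

theorem irredundant_subset_tight : solid v ∩ irredundant v ⊆ tight v := by
  rintro t ⟨ht, hirr⟩ j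
  obtain ⟨z, hzj, hz⟩ := exists_mem_face_of_irredundant ht (hirr j)
  exact ⟨z, fun i => by
      by_cases hi : i = j
      · subst hi; exact hzj.le
      · exact (hz i hi).le, hzj⟩

theorem mem_tight_iff (h : IsBalanced v l) (ht : t ∈ solid v) :
    t ∈ tight v ↔ ∀ j, supportFn (body v t).1 (v j) = t j := by
  refine forall_congr' fun j => ⟨fun ⟨x, hx, hxj⟩ => ?_, fun hj => ?_⟩
  · exact le_antisymm (supportFn_body_le h ht j)
      (hxj ▸ inner_le_supportFn ((mem_body h ht).2 hx) (v j))
  · obtain ⟨x, hx, hxj⟩ := exists_inner_eq_supportFn (body v t).1 (v j)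
    exact ⟨x, (mem_body h ht).1 hx, hxj.trans hj⟩

/-- Constraints that touch the polytope without defining a facet occur with measure zero. -/
theorem volume_tight_diff_irredundant :
    volume ((solid v ∩ tight v) \ irredundant v) = 0 := by
  classical
  let A : J → Set (J → ℝ) := fun j => {t | (face v t j).Nonempty}
  -- Convexity makes the frontier Lebesgue null; it remains to place the exceptional parameters on
  -- one of these frontiers.
  have hconv : ∀ j, Convex ℝ (A j) := by
    rintro j s ⟨x, hx, hxj⟩ t ⟨y, hy, hyj⟩ a b ha hb hab
    refine ⟨a • x + b • y, fun k => ?_, ?_⟩ <;>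
      simp only [inner_add_left, real_inner_smul_left, Pi.add_apply, Pi.smul_apply, smul_eq_mul]
    · exact add_le_add (mul_le_mul_of_nonneg_left (hx k) ha) (mul_le_mul_of_nonneg_left (hy k) hb)
    · rw [hxj, hyj]
  refine measure_mono_null (t := ⋃ j, frontier (A j)) ?_
    ((measure_iUnion_null_iff).2 fun j => (hconv j).addHaar_frontier volume)
  rintro t ⟨⟨ht, htight⟩, hirr⟩
  simp only [irredundant, mem_ofPred_eq, not_forall] at hirr
  obtain ⟨j, hj⟩ := hirr
  refine mem_iUnion.2 ⟨j, subset_closure (htight j), fun hint => hj ?_⟩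
  -- If `t` were interior to `A j`, the `j`-th half-space could be enlarged and would still touch.
  -- The new touching point, moved slightly towards an interior point, violates only the original
  -- `j`-th constraint.
  have hc : Tendsto (fun s : ℝ => t + s • (Pi.single j 1 : J → ℝ)) (𝓝[>] 0) (𝓝 t) := by
    have : Continuous fun s : ℝ => t + s • (Pi.single j 1 : J → ℝ) := by fun_prop
    simpa using (this.tendsto 0).mono_left nhdsWithin_le_nhds
  obtain ⟨s, ⟨y, hy, hyj⟩, hs0⟩ := ((hc.eventually (mem_interior_iff_mem_nhds.1 hint)).and
    self_mem_nhdsWithin).exists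
  have hs0 : (0 : ℝ) < s := hs0
  obtain ⟨x, hx⟩ := ht
  have hyj' : t j < inner ℝ y (v j) := by
    rw [hyj]; simp [hs0]
  have hev : ∀ᶠ q : ℝ in 𝓝[>] 0, q < 1 ∧ t j < inner ℝ (y + q • (x - y)) (v j) := by
    have hc : Continuous fun q : ℝ => inner ℝ (y + q • (x - y)) (v j) := by fun_prop
    have := (hc.tendsto 0).mono_left (nhdsWithin_le_nhds (s := Ioi 0))
    simp only [zero_smul, add_zero] at this
    filter_upwards [this.eventually_const_lt hyj', Ioo_mem_nhdsGT (zero_lt_one' ℝ)] with q h1 h2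
    exact ⟨h2.2, h1⟩
  obtain ⟨q, ⟨hq1, hq⟩, hq0⟩ := (hev.and self_mem_nhdsWithin).exists
  have hq0 : (0 : ℝ) < q := hq0
  refine ⟨y + q • (x - y), fun k hk => ?_, hq⟩
  have h1 : inner ℝ y (v k) ≤ t k := by
    have := hy k
    simpa [Pi.single_eq_of_ne hk] using this
  rw [inner_add_left, real_inner_smul_left, inner_sub_left]
  nlinarith [hx k, mul_lt_mul_of_pos_left (hx k) hq0,
    mul_le_mul_of_nonneg_left h1 (sub_nonneg.2 hq1.le)]

/-- The set of parameters without redundant constraints is non-empty. -/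
theorem one_mem_irredundant (h : IsBalanced v l) :
    (1 : J → ℝ) ∈ solid v ∩ irredundant v := by
  refine ⟨⟨0, fun j => by simp⟩, fun j => ?_⟩
  -- Distinct unit vectors have inner product below one, so a multiple of `v j` slightly longer than
  -- one violates only the `j`-th constraint.
  have hlt : ∀ k, k ≠ j → inner ℝ (v j) (v k) < (1 : ℝ) := fun k hk => by
    refine lt_of_le_of_ne ?_ fun heq => hk ?_
    · simpa [h.norm_eq] using real_inner_le_norm (v j) (v k)
    · exact (h.injective ((inner_eq_one_iff_of_norm_eq_one (h.norm_eq j) (h.norm_eq k)).1 heq)).symm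
  have hev : ∀ᶠ s : ℝ in 𝓝[>] 1, ∀ k, k ≠ j → inner ℝ (s • v j) (v k) < (1 : ℝ) := by
    refine eventually_all.2 fun k => ?_
    by_cases hk : k = j
    · exact Eventually.of_forall fun _ hk' => absurd hk hk'
    have hc : Continuous fun s : ℝ => inner ℝ (s • v j) (v k) := by fun_prop
    have := (hc.tendsto 1).mono_left (nhdsWithin_le_nhds (s := Ioi 1))
    simp only [one_smul] at this
    filter_upwards [this.eventually_lt_const (hlt k hk)] with s hs _ using hs
  obtain ⟨s, hs, hs0⟩ := (hev.and self_mem_nhdsWithin).exists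
  refine ⟨s • v j, fun k hk => hs k hk, ?_⟩
  rw [real_inner_smul_left, real_inner_self_eq_norm_sq, h.norm_eq]
  simpa using hs0

end Facets

/-! ### The scaling property of the polytope parameters -/

section Scaling

variable {d : ℕ} {J : Type*} [Fintype J] {v : J → Space d} {l : J → ℝ} {c : FatBody d → Space d}

/-- The unit cube. -/
def cube (d : ℕ) : Set (Space d) := {x | ∀ i, x i ∈ Icc (0 : ℝ) 1}

theorem measurableSet_cube : MeasurableSet (cube d) := by
  simp only [cube, ofPred_forall]
  exact MeasurableSet.iInter fun i => (measurableSet_Icc).preimage (by fun_prop)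

theorem isBounded_cube : Bornology.IsBounded (cube d) := by
  refine isBounded_iff_forall_norm_le.2 ⟨√(∑ _i : Fin d, (1 : ℝ)), fun x hx => ?_⟩
  rw [EuclideanSpace.norm_eq]
  refine Real.sqrt_le_sqrt (Finset.sum_le_sum fun i _ => ?_)
  rw [Real.norm_eq_abs, sq_abs]
  have := hx i
  nlinarith [this.1, this.2]

theorem volume_cube_ne_zero : volume (cube d) ≠ 0 := by
  have hopen : IsOpen {x : Space d | ∀ i, x i ∈ Ioo (0 : ℝ) 1} := by
    simp only [ofPred_forall]
    exact isOpen_iInter_of_finite fun i => isOpen_Ioo.preimage (by fun_prop)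
  have hne : {x : Space d | ∀ i, x i ∈ Ioo (0 : ℝ) 1}.Nonempty :=
    ⟨WithLp.toLp 2 fun _ => 1 / 2, fun i => by norm_num⟩
  refine fun h0 => (hopen.measure_pos volume hne).ne' (measure_mono_null ?_ h0)
  exact fun x hx i => Ioo_subset_Icc_self (hx i)

/-- Sets of parameters that are invariant under homotheties of the polytopes. -/
structure IsHomothetic (v : J → Space d) (B : Set (J → ℝ)) : Prop where
  measurableSet : MeasurableSet B
  subset_solid : B ⊆ solid v
  smul_add_shift_mem : ∀ r : ℝ, 0 < r → ∀ (x : Space d), ∀ t ∈ B, r • t + shift v x ∈ B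

/-- The parameters in `B` of level at most `r` for polytopes with center in `A`. -/
def levelSet (v : J → Space d) (l : J → ℝ) (c : FatBody d → Space d) (B : Set (J → ℝ))
    (A : Set (Space d)) (r : ℝ) : Set (J → ℝ) :=
  {t | t ∈ B ∧ c (body v t) ∈ A ∧ level l t ≤ r}

theorem center_smul_add_shift (h : IsBalanced v l) (hc : IsCenterFunction c) {t : J → ℝ}
    (ht : t ∈ solid v) {r : ℝ} (hr : 0 < r) (x : Space d) :
    c (body v (r • t + shift v x)) = r • c (body v t) + x := by
  rw [body_smul_add_shift h ht hr, hc.map_smulAdd]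

theorem measurable_center (h : IsBalanced v l) (hc : IsCenterFunction c) :
    Measurable fun t => c (body v t) :=
  hc.measurable.comp (measurable_body h)

/-- The center belongs to the polytope, so a bounded center bounds every `t j` below; the level then
bounds it above. -/
theorem volume_levelSet_lt_top (h : IsBalanced v l) (hc : IsCenterFunction c) {B : Set (J → ℝ)}
    (hB : B ⊆ solid v) {A : Set (Space d)} (hA : Bornology.IsBounded A) (r : ℝ) :
    volume (levelSet v l c B A r) < ∞ := by
  obtain ⟨R, hR⟩ := isBounded_iff_forall_norm_le.1 hA
  obtain ⟨M, hM0, hM⟩ := exists_bound_of_level_le h R r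
  have hsub : levelSet v l c B A r ⊆ Icc (fun _ => -R) (fun _ => M) := by
    rintro t ⟨htB, hcA, hr⟩
    have hlow : ∀ j, -R ≤ t j := fun j => by
      have h1 := (mem_body h (hB htB)).1 (hc.mem (body v t)) j
      have h2 := abs_real_inner_le_norm (c (body v t)) (v j)
      rw [h.norm_eq, mul_one] at h2
      linarith [(abs_le.1 (h2.trans (hR _ hcA))).1]
    exact ⟨hlow, hM t hlow hr⟩
  exact (measure_mono hsub).trans_lt isCompact_Icc.measure_lt_top

theorem IsHomothetic.measurableSet_levelSet (h : IsBalanced v l) (hc : IsCenterFunction c)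
    {B : Set (J → ℝ)} (hB : IsHomothetic v B) {A : Set (Space d)} (hA : MeasurableSet A) (r : ℝ) :
    MeasurableSet (levelSet v l c B A r) :=
  hB.measurableSet.inter ((measurable_center h hc hA).inter
    (measurableSet_le (continuous_level l).measurable measurable_const))

/-- The volume of a level set is proportional to the volume of the set of centers. -/
theorem IsHomothetic.exists_volume_levelSet (h : IsBalanced v l) (hc : IsCenterFunction c)
    {B : Set (J → ℝ)} (hB : IsHomothetic v B) :
    ∃ C : ℝ≥0∞, ∀ A : Set (Space d), MeasurableSet A →
      volume (levelSet v l c B A 1) = C * volume A := by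
  have hL : MeasurableSet {t | t ∈ B ∧ level l t ≤ 1} :=
    hB.measurableSet.inter (measurableSet_le (continuous_level l).measurable measurable_const)
  have hκ := measurable_center h hc
  set ν : Measure (Space d) :=
    (volume.restrict {t | t ∈ B ∧ level l t ≤ 1}).map fun t => c (body v t) with hν
  have hνA : ∀ A, MeasurableSet A → ν A = volume (levelSet v l c B A 1) := by
    intro A hA
    rw [hν, Measure.map_apply hκ hA, Measure.restrict_apply (hκ hA)]
    congr 1
    ext t
    simp only [levelSet, mem_inter_iff, mem_preimage, mem_ofPred_eq]
    tauto
  have hfin : IsFiniteMeasureOnCompacts ν := ⟨fun K hK => by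
    rw [hνA K hK.measurableSet]
    exact volume_levelSet_lt_top h hc hB.subset_solid hK.isBounded 1⟩
  -- Adding `shift v x` to a parameter preserves Lebesgue measure, `B` and the level, and moves the
  -- center by `x`. So the image measure on centers is translation invariant and, by uniqueness of
  -- Haar measure, a multiple of volume.
  have hinv : ν.IsAddLeftInvariant := ⟨fun x => by
    ext A hA
    rw [Measure.map_apply (measurable_const_add x) hA, hνA A hA,
      hνA _ (measurable_const_add x hA), ← measure_preimage_add volume (shift v x) (levelSet v l c B A 1)]
    congr 1
    ext t
    have hmem : ∀ x : Space d, ∀ t ∈ B, shift v x + t ∈ B := fun x t ht => by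
      have := hB.smul_add_shift_mem 1 one_pos x t ht
      rwa [one_smul, add_comm] at this
    have hiff : shift v x + t ∈ B ↔ t ∈ B := by
      refine ⟨fun ht => ?_, hmem x t⟩
      have := hmem (-x) _ ht
      rwa [← add_assoc, ← shift_add, neg_add_cancel, show shift v (0 : Space d) = 0 by
        ext j; simp [shift], zero_add] at this
    simp only [levelSet, mem_preimage, mem_ofPred_eq, hiff]
    refine and_congr_right fun ht => ?_
    have h1 := center_smul_add_shift h hc (hB.subset_solid ht) one_pos x
    have h2 := level_smul_add_shift h 1 t x
    rw [one_smul, add_comm] at h1 h2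
    rw [h1, h2, one_smul, one_mul, add_comm]⟩
  refine ⟨Measure.addHaarScalarFactor ν volume, fun A hA => ?_⟩
  rw [← hνA A hA]
  conv_lhs => rw [Measure.isAddLeftInvariant_eq_smul ν volume]
  rfl

/-- Rescaling the parameters contributes `r ^ card J` but shrinks the cube of centers by `r⁻¹`,
which costs `r ^ d`; this leaves the exponent `m`. -/
theorem IsHomothetic.volume_levelSet_cube (h : IsBalanced v l) (hc : IsCenterFunction c)
    {B : Set (J → ℝ)} (hB : IsHomothetic v B) {m : ℕ} (hm : Fintype.card J = m + d)
    {r : ℝ} (hr : 0 < r) :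
    volume (levelSet v l c B (cube d) r) =
      ENNReal.ofReal (r ^ m) * volume (levelSet v l c B (cube d) 1) := by
  obtain ⟨C, hC⟩ := hB.exists_volume_levelSet h hc
  have hset : levelSet v l c B (cube d) r = r • levelSet v l c B (r⁻¹ • cube d) 1 := by
    ext t
    rw [mem_smul_set_iff_inv_smul_mem₀ hr.ne']
    have hmem : ∀ s > 0, ∀ t ∈ B, (s : ℝ) • t ∈ B := fun s hs t ht => by
      have := hB.smul_add_shift_mem s hs 0 t ht
      rwa [show shift v (0 : Space d) = 0 by ext j; simp [shift], add_zero] at this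
    have hiff : r⁻¹ • t ∈ B ↔ t ∈ B := by
      refine ⟨fun ht => ?_, hmem _ (inv_pos.2 hr) t⟩
      have := hmem r hr _ ht
      rwa [smul_smul, mul_inv_cancel₀ hr.ne', one_smul] at this
    simp only [levelSet, mem_ofPred_eq, hiff]
    refine and_congr_right fun ht => ?_
    have h1 := center_smul_add_shift h hc (hB.subset_solid ht) (inv_pos.2 hr) 0
    have h2 := level_smul_add_shift h r⁻¹ t 0
    rw [show shift v (0 : Space d) = 0 by ext j; simp [shift], add_zero] at h1 h2
    rw [h1, h2, add_zero, smul_mem_smul_set_iff₀ (inv_ne_zero hr.ne'), inv_mul_le_iff₀ hr,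
      mul_one]
  have hcube : MeasurableSet (r⁻¹ • cube d) :=
    measurableSet_cube.const_smul₀ _
  rw [hset, Measure.addHaar_smul, hC _ hcube, hC _ measurableSet_cube, Measure.addHaar_smul,
    Module.finrank_fintype_fun_eq_card, finrank_euclideanSpace, Fintype.card_fin, hm,
    abs_of_pos (pow_pos hr _), abs_of_pos (pow_pos (inv_pos.2 hr) _), mul_left_comm C,
    ← mul_assoc, ← ENNReal.ofReal_mul (by positivity)]
  congr 2
  rw [pow_add, inv_pow, mul_assoc, mul_inv_cancel₀ (by positivity), mul_one]

/-- The density `m x ^ (m - 1)` on the positive half-line. -/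
def powerLaw (m : ℕ) : Measure ℝ :=
  (volume.restrict (Ioi 0)).withDensity fun x => ENNReal.ofReal (m * x ^ (m - 1))

theorem powerLaw_Iic {m : ℕ} (hm : 1 ≤ m) {b : ℝ} (hb : 0 ≤ b) :
    powerLaw m (Iic b) = ENNReal.ofReal (b ^ m) := by
  rw [powerLaw, withDensity_apply _ measurableSet_Iic, Measure.restrict_restrict measurableSet_Iic,
    Iic_inter_Ioi, ← ofReal_integral_eq_lintegral_ofReal]
  · congr 1
    rw [← intervalIntegral.integral_of_le hb, intervalIntegral.integral_const_mul, integral_pow,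
      Nat.sub_add_cancel hm, zero_pow (by omega), sub_zero, Nat.cast_sub hm]
    have : (m : ℝ) ≠ 0 := by positivity
    simp only [Nat.cast_one, sub_add_cancel]
    field_simp
  · exact (Continuous.integrableOn_Icc (by fun_prop)).mono_set Ioc_subset_Icc_self
  · refine (ae_restrict_iff' measurableSet_Ioc).2 (Eventually.of_forall fun x hx => ?_)
    have := hx.1.le
    change (0 : ℝ) ≤ _
    positivity

theorem powerLaw_Iic_zero (m : ℕ) : powerLaw m (Iic 0) = 0 := by
  rw [powerLaw, withDensity_apply _ measurableSet_Iic, Measure.restrict_restrict measurableSet_Iic,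
    Iic_inter_Ioi, Ioc_self, Measure.restrict_empty, lintegral_zero_measure]

/-- Two measures with the same finite values on lower half-lines are equal. -/
theorem ext_of_Iic_of_lt_top {μ ν : Measure ℝ} (hfin : ∀ b, μ (Iic b) < ∞)
    (heq : ∀ b, μ (Iic b) = ν (Iic b)) : μ = ν := by
  have hμ : IsLocallyFiniteMeasure μ :=
    ⟨fun x => ⟨Iic (x + 1), Iic_mem_nhds (by linarith), hfin _⟩⟩
  refine Measure.ext_of_Ioc μ ν fun a b hab => ?_
  rw [← Iic_sdiff_Iic, measure_sdiff (Iic_subset_Iic.2 hab.le) measurableSet_Iic.nullMeasurableSet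
    (hfin a).ne, measure_sdiff (Iic_subset_Iic.2 hab.le) measurableSet_Iic.nullMeasurableSet
    (heq a ▸ (hfin a).ne), heq, heq]

/-- The integral of a function of the level over the parameters of polytopes with center in the
cube. -/
theorem IsHomothetic.lintegral_level [Nonempty J] (h : IsBalanced v l) (hc : IsCenterFunction c)
    {B : Set (J → ℝ)} (hB : IsHomothetic v B) {m : ℕ} (hm : Fintype.card J = m + d) (hm1 : 1 ≤ m)
    {f : ℝ → ℝ≥0∞} (hf : Measurable f) :
    ∫⁻ t in {t | t ∈ B ∧ c (body v t) ∈ cube d}, f (level l t) =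
      volume (levelSet v l c B (cube d) 1) * ∫⁻ x, f x ∂(powerLaw m) := by
  have hE : Measurable (level l) := (continuous_level l).measurable
  have hS : MeasurableSet {t | t ∈ B ∧ c (body v t) ∈ cube d} :=
    hB.measurableSet.inter (measurable_center h hc measurableSet_cube)
  have hmap : ∀ b, ((volume.restrict {t | t ∈ B ∧ c (body v t) ∈ cube d}).map (level l)) (Iic b) =
      volume (levelSet v l c B (cube d) b) := fun b => by
    rw [Measure.map_apply hE measurableSet_Iic, Measure.restrict_apply (hE measurableSet_Iic)]
    congr 1
    ext t
    simp only [levelSet, mem_inter_iff, mem_preimage, mem_ofPred_eq, mem_Iic]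
    tauto
  -- The image of Lebesgue measure under the level is identified on lower half-lines; those ending
  -- at or below zero carry nothing because solid parameters have positive level.
  have key : (volume.restrict {t | t ∈ B ∧ c (body v t) ∈ cube d}).map (level l) =
      volume (levelSet v l c B (cube d) 1) • powerLaw m := by
    refine ext_of_Iic_of_lt_top (fun b => ?_) fun b => ?_
    · rw [hmap]
      exact volume_levelSet_lt_top h hc hB.subset_solid isBounded_cube b
    · rw [hmap, Measure.smul_apply, smul_eq_mul]
      rcases le_or_gt b 0 with hb | hb
      · have h1 : levelSet v l c B (cube d) b = ∅ := by
          rw [eq_empty_iff_forall_notMem]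
          rintro t ⟨htB, -, hle⟩
          linarith [level_pos h (hB.subset_solid htB)]
        have h2 : powerLaw m (Iic b) = 0 :=
          measure_mono_null (Iic_subset_Iic.2 hb) (powerLaw_Iic_zero m)
        rw [h1, h2, measure_empty, mul_zero]
      · rw [hB.volume_levelSet_cube h hc hm hb, powerLaw_Iic hm1 hb.le, mul_comm]
  rw [← lintegral_map hf hE, key, lintegral_smul_measure, smul_eq_mul]

end Scaling

/-! ### Tails of the Gamma law -/

section Tails

/-- The tail of the integral of `exp (-x) m x ^ (m - 1)`. -/
def gammaTail (m : ℕ) (a : ℝ) : ℝ≥0∞ := ∫⁻ x in Ici a, ENNReal.ofReal (Real.exp (-x)) ∂powerLaw m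

/-- The integral of `exp (-x) m x ^ (m - 1)` over the half-line. -/
def gammaTotal (m : ℕ) : ℝ≥0∞ := ∫⁻ x, ENNReal.ofReal (Real.exp (-x)) ∂powerLaw m

variable {m : ℕ}

theorem lintegral_exp_powerLaw_lt_top {b : ℝ} (hb : 0 < b) :
    ∫⁻ x, ENNReal.ofReal (Real.exp (-(b * x))) ∂powerLaw m < ∞ := by
  have hint : IntegrableOn (fun x : ℝ => m * (x ^ ((m - 1 : ℕ) : ℝ) *
      Real.exp (-b * x ^ (1 : ℝ)))) (Ioi 0) :=
    (integrableOn_rpow_mul_exp_neg_mul_rpow (by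
      have : (0 : ℝ) ≤ ((m - 1 : ℕ) : ℝ) := Nat.cast_nonneg _
      linarith) one_pos hb).const_mul _
  rw [powerLaw, lintegral_withDensity_eq_lintegral_mul _ (by fun_prop) (by fun_prop)]
  refine lt_of_le_of_lt (le_of_eq ?_) hint.lintegral_lt_top
  refine setLIntegral_congr_fun measurableSet_Ioi fun x hx => ?_
  have hx : (0 : ℝ) < x := hx
  simp only [Pi.mul_apply, Real.rpow_natCast, Real.rpow_one]
  rw [← ENNReal.ofReal_mul (by positivity), neg_mul, mul_assoc]

theorem gammaTotal_lt_top : gammaTotal m < ∞ := by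
  simpa [gammaTotal] using lintegral_exp_powerLaw_lt_top (m := m) one_pos

theorem gammaTail_le_gammaTotal (a : ℝ) : gammaTail m a ≤ gammaTotal m := setLIntegral_le_lintegral _ _

theorem gammaTail_antitone : Antitone (gammaTail m) := fun _ _ hab =>
  lintegral_mono_set (Ici_subset_Ici.2 hab)

/-- Since `(a + 1) ^ m - a ^ m ≥ 1`, the interval from `a` to `a + 1` already has mass at least one
under `powerLaw m`. This crude bound suffices for the tail comparison. -/
theorem exp_le_gammaTail (hm : 1 ≤ m) {a : ℝ} (ha : 0 ≤ a) :
    ENNReal.ofReal (Real.exp (-(a + 1))) ≤ gammaTail m a := by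
  have h1 : 1 ≤ powerLaw m (Ioc a (a + 1)) := by
    rw [← Iic_sdiff_Iic, measure_sdiff (Iic_subset_Iic.2 (by linarith))
      measurableSet_Iic.nullMeasurableSet (by rw [powerLaw_Iic hm ha]; exact ENNReal.ofReal_ne_top),
      powerLaw_Iic hm ha, powerLaw_Iic hm (by linarith), ← ENNReal.ofReal_sub _ (by positivity),
      ← ENNReal.ofReal_one]
    apply ENNReal.ofReal_le_ofReal
    have := pow_add_pow_le ha zero_le_one (n := m) (by omega)
    rw [one_pow] at this
    linarith
  calc _ ≤ ENNReal.ofReal (Real.exp (-(a + 1))) * powerLaw m (Ioc a (a + 1)) :=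
        le_mul_of_one_le_right' h1
    _ = ∫⁻ _ in Ioc a (a + 1), ENNReal.ofReal (Real.exp (-(a + 1))) ∂powerLaw m := by
        rw [setLIntegral_const]
    _ ≤ ∫⁻ x in Ioc a (a + 1), ENNReal.ofReal (Real.exp (-x)) ∂powerLaw m := by
        refine setLIntegral_mono (by fun_prop) fun x hx => ?_
        apply ENNReal.ofReal_le_ofReal
        exact Real.exp_le_exp.2 (by linarith [hx.2])
    _ ≤ _ := lintegral_mono_set fun x hx => hx.1.le

theorem gammaTail_ne_zero (hm : 1 ≤ m) (a : ℝ) : gammaTail m a ≠ 0 := by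
  have h1 := (exp_le_gammaTail hm (le_max_right a 0)).trans (gammaTail_antitone (le_max_left a 0))
  exact fun h0 => (ENNReal.ofReal_pos.2 (Real.exp_pos _)).ne' (le_zero_iff.1 (h0 ▸ h1))

theorem gammaTail_ne_top (a : ℝ) : gammaTail m a ≠ ∞ :=
  ((gammaTail_le_gammaTotal a).trans_lt gammaTotal_lt_top).ne

/-- Take `e` halfway between `y` and `1`. Giving up the factor `exp (-(1 - e) x)` to integrate the
power leaves the tail at `a / y` of order `exp (-(e / y) a)`, and `e / y > 1` beats the lower bound
`exp (-(a + 1))`. -/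
theorem tendsto_gammaTail_ratio (hm : 1 ≤ m) {y : ℝ} (hy : 0 < y) (hy1 : y < 1) :
    Tendsto (fun a => gammaTail m (a / y) / gammaTail m a) atTop (𝓝 0) := by
  set e : ℝ := (1 + y) / 2 with he
  set C := ∫⁻ x, ENNReal.ofReal (Real.exp (-((1 - e) * x))) ∂powerLaw m with hC
  have hCtop : C ≠ ∞ := (lintegral_exp_powerLaw_lt_top (by rw [he]; linarith)).ne
  have hup : ∀ b, gammaTail m b ≤ ENNReal.ofReal (Real.exp (-(e * b))) * C := by
    intro b
    rw [hC, ← lintegral_const_mul _ (by fun_prop)]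
    refine (setLIntegral_mono (by fun_prop) fun x hx => ?_).trans (setLIntegral_le_lintegral (Ici b) _)
    rw [← ENNReal.ofReal_mul (Real.exp_pos _).le, ← Real.exp_add]
    apply ENNReal.ofReal_le_ofReal
    refine Real.exp_le_exp.2 ?_
    have : e * b ≤ e * x := mul_le_mul_of_nonneg_left hx (by rw [he]; linarith)
    linarith
  have hlim : Tendsto (fun a : ℝ => C * ENNReal.ofReal (Real.exp (1 - (e / y - 1) * a))) atTop
      (𝓝 0) := by
    have hpos : 0 < e / y - 1 := by
      rw [sub_pos, lt_div_iff₀ hy, he]; linarith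
    have h1 : Tendsto (fun a : ℝ => Real.exp (1 - (e / y - 1) * a)) atTop (𝓝 0) :=
      Real.tendsto_exp_atBot.comp (tendsto_const_nhds.add_atBot (f := fun _ : ℝ => (1 : ℝ))
        (tendsto_neg_atTop_atBot.comp (tendsto_id.const_mul_atTop hpos)))
    have h2 := (ENNReal.continuous_ofReal.tendsto 0).comp h1
    rw [ENNReal.ofReal_zero] at h2
    simpa using ENNReal.Tendsto.const_mul h2 (Or.inr hCtop)
  refine tendsto_of_tendsto_of_tendsto_of_le_of_le' tendsto_const_nhds hlim
    (Eventually.of_forall fun _ => zero_le) ?_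
  filter_upwards [eventually_ge_atTop 0] with a ha
  have hlow := exp_le_gammaTail hm ha
  calc gammaTail m (a / y) / gammaTail m a
      ≤ ENNReal.ofReal (Real.exp (-(e * (a / y)))) * C / ENNReal.ofReal (Real.exp (-(a + 1))) :=
        ENNReal.div_le_div (hup _) hlow
    _ = C * ENNReal.ofReal (Real.exp (1 - (e / y - 1) * a)) := by
        rw [mul_comm, mul_div_assoc, ← ENNReal.ofReal_div_of_pos (Real.exp_pos _), ← Real.exp_sub]
        congr 3
        field_simp
        ring

end Tails

/-! ### Large polytopes -/

section Large

variable {d : ℕ} {J : Type*} [Fintype J] {v : J → Space d} {l : J → ℝ} {c : FatBody d → Space d}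

/-- The level of the support function of a body. -/
def content (v : J → Space d) (l : J → ℝ) (K : ConvexBody (Space d)) : ℝ :=
  ∑ j, l j * supportFn K (v j)

theorem continuous_content (v : J → Space d) (l : J → ℝ) : Continuous (content v l) :=
  continuous_finsetSum _ fun j _ => continuous_const.mul (continuous_supportFn (v j))

theorem content_smulAdd (h : IsBalanced v l) {r : ℝ} (hr : 0 ≤ r) (x : Space d)
    (K : ConvexBody (Space d)) : content v l (smulAdd r x K) = r * content v l K := by
  have := level_smul_add_shift h r (fun j => supportFn K (v j)) x
  simpa only [content, level, supportFn_smulAdd hr, Pi.add_apply, Pi.smul_apply, smul_eq_mul,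
    shift] using this

theorem content_body_le (h : IsBalanced v l) {t : J → ℝ} (ht : t ∈ solid v) :
    content v l (body v t).1 ≤ level l t :=
  level_mono h (supportFn_body_le h ht)

/-- The weights are positive, so termwise inequalities with equal weighted sums are all equalities.
-/
theorem content_body_eq_iff (h : IsBalanced v l) {t : J → ℝ} (ht : t ∈ solid v) :
    content v l (body v t).1 = level l t ↔ t ∈ tight v := by
  rw [mem_tight_iff h ht, content, level, Finset.sum_eq_sum_iff_of_le
    fun j _ => mul_le_mul_of_nonneg_left (supportFn_body_le h ht j) (h.pos j).le]
  simp [(h.pos _).ne']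

/-- The integral of `exp (-level)` over the parameters of polytopes with center in the cube. -/
def mass (v : J → Space d) (l : J → ℝ) (c : FatBody d → Space d) (B : Set (J → ℝ)) : ℝ≥0∞ :=
  ∫⁻ t in {t | t ∈ B ∧ c (body v t) ∈ cube d}, ENNReal.ofReal (Real.exp (-level l t))

theorem mass_mono {B B' : Set (J → ℝ)} (hBB : B ⊆ B') : mass v l c B ≤ mass v l c B' :=
  lintegral_mono_set fun _ ht => ⟨hBB ht.1, ht.2⟩

theorem mass_union_le (B B' : Set (J → ℝ)) :
    mass v l c (B ∪ B') ≤ mass v l c B + mass v l c B' := by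
  refine (lintegral_mono_set fun t ht => ?_).trans (lintegral_union_le _ _ _)
  exact ht.1.imp (fun h' => ⟨h', ht.2⟩) fun h' => ⟨h', ht.2⟩

section

variable [Nonempty J] (h : IsBalanced v l) (hc : IsCenterFunction c) {B : Set (J → ℝ)}
  (hB : IsHomothetic v B) {m : ℕ} (hm : Fintype.card J = m + d) (hm1 : 1 ≤ m)

include h hc hB hm hm1

theorem IsHomothetic.mass_eq :
    mass v l c B = volume (levelSet v l c B (cube d) 1) * gammaTotal m :=
  hB.lintegral_level h hc hm hm1 (f := fun x => ENNReal.ofReal (Real.exp (-x))) (by fun_prop)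

/-- The dependence on `B` and on `a` separates into two factors: under the weight `exp (-level)`,
homothety-invariant properties are independent of the level. -/
theorem IsHomothetic.mass_level_ge (a : ℝ) :
    mass v l c {t | t ∈ B ∧ a ≤ level l t} =
      volume (levelSet v l c B (cube d) 1) * gammaTail m a := by
  have := hB.lintegral_level h hc hm hm1
    (f := (Ici a).indicator fun x => ENNReal.ofReal (Real.exp (-x)))
    (Measurable.indicator (by fun_prop) measurableSet_Ici)
  rw [lintegral_indicator measurableSet_Ici] at this
  have hE : MeasurableSet {t : J → ℝ | a ≤ level l t} :=
    measurableSet_le measurable_const (continuous_level l).measurable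
  rw [gammaTail, ← this, mass]
  have h2 : (fun t => (Ici a).indicator (fun x => ENNReal.ofReal (Real.exp (-x))) (level l t)) =
      {t : J → ℝ | a ≤ level l t}.indicator fun t => ENNReal.ofReal (Real.exp (-level l t)) := by
    ext t
    simp only [indicator, mem_Ici, mem_ofPred_eq]
  rw [h2, lintegral_indicator hE, Measure.restrict_restrict hE]
  congr 2
  ext t
  simp only [mem_inter_iff, mem_ofPred_eq]
  tauto

omit [Nonempty J] hc hm hm1 in
-- The ratio of content to level is invariant under homotheties. Its superlevel sets decrease to the
-- touching parameters as `y` increases to one, which lets the exact scaling law for the level be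
-- used for the content.
theorem IsHomothetic.content_ge (y : ℝ) :
    IsHomothetic v {t | t ∈ B ∧ y * level l t ≤ content v l (body v t).1} where
  measurableSet := hB.measurableSet.inter (measurableSet_le
    ((continuous_level l).measurable.const_mul y)
    ((continuous_content v l).measurable.comp (measurable_subtype_coe.comp (measurable_body h))))
  subset_solid := fun t ht => hB.subset_solid ht.1
  smul_add_shift_mem := by
    rintro r hr x t ⟨ht, hy⟩
    refine ⟨hB.smul_add_shift_mem r hr x t ht, ?_⟩
    rw [body_smul_add_shift h (hB.subset_solid ht) hr, level_smul_add_shift h]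
    change _ ≤ content v l (smulAdd r x (body v t).1)
    rw [content_smulAdd h hr.le]
    linarith [mul_le_mul_of_nonneg_left hy hr.le]

omit [Nonempty J] hc hm hm1 in
theorem IsHomothetic.inter_tight_eq :
    B ∩ tight v = {t | t ∈ B ∧ 1 * level l t ≤ content v l (body v t).1} := by
  ext t
  refine and_congr_right fun ht => ?_
  have ht := hB.subset_solid ht
  rw [← content_body_eq_iff h ht, one_mul]
  exact ⟨fun h' => h'.ge, fun h' => le_antisymm (content_body_le h ht) h'⟩

omit [Nonempty J] hc hm hm1 in
theorem IsHomothetic.inter_tight : IsHomothetic v (B ∩ tight v) := by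
  rw [hB.inter_tight_eq h]
  exact hB.content_ge h 1

/-- From below, touching parameters have content equal to level. From above, either the content is
at least `y * level`, which contributes `V y` times the tail at `a`, or the level exceeds `a / y`,
which is negligible. Finally `y` tends to one. -/
theorem IsHomothetic.tendsto_mass_div :
    Tendsto (fun a => mass v l c {t | t ∈ B ∧ a ≤ content v l (body v t).1} / gammaTail m a) atTop
      (𝓝 (volume (levelSet v l c (B ∩ tight v) (cube d) 1))) := by
  set V := fun y : ℝ => volume
    (levelSet v l c {t | t ∈ B ∧ y * level l t ≤ content v l (body v t).1} (cube d) 1) with hV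
  have hV1 : volume (levelSet v l c (B ∩ tight v) (cube d) 1) = V 1 := by
    rw [hB.inter_tight_eq h]
  -- Continuity from above along decreasing sets of finite volume; the shift `n + 2` keeps every `y`
  -- strictly between zero and one.
  have hlim : Tendsto (fun n : ℕ => V (1 - 1 / ((n : ℝ) + 2))) atTop (𝓝 (V 1)) := by
    have hs : (⋂ n : ℕ, levelSet v l c {t | t ∈ B ∧ (1 - 1 / ((n : ℝ) + 2)) * level l t ≤
        content v l (body v t).1} (cube d) 1) =
        levelSet v l c {t | t ∈ B ∧ 1 * level l t ≤ content v l (body v t).1} (cube d) 1 := by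
      ext t
      simp only [levelSet, mem_iInter, mem_ofPred_eq]
      refine ⟨fun hall => ⟨⟨(hall 0).1.1, ?_⟩, (hall 0).2⟩, fun ht n => ⟨⟨ht.1.1, ?_⟩, ht.2⟩⟩
      · have h0 : Tendsto (fun n : ℕ => 1 / ((n : ℝ) + 2)) atTop (𝓝 0) :=
          tendsto_const_nhds.div_atTop (tendsto_atTop_add_const_right _ _ tendsto_natCast_atTop_atTop)
        have h1 : Tendsto (fun n : ℕ => (1 - 1 / ((n : ℝ) + 2)) * level l t) atTop
            (𝓝 ((1 - 0) * level l t)) := (tendsto_const_nhds.sub h0).mul_const _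
        rw [sub_zero] at h1
        exact le_of_tendsto h1 (Eventually.of_forall fun n => (hall n).1.2)
      · refine le_trans ?_ ht.1.2
        have := level_pos h (hB.subset_solid ht.1.1)
        gcongr
        rw [sub_le_self_iff]
        positivity
    rw [hV]
    simp only
    rw [← hs]
    refine tendsto_measure_iInter_atTop (fun n => ((hB.content_ge h _).measurableSet_levelSet h hc
      measurableSet_cube 1).nullMeasurableSet) ?_ ⟨0, (volume_levelSet_lt_top h hc
        (hB.content_ge h _).subset_solid isBounded_cube 1).ne⟩
    intro n k hnk t ht
    refine ⟨⟨ht.1.1, le_trans ?_ ht.1.2⟩, ht.2⟩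
    have := level_pos h (hB.subset_solid ht.1.1)
    gcongr
  rw [hV1]
  have htop := fun a => gammaTail_ne_top (m := m) a
  have hne := fun a => gammaTail_ne_zero hm1 a
  refine tendsto_order.2 ⟨fun b hb => Eventually.of_forall fun a => hb.trans_le ?_, fun b hb => ?_⟩
  · rw [ENNReal.le_div_iff_mul_le (Or.inl (hne a)) (Or.inl (htop a)),
      ← (hB.content_ge h 1).mass_level_ge h hc hm hm1 a]
    refine mass_mono fun t ht => ⟨ht.1.1, ?_⟩
    have := ht.1.2
    rw [one_mul] at this
    exact ht.2.trans this
  · obtain ⟨n, hn⟩ := (hlim.eventually_lt_const hb).exists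
    set y : ℝ := 1 - 1 / ((n : ℝ) + 2) with hy
    have hy0 : 0 < y := by
      rw [hy, sub_pos, div_lt_one (by positivity)]
      have : (0 : ℝ) ≤ n := Nat.cast_nonneg n
      linarith
    have hy1 : y < 1 := by
      rw [hy, sub_lt_self_iff]
      positivity
    have hVB : volume (levelSet v l c B (cube d) 1) ≠ ∞ :=
      (volume_levelSet_lt_top h hc hB.subset_solid isBounded_cube 1).ne
    -- The first part uses content at most level, so its level is at least `a`; in the second, `a ≤
    -- content < y * level`.
    have hbound : ∀ a, mass v l c {t | t ∈ B ∧ a ≤ content v l (body v t).1} / gammaTail m a ≤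
        V y + volume (levelSet v l c B (cube d) 1) * (gammaTail m (a / y) / gammaTail m a) := by
      intro a
      have hle : mass v l c {t | t ∈ B ∧ a ≤ content v l (body v t).1} ≤
          V y * gammaTail m a + volume (levelSet v l c B (cube d) 1) * gammaTail m (a / y) := by
        rw [← (hB.content_ge h y).mass_level_ge h hc hm hm1 a,
          ← hB.mass_level_ge h hc hm hm1 (a / y)]
        refine (mass_mono fun t ht => ?_).trans (mass_union_le _ _)
        by_cases hty : y * level l t ≤ content v l (body v t).1
        · exact Or.inl ⟨⟨ht.1, hty⟩, ht.2.trans (content_body_le h (hB.subset_solid ht.1))⟩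
        · refine Or.inr ⟨ht.1, ?_⟩
          rw [div_le_iff₀ hy0]
          linarith [ht.2, not_le.1 hty]
      calc _ ≤ (V y * gammaTail m a + volume (levelSet v l c B (cube d) 1) * gammaTail m (a / y)) /
            gammaTail m a := ENNReal.div_le_div_right hle _
        _ = _ := by
          rw [ENNReal.add_div, ENNReal.mul_div_cancel_right (hne a) (htop a), mul_div_assoc]
    have hlim2 : Tendsto (fun a => V y + volume (levelSet v l c B (cube d) 1) *
        (gammaTail m (a / y) / gammaTail m a)) atTop (𝓝 (V y)) := by
      have := (ENNReal.Tendsto.const_mul (tendsto_gammaTail_ratio hm1 hy0 hy1)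
        (Or.inr hVB)).const_add (V y)
      simpa using this
    filter_upwards [hlim2.eventually_lt_const hn] with a ha
    exact (hbound a).trans_lt ha

end

end Large

/-! ### Gaps of independent Poisson processes on the line -/

section Gaps

variable {Ω ι : Type*}

/-- Two consecutive points of a subset of the line. -/
def IsGap (N : Set ℝ) (a b : ℝ) : Prop := a ∈ N ∧ b ∈ N ∧ a < b ∧ ∀ s ∈ N, ¬(a < s ∧ s < b)

/-- Every compact interval contains finitely many points. -/
def IsSparse (N : Set ℝ) : Prop := ∀ a b : ℝ, (N ∩ Icc a b).Finite

theorem IsSparse.exists_isGap {N : Set ℝ} (hN : IsSparse N) {a₁ a₂ b₁ b₂ : ℝ}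
    (hA : (N ∩ Ico a₁ a₂).Nonempty) (hG : N ∩ Icc a₂ b₁ = ∅) (hB : (N ∩ Ioc b₁ b₂).Nonempty)
    (hab : a₂ ≤ b₁) : ∃ a ∈ Ico a₁ a₂, ∃ b ∈ Ioc b₁ b₂, IsGap N a b := by
  have hfA : (N ∩ Ico a₁ a₂).Finite := (hN a₁ a₂).subset
    (inter_subset_inter_right _ Ico_subset_Icc_self)
  have hfB : (N ∩ Ioc b₁ b₂).Finite := (hN b₁ b₂).subset
    (inter_subset_inter_right _ Ioc_subset_Icc_self)
  obtain ⟨a, ⟨haN, ha⟩, hmax⟩ := hfA.exists_maximal hA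
  obtain ⟨b, ⟨hbN, hb⟩, hmin⟩ := hfB.exists_minimal hB
  refine ⟨a, ha, b, hb, haN, hbN, by linarith [ha.2, hb.1], fun s hs ⟨h1, h2⟩ => ?_⟩
  rcases lt_or_ge s a₂ with h3 | h3
  · exact absurd (hmax (y := s) ⟨hs, ha.1.trans h1.le, h3⟩ h1.le) (not_le.2 h1)
  · rcases le_or_gt s b₁ with h4 | h4
    · exact (hG ▸ (⟨hs, h3, h4⟩ : s ∈ N ∩ Icc a₂ b₁) : s ∈ (∅ : Set ℝ))
    · exact absurd (hmin (y := s) ⟨hs, h4, h2.le.trans hb.2⟩ h2.le) (not_le.2 h2)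

theorem IsGap.eq_of_lt_of_lt {N : Set ℝ} {a b a' b' x : ℝ} (h : IsGap N a b) (h' : IsGap N a' b')
    (hax : a < x) (hxb : x < b) (hax' : a' < x) (hxb' : x < b') : a = a' ∧ b = b' := by
  obtain ⟨ha, hb, -, hg⟩ := h
  obtain ⟨ha', hb', -, hg'⟩ := h'
  constructor
  · rcases lt_trichotomy a a' with hlt | heq | hlt
    · exact absurd ⟨hlt, hax'.trans hxb⟩ (hg a' ha')
    · exact heq
    · exact absurd ⟨hlt, hax.trans hxb'⟩ (hg' a ha)
  · rcases lt_trichotomy b b' with hlt | heq | hlt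
    · exact absurd ⟨hax'.trans hxb, hlt⟩ (hg' b hb)
    · exact heq
    · exact absurd ⟨hax.trans hxb', hlt⟩ (hg b' hb')

/-- The parameters of the systems of gaps: the coordinates `(i, true)` are the right end points,
the coordinates `(i, false)` the reflected left end points. -/
def gapParams (N : ι → Set ℝ) : Set (ι × Bool → ℝ) :=
  {t | ∀ i, IsGap (N i) (-t (i, false)) (t (i, true))}

/-- The box of parameters with `p j < t j ≤ q j`. -/
def box (p q : ι × Bool → ℝ) : Set (ι × Bool → ℝ) := univ.pi fun j => Ioc (p j) (q j)

/-- The test sets for gaps with parameters in a box. -/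
def testSet (p q : ι × Bool → ℝ) (i : ι) (k : Fin 3) : Set ℝ :=
  ![Ico (-q (i, false)) (-p (i, false)), Icc (-p (i, false)) (p (i, true)),
    Ioc (p (i, true)) (q (i, true))] k

/-- The condition that there is a system of gaps with parameters in a box. -/
def HasGaps (N : ι → Set ℝ) (p q : ι × Bool → ℝ) : Prop :=
  ∀ i, (N i ∩ testSet p q i 0).Nonempty ∧ N i ∩ testSet p q i 1 = ∅ ∧
    (N i ∩ testSet p q i 2).Nonempty

open Classical in
-- The condition on `p` forces every gap allowed by the box to contain the point `p (i, true)`. As a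
-- point lies in at most one gap, the count is the indicator of an event built from voids of the
-- test sets.
theorem encard_gapParams_inter_box {N : ι → Set ℝ} (hN : ∀ i, IsSparse (N i))
    {p q : ι × Bool → ℝ} (hp : ∀ i, 0 ≤ p (i, false) + p (i, true)) :
    (gapParams N ∩ box p q).encard = if HasGaps N p q then 1 else 0 := by
  have hsub : (gapParams N ∩ box p q).Subsingleton := by
    rintro s ⟨hs, hsb⟩ t ⟨ht, htb⟩
    ext ⟨i, b⟩
    have h1 := hsb (i, false) (mem_univ _)
    have h2 := hsb (i, true) (mem_univ _)
    have h3 := htb (i, false) (mem_univ _)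
    have h4 := htb (i, true) (mem_univ _)
    have := IsGap.eq_of_lt_of_lt (x := p (i, true)) (hs i) (ht i) (by linarith [h1.1, hp i]) h2.1
      (by linarith [h3.1, hp i]) h4.1
    cases b
    · linarith [this.1]
    · exact this.2
  split_ifs with hG
  · choose a ha b hb hab using fun i => (hN i).exists_isGap (hG i).1 (hG i).2.1 (hG i).2.2
      (by linarith [hp i])
    have hne : (gapParams N ∩ box p q).Nonempty := by
      refine ⟨fun j => if j.2 then b j.1 else -a j.1, fun i => by simpa using hab i, ?_⟩
      rintro ⟨i, _ | _⟩ -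
      · simp only [Bool.false_eq_true, if_false]
        exact ⟨by linarith [(ha i).2], by linarith [(ha i).1]⟩
      · simpa using hb i
    rw [encard_eq_one]
    exact hsub.eq_empty_or_singleton.resolve_left hne.ne_empty
  · rw [encard_eq_zero, eq_empty_iff_forall_notMem]
    rintro t ⟨ht, htb⟩
    refine hG fun i => ?_
    have h1 := htb (i, false) (mem_univ _)
    have h2 := htb (i, true) (mem_univ _)
    refine ⟨⟨_, (ht i).1, by linarith [h1.2], by linarith [h1.1]⟩, ?_, ⟨_, (ht i).2.1, h2⟩⟩
    rw [eq_empty_iff_forall_notMem]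
    rintro s ⟨hs, h3, h4⟩
    exact (ht i).2.2.2 s hs ⟨by linarith [h1.1], by linarith [h2.1]⟩

variable [MeasurableSpace Ω]

/-- Independent Poisson processes on the line, described by their void probabilities. -/
structure IsPoissonSystem (P : Measure Ω) (N : Ω → ι → Set ℝ) (l : ι → ℝ) : Prop where
  measurableSet_void : ∀ (i : ι) (A : Set ℝ), MeasurableSet A → MeasurableSet {ω | N ω i ∩ A = ∅}
  measure_void : ∀ (i : ι) (A : Set ℝ), MeasurableSet A → volume A ≠ ∞ →
    P {ω | N ω i ∩ A = ∅} = ENNReal.ofReal (Real.exp (-(l i * (volume A).toReal)))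
  iIndepSet_void : ∀ A : ι → Fin 3 → Set ℝ, (∀ i k, MeasurableSet (A i k)) →
    (∀ i, Pairwise fun k k' => Disjoint (A i k) (A i k')) →
    iIndepSet (fun j : ι × Fin 3 => {ω | N ω j.1 ∩ A j.1 j.2 = ∅}) P
  ae_isSparse : ∀ᵐ ω ∂P, ∀ i, IsSparse (N ω i)

theorem measurableSet_testSet (p q : ι × Bool → ℝ) (i : ι) (k : Fin 3) :
    MeasurableSet (testSet p q i k) := by
  fin_cases k
  exacts [measurableSet_Ico, measurableSet_Icc, measurableSet_Ioc]

theorem pairwise_disjoint_testSet {p q : ι × Bool → ℝ}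
    (hp : ∀ i, 0 ≤ p (i, false) + p (i, true)) (i : ι) :
    Pairwise fun k k' => Disjoint (testSet p q i k) (testSet p q i k') := by
  have h01 : Disjoint (testSet p q i 0) (testSet p q i 1) :=
    disjoint_left.2 fun x hx hx' => absurd hx.2 (not_lt.2 hx'.1)
  have h02 : Disjoint (testSet p q i 0) (testSet p q i 2) :=
    disjoint_left.2 fun x hx hx' => by
      have := hx.2
      have := hx'.1
      linarith [hp i]
  have h12 : Disjoint (testSet p q i 1) (testSet p q i 2) :=
    disjoint_left.2 fun x hx hx' => absurd hx'.1 (not_lt.2 hx.2)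
  intro k k' hkk
  fin_cases k <;> fin_cases k' <;>
    first
    | exact absurd rfl hkk
    | assumption
    | exact Disjoint.symm (by assumption)

variable [Fintype ι] {P : Measure Ω} [IsProbabilityMeasure P] {N : Ω → ι → Set ℝ} {l : ι → ℝ}

theorem hasGaps_eq_iInter (N : Ω → ι → Set ℝ) (p q : ι × Bool → ℝ) :
    {ω | HasGaps (N ω) p q} = ⋂ j : ι × Fin 3,
      if j.2 = 1 then {ω | N ω j.1 ∩ testSet p q j.1 j.2 = ∅}
      else {ω | N ω j.1 ∩ testSet p q j.1 j.2 = ∅}ᶜ := by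
  ext ω
  simp only [HasGaps, mem_ofPred_eq, mem_iInter, Prod.forall]
  refine forall_congr' fun i => ?_
  rw [Fin.forall_fin_succ, Fin.forall_fin_succ, Fin.forall_fin_succ]
  simp [nonempty_iff_ne_empty]

theorem IsPoissonSystem.measurableSet_hasGaps (hN : IsPoissonSystem P N l)
    (p q : ι × Bool → ℝ) : MeasurableSet {ω | HasGaps (N ω) p q} := by
  rw [hasGaps_eq_iInter]
  refine MeasurableSet.iInter fun j => ?_
  have := hN.measurableSet_void j.1 _ (measurableSet_testSet p q j.1 j.2)
  split_ifs
  exacts [this, this.compl]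

/-- For each `i`, independence gives the factor of an empty middle interval times those of two
non-empty outer ones. The middle exponential splits over the two end points, so the product becomes
one increment of `exp (-l x)` for each coordinate. -/
theorem IsPoissonSystem.measure_hasGaps (hN : IsPoissonSystem P N l) (hl : ∀ i, 0 < l i)
    {p q : ι × Bool → ℝ} (hp : ∀ i, 0 ≤ p (i, false) + p (i, true)) (hpq : ∀ j, p j ≤ q j) :
    P {ω | HasGaps (N ω) p q} =
      ENNReal.ofReal (∏ j, (Real.exp (-(l j.1 * p j)) - Real.exp (-(l j.1 * q j)))) := by
  have hind := hN.iIndepSet_void (testSet p q) (measurableSet_testSet p q)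
    (pairwise_disjoint_testSet hp)
  have hmeas : ∀ j : ι × Fin 3, MeasurableSet {ω | N ω j.1 ∩ testSet p q j.1 j.2 = ∅} :=
    fun j => hN.measurableSet_void j.1 _ (measurableSet_testSet p q j.1 j.2)
  have hprod := iIndep.meas_iInter hind (s := fun j : ι × Fin 3 =>
      if j.2 = 1 then {ω | N ω j.1 ∩ testSet p q j.1 j.2 = ∅}
      else {ω | N ω j.1 ∩ testSet p q j.1 j.2 = ∅}ᶜ) fun j => by
    have hg := MeasurableSpace.measurableSet_generateFrom
      (mem_singleton {ω | N ω j.1 ∩ testSet p q j.1 j.2 = ∅})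
    split_ifs
    exacts [hg, hg.compl]
  rw [hasGaps_eq_iInter, hprod, Fintype.prod_prod_type, Fintype.prod_prod_type,
    ENNReal.ofReal_prod_of_nonneg]
  swap
  · intro i _
    refine Finset.prod_nonneg fun b _ => sub_nonneg.2 (Real.exp_le_exp.2 ?_)
    exact neg_le_neg (mul_le_mul_of_nonneg_left (hpq (i, b)) (hl i).le)
  refine Finset.prod_congr rfl fun i _ => ?_
  have hv0 : volume (testSet p q i 0) = ENNReal.ofReal (q (i, false) - p (i, false)) := by
    change volume (Ico _ _) = _
    rw [Real.volume_Ico]; congr 1; ring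
  have hv1 : volume (testSet p q i 1) = ENNReal.ofReal (p (i, false) + p (i, true)) := by
    change volume (Icc _ _) = _
    rw [Real.volume_Icc]; congr 1; ring
  have hv2 : volume (testSet p q i 2) = ENNReal.ofReal (q (i, true) - p (i, true)) := by
    change volume (Ioc _ _) = _
    rw [Real.volume_Ioc]
  have hvoid : ∀ k r, 0 ≤ r → volume (testSet p q i k) = ENNReal.ofReal r →
      P {ω | N ω i ∩ testSet p q i k = ∅} = ENNReal.ofReal (Real.exp (-(l i * r))) := by
    intro k r hr hv
    rw [hN.measure_void i _ (measurableSet_testSet p q i k) (by rw [hv]; exact ENNReal.ofReal_ne_top),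
      hv, ENNReal.toReal_ofReal hr]
  have hcompl : ∀ k r, 0 ≤ r → volume (testSet p q i k) = ENNReal.ofReal r →
      P {ω | N ω i ∩ testSet p q i k = ∅}ᶜ = ENNReal.ofReal (1 - Real.exp (-(l i * r))) := by
    intro k r hr hv
    rw [prob_compl_eq_one_sub (hmeas (i, k)), hvoid k r hr hv, ENNReal.ofReal_sub _ (by positivity),
      ENNReal.ofReal_one]
  have h0 := hpq (i, false)
  have h2 := hpq (i, true)
  have hle : ∀ r, 0 ≤ r → 0 ≤ 1 - Real.exp (-(l i * r)) := fun r hr => by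
    rw [sub_nonneg, Real.exp_le_one_iff, neg_nonpos]
    exact mul_nonneg (hl i).le hr
  rw [Fin.prod_univ_three, Fintype.prod_bool]
  simp only [Fin.isValue, show ((0 : Fin 3) = 1) = False by simp, if_false, if_true,
    show ((2 : Fin 3) = 1) = False by simp]
  rw [hcompl 0 _ (by linarith) hv0, hvoid 1 _ (hp i) hv1, hcompl 2 _ (by linarith) hv2,
    ← ENNReal.ofReal_mul (hle _ (by linarith)), ← ENNReal.ofReal_mul
      (mul_nonneg (hle _ (by linarith)) (Real.exp_pos _).le)]
  congr 1
  have e1 : Real.exp (-(l i * q (i, true))) =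
      Real.exp (-(l i * p (i, true))) * Real.exp (-(l i * (q (i, true) - p (i, true)))) := by
    rw [← Real.exp_add]; congr 1; ring
  have e2 : Real.exp (-(l i * q (i, false))) =
      Real.exp (-(l i * p (i, false))) * Real.exp (-(l i * (q (i, false) - p (i, false)))) := by
    rw [← Real.exp_add]; congr 1; ring
  have e3 : Real.exp (-(l i * (p (i, false) + p (i, true)))) =
      Real.exp (-(l i * p (i, true))) * Real.exp (-(l i * p (i, false))) := by
    rw [← Real.exp_add]; congr 1; ring
  rw [e1, e2, e3]
  ring

/-- The intensity measure of the parameters of systems of gaps. -/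
def gapIntensity (l : ι → ℝ) : Measure (ι × Bool → ℝ) :=
  ENNReal.ofReal (∏ j : ι × Bool, l j.1) •
    volume.withDensity fun t => ENNReal.ofReal (Real.exp (-level (fun j => l j.1) t))

theorem gapIntensity_box (hl : ∀ i, 0 < l i) {p q : ι × Bool → ℝ} (hpq : ∀ j, p j ≤ q j) :
    gapIntensity l (box p q) =
      ENNReal.ofReal (∏ j, (Real.exp (-(l j.1 * p j)) - Real.exp (-(l j.1 * q j)))) := by
  have hbox : MeasurableSet (box p q) := MeasurableSet.univ_pi fun j => measurableSet_Ioc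
  rw [gapIntensity, Measure.smul_apply, withDensity_apply _ hbox, smul_eq_mul]
  have hvol : (volume : Measure (ι × Bool → ℝ)).restrict (box p q) =
      Measure.pi fun j => volume.restrict (Ioc (p j) (q j)) := by
    rw [box, volume_pi, Measure.restrict_pi_pi]
  have hint : ∀ j : ι × Bool, Integrable (fun x : ℝ => Real.exp (-(l j.1 * x)))
      (volume.restrict (Ioc (p j) (q j))) := fun j =>
    (Continuous.integrableOn_Icc (by fun_prop)).mono_set Ioc_subset_Icc_self
  have hfun : ∀ t : ι × Bool → ℝ, Real.exp (-level (fun j => l j.1) t) =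
      ∏ j, Real.exp (-(l j.1 * t j)) := fun t => by
    rw [← Real.exp_sum, Finset.sum_neg_distrib]; rfl
  rw [hvol]
  simp only [hfun]
  rw [← ofReal_integral_eq_lintegral_ofReal (Integrable.fintype_prod hint)
    (Eventually.of_forall fun t => Finset.prod_nonneg fun j _ => (Real.exp_pos _).le),
    integral_fintype_prod_eq_prod (fun (j : ι × Bool) (x : ℝ) => Real.exp (-(l j.1 * x))),
    ← ENNReal.ofReal_mul (Finset.prod_nonneg fun j _ => (hl j.1).le), ← Finset.prod_mul_distrib]
  congr 1
  refine Finset.prod_congr rfl fun j _ => ?_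
  rw [← intervalIntegral.integral_of_le (hpq j)]
  have hne := (hl j.1).ne'
  have hderiv : ∀ x ∈ uIcc (p j) (q j), HasDerivAt (fun x : ℝ => -(Real.exp (-(l j.1 * x)) / l j.1))
      (Real.exp (-(l j.1 * x))) x := fun x _ => by
    have h1 : HasDerivAt (fun x : ℝ => -(l j.1 * x)) (-(l j.1 * 1)) x :=
      ((hasDerivAt_id x).const_mul _).neg
    have h2 := (h1.exp.div_const (l j.1)).neg
    exact h2.congr_deriv (by rw [mul_one, mul_neg, neg_div, neg_neg, mul_div_cancel_right₀ _ hne])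
  rw [intervalIntegral.integral_eq_sub_of_hasDerivAt hderiv
    (Continuous.intervalIntegrable (by fun_prop) _ _)]
  field_simp
  ring

/-- The random measure that counts the parameters of systems of gaps. -/
def gapMeasure (N : ι → Set ℝ) : Measure (ι × Bool → ℝ) :=
  Measure.sum fun t : gapParams N => Measure.dirac (t : ι × Bool → ℝ)

theorem sum_dirac_apply {α : Type*} [MeasurableSpace α] (T : Set α) {D : Set α}
    (hD : MeasurableSet D) :
    (Measure.sum fun t : T => Measure.dirac (t : α)) D = ((T ∩ D).encard : ℝ≥0∞) := by
  classical
  rw [Measure.sum_apply _ hD, ← ENNReal.tsum_set_one]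
  simp only [Measure.dirac_apply' _ hD]
  rw [tsum_subtype T (fun t => D.indicator 1 t), tsum_subtype (T ∩ D) fun _ => (1 : ℝ≥0∞)]
  congr 1
  ext t
  by_cases h1 : t ∈ T <;> by_cases h2 : t ∈ D <;> simp [h1, h2]

theorem gapMeasure_apply (N : ι → Set ℝ) {D : Set (ι × Bool → ℝ)} (hD : MeasurableSet D) :
    gapMeasure N D = ((gapParams N ∩ D).encard : ℝ≥0∞) :=
  sum_dirac_apply _ hD

theorem measurableSet_box (p q : ι × Bool → ℝ) : MeasurableSet (box p q) :=
  MeasurableSet.univ_pi fun _ => measurableSet_Ioc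

/-- The boxes of parameters in lower orthants form a generating π-system. -/
theorem pi_eq_generateFrom_Iic {J : Type*} [Finite J] :
    (MeasurableSpace.pi : MeasurableSpace (J → ℝ)) =
      MeasurableSpace.generateFrom (pi univ '' pi univ fun _ => range Iic) := by
  refine (generateFrom_eq_pi (fun _ => ?_) fun _ => ?_).symm
  · rw [← borel_eq_generateFrom_Iic]
    exact (BorelSpace.measurable_eq (α := ℝ)).symm
  · refine ⟨fun n : ℕ => Iic (n : ℝ), fun n => mem_range_self _, ?_⟩
    exact iUnion_eq_univ_iff.2 fun x => exists_nat_ge x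

theorem pi_Iic_inter_box (x p q : ι × Bool → ℝ) :
    (univ.pi fun j => Iic (x j)) ∩ box p q = box p fun j => min (q j) (x j) := by
  rw [box, ← pi_inter_distrib]
  congr 1
  ext j s
  simp only [mem_inter_iff, mem_Iic, mem_Ioc, le_min_iff]
  tauto

/-! ### Mean number of gap systems with parameters in a measurable set -/

section RandomMeasure

variable {Ω₀ : Set Ω}

/-- The random gap measure is measurable within a box, and its mean there is the gap
intensity. -/
theorem IsPoissonSystem.gapMeasure_restrict_box (hN : IsPoissonSystem P N l) (hl : ∀ i, 0 < l i)
    (hΩ₀ : MeasurableSet Ω₀) (hΩ₀P : P Ω₀ᶜ = 0) (hΩ₀N : ∀ ω ∈ Ω₀, ∀ i, IsSparse (N ω i))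
    {p q : ι × Bool → ℝ} (hp : ∀ i, 0 ≤ p (i, false) + p (i, true)) :
    (Measurable fun ω => Ω₀.indicator (fun ω => (gapMeasure (N ω)).restrict (box p q)) ω) ∧
      P.bind (fun ω => Ω₀.indicator (fun ω => (gapMeasure (N ω)).restrict (box p q)) ω) =
        (gapIntensity l).restrict (box p q) := by
  classical
  set ρ : Ω → Measure (ι × Bool → ℝ) :=
    fun ω => Ω₀.indicator (fun ω => (gapMeasure (N ω)).restrict (box p q)) ω with hρ
  have hbox : ∀ q', Ω₀.indicator (fun ω => gapMeasure (N ω) (box p q')) =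
      (Ω₀ ∩ {ω | HasGaps (N ω) p q'}).indicator fun _ => 1 := by
    intro q'
    ext ω
    by_cases hω : ω ∈ Ω₀
    · rw [indicator_of_mem hω, gapMeasure_apply _ (measurableSet_box p q'),
        encard_gapParams_inter_box (hΩ₀N ω hω) hp]
      by_cases hG : HasGaps (N ω) p q' <;> simp [indicator, hω, hG]
    · simp [indicator, hω]
  have happ : ∀ ω s, ρ ω s = Ω₀.indicator (fun ω => (gapMeasure (N ω)).restrict (box p q) s) ω := by
    intro ω s
    by_cases hω : ω ∈ Ω₀ <;> simp [hρ, indicator, hω]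
  have hs : ∀ x : ι × Bool → ℝ, (fun ω => ρ ω (univ.pi fun j => Iic (x j))) =
      (Ω₀ ∩ {ω | HasGaps (N ω) p fun j => min (q j) (x j)}).indicator fun _ => 1 := by
    intro x
    rw [← hbox]
    ext ω
    rw [happ]
    congr 1
    ext ω
    rw [Measure.restrict_apply (MeasurableSet.univ_pi fun _ => measurableSet_Iic),
      pi_Iic_inter_box]
  have hu : (fun ω => ρ ω univ) = (Ω₀ ∩ {ω | HasGaps (N ω) p q}).indicator fun _ => 1 := by
    rw [← hbox]
    ext ω
    rw [happ]
    congr 1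
    ext ω
    rw [Measure.restrict_apply_univ]
  have hmG : ∀ q', MeasurableSet (Ω₀ ∩ {ω | HasGaps (N ω) p q'}) := fun q' =>
    hΩ₀.inter (hN.measurableSet_hasGaps p q')
  -- Restriction to one box makes the random measure finite, as the π-system arguments for
  -- measurability and uniqueness require.
  have hle : ∀ ω, ρ ω univ ≤ 1 := fun ω => by
    have := congrFun hu ω
    rw [this]
    exact indicator_le_self' (fun _ _ => zero_le_one) ω
  have hfin : ∀ ω, IsFiniteMeasure (ρ ω) := fun ω => ⟨(hle ω).trans_lt ENNReal.one_lt_top⟩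
  have hpi : IsPiSystem (pi univ '' pi univ fun _ : ι × Bool => range (Iic : ℝ → Set ℝ)) := by
    refine IsPiSystem.pi fun _ => ?_
    exact isPiSystem_Iic
  have hmeas : Measurable ρ := by
    refine Measurable.measure_of_isPiSystem pi_eq_generateFrom_Iic hpi ?_ ?_
    · rintro _ ⟨f, hf, rfl⟩
      choose x hx using fun j => hf j (mem_univ j)
      obtain rfl : (fun j => Iic (x j)) = f := funext hx
      rw [hs]
      exact measurable_const.indicator (hmG _)
    · rw [hu]
      exact measurable_const.indicator (hmG _)
  have hmean : ∀ q', P (Ω₀ ∩ {ω | HasGaps (N ω) p q'}) = gapIntensity l (box p q') := by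
    intro q'
    have h1 : P (Ω₀ ∩ {ω | HasGaps (N ω) p q'}) = P {ω | HasGaps (N ω) p q'} := by
      rw [inter_comm]
      exact measure_inter_conull hΩ₀P
    -- Intersecting the box with an orthant keeps the lower corner `p`, so the condition on `p`
    -- persists; but the new upper corner may fall below `p`, and then the box is empty.
    by_cases hpq : ∀ j, p j ≤ q' j
    · rw [h1, hN.measure_hasGaps hl hp hpq, gapIntensity_box hl hpq]
    · push Not at hpq
      obtain ⟨j, hj⟩ := hpq
      have he : box p q' = ∅ := by
        rw [box, univ_pi_eq_empty_iff]
        exact ⟨j, Ioc_eq_empty (not_lt.2 hj.le)⟩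
      rw [he, measure_empty]
      refine measure_mono_null (t := ∅) ?_ measure_empty
      rintro ω ⟨hω, hG⟩
      have := encard_gapParams_inter_box (hΩ₀N ω hω) hp (q := q')
      rw [he, inter_empty, encard_empty, if_pos (show HasGaps (N ω) p q' from hG)] at this
      exact absurd this zero_ne_one
  refine ⟨hmeas, ?_⟩
  have hbfin : IsFiniteMeasure (P.bind ρ) := ⟨by
    rw [Measure.bind_apply MeasurableSet.univ hmeas.aemeasurable]
    calc _ ≤ ∫⁻ _, 1 ∂P := lintegral_mono hle
      _ < ∞ := by simp⟩
  refine ext_of_generate_finite _ pi_eq_generateFrom_Iic hpi ?_ ?_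
  · rintro _ ⟨f, hf, rfl⟩
    choose x hx using fun j => hf j (mem_univ j)
    obtain rfl : (fun j => Iic (x j)) = f := funext hx
    have hms : MeasurableSet (univ.pi fun j => Iic (x j)) :=
      MeasurableSet.univ_pi fun _ => measurableSet_Iic
    rw [Measure.bind_apply hms hmeas.aemeasurable, hs, lintegral_indicator (hmG _),
      lintegral_one, Measure.restrict_apply_univ, hmean, Measure.restrict_apply hms,
      pi_Iic_inter_box]
  · rw [Measure.bind_apply MeasurableSet.univ hmeas.aemeasurable, hu, lintegral_indicator (hmG _),
      lintegral_one, Measure.restrict_apply_univ, hmean, Measure.restrict_apply_univ]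

/-- Countably many boxes cover the parameters of systems of intervals of positive length. -/
theorem exists_box_cover (ι : Type*) [Finite ι] :
    ∃ p q : ℕ → ι × Bool → ℝ, (∀ n i, 0 ≤ p n (i, false) + p n (i, true)) ∧
      ∀ t : ι × Bool → ℝ, (∀ i, 0 < t (i, false) + t (i, true)) → ∃ n, t ∈ box (p n) (q n) := by
  let β := {r : (ι × Bool → ℚ) × (ι × Bool → ℚ) // ∀ i, 0 ≤ r.1 (i, false) + r.1 (i, true)}
  have hne : Nonempty β := ⟨⟨0, fun i => by simp⟩⟩
  obtain ⟨f, hf⟩ := exists_surjective_nat β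
  refine ⟨fun n j => (f n).1.1 j, fun n j => (f n).1.2 j, fun n i => ?_, fun t ht => ?_⟩
  · change (0 : ℝ) ≤ ((f n).1.1 (i, false) : ℝ) + ((f n).1.1 (i, true) : ℝ)
    exact_mod_cast (f n).2 i
  -- Losing less than half of the interval length at each end keeps the sum of the two lower bounds
  -- positive.
  · have hlow : ∀ i b, ∃ r : ℚ, t (i, b) - (t (i, false) + t (i, true)) / 2 < r ∧ r < t (i, b) :=
      fun i b => exists_rat_btwn (by linarith [ht i])
    choose p hp1 hp2 using hlow
    have hup : ∀ j, ∃ r : ℚ, t j < r := fun j => exists_rat_gt _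
    choose q hq using hup
    obtain ⟨n, hn⟩ := hf ⟨(fun j => p j.1 j.2, q), fun i => by
      have h1 := hp1 i false
      have h2 := hp1 i true
      have : (0 : ℝ) ≤ p i false + p i true := by linarith
      exact_mod_cast this⟩
    refine ⟨n, fun j _ => ?_⟩
    simp only [hn]
    exact ⟨hp2 j.1 j.2, (hq j).le⟩

/-- A single box controls only the gap systems that straddle common points. Cutting `D` along a
countable cover by such boxes, made disjoint, and summing gives the general mean. The indicator of
`Ω₀` discards realizations that are not locally finite. -/
theorem IsPoissonSystem.lintegral_encard (hN : IsPoissonSystem P N l) (hl : ∀ i, 0 < l i)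
    (hΩ₀ : MeasurableSet Ω₀) (hΩ₀P : P Ω₀ᶜ = 0) (hΩ₀N : ∀ ω ∈ Ω₀, ∀ i, IsSparse (N ω i))
    {D : Set (ι × Bool → ℝ)} (hD : MeasurableSet D)
    (hDpos : ∀ t ∈ D, ∀ i, 0 < t (i, false) + t (i, true)) :
    (Measurable fun ω => Ω₀.indicator (fun ω => ((gapParams (N ω) ∩ D).encard : ℝ≥0∞)) ω) ∧
      ∫⁻ ω, Ω₀.indicator (fun ω => ((gapParams (N ω) ∩ D).encard : ℝ≥0∞)) ω ∂P =
        gapIntensity l D := by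
  obtain ⟨p, q, hp, hcov⟩ := exists_box_cover ι
  set R := fun n => box (p n) (q n) with hR
  set E := fun n => D ∩ disjointed R n with hE
  have hRm : ∀ n, MeasurableSet (R n) := fun n => measurableSet_box _ _
  have hEm : ∀ n, MeasurableSet (E n) := fun n => hD.inter (MeasurableSet.disjointed hRm n)
  have hDE : D = ⋃ n, E n := by
    rw [← inter_iUnion, iUnion_disjointed, eq_comm, inter_eq_left]
    exact fun t ht => mem_iUnion.2 (hcov t (hDpos t ht))
  have hdisj : Pairwise fun m n => Disjoint (E m) (E n) := fun m n hmn =>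
    (disjoint_disjointed R hmn).mono inter_subset_right inter_subset_right
  have hER : ∀ n, E n ⊆ R n := fun n => inter_subset_right.trans (disjointed_subset R n)
  have hbox := fun n => hN.gapMeasure_restrict_box hl hΩ₀ hΩ₀P hΩ₀N (hp n) (q := q n)
  set ρ : ℕ → Ω → Measure (ι × Bool → ℝ) :=
    fun n ω => Ω₀.indicator (fun ω => (gapMeasure (N ω)).restrict (R n)) ω with hρ
  have hsum : (fun ω => Ω₀.indicator (fun ω => ((gapParams (N ω) ∩ D).encard : ℝ≥0∞)) ω) =
      fun ω => ∑' n, ρ n ω (E n) := by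
    ext ω
    by_cases hω : ω ∈ Ω₀
    · simp only [hρ, indicator_of_mem hω]
      rw [← gapMeasure_apply _ hD]
      conv_lhs => rw [hDE]
      rw [measure_iUnion hdisj hEm]
      refine tsum_congr fun n => ?_
      rw [Measure.restrict_apply (hEm n), inter_eq_left.2 (hER n)]
    · simp [hρ, indicator_of_notMem hω]
  have hmeas : ∀ n, Measurable fun ω => ρ n ω (E n) := fun n =>
    (Measure.measurable_coe (hEm n)).comp (hbox n).1
  rw [hsum]
  refine ⟨Measurable.tsum hmeas, ?_⟩
  rw [lintegral_tsum fun n => (hmeas n).aemeasurable]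
  conv_rhs => rw [hDE]
  rw [measure_iUnion hdisj hEm]
  refine tsum_congr fun n => ?_
  rw [← Measure.bind_apply (hEm n) (hbox n).1.aemeasurable, (hbox n).2,
    Measure.restrict_apply (hEm n), inter_eq_left.2 (hER n)]

end RandomMeasure

end Gaps

/-! ### The Poisson processes of the parallel classes of hyperplanes -/

section Classes

variable {d : ℕ} {Ω ι : Type*}

/-- The directions `± u i`. -/
def direction (u : ι → Sphere d) (j : ι × Bool) : Sphere d := if j.2 then u j.1 else -u j.1

/-- The signed distances of the hyperplanes with normal `u`. -/
def linePoints (A : Set (Sphere d × ℝ)) (u : Sphere d) : Set ℝ :=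
  {s | ∃ p ∈ A, 0 < p.2 ∧ ((p.1 = u ∧ p.2 = s) ∨ (p.1 = -u ∧ -p.2 = s))}

/-- The parameters of hyperplanes with normal `u` and signed distance in `B`. -/
def slab (u : Sphere d) (B : Set ℝ) : Set (Sphere d × ℝ) :=
  ({u} ×ˢ (B ∩ Ioi 0)) ∪ ({-u} ×ˢ (-B ∩ Ioi 0))

theorem linePoints_inter_eq_empty (A : Set (Sphere d × ℝ)) (u : Sphere d) (B : Set ℝ) :
    linePoints A u ∩ B = ∅ ↔ (A ∩ slab u B).encard = 0 := by
  rw [encard_eq_zero, eq_empty_iff_forall_notMem, eq_empty_iff_forall_notMem]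
  constructor
  · rintro h ⟨v, s⟩ ⟨hA, ⟨hv, hB, hs⟩ | ⟨hv, hB, hs⟩⟩
    · exact h s ⟨⟨_, hA, hs, Or.inl ⟨hv, rfl⟩⟩, hB⟩
    · exact h (-s) ⟨⟨_, hA, hs, Or.inr ⟨hv, rfl⟩⟩, hB⟩
  · rintro h s ⟨⟨p, hA, hs, ⟨hv, rfl⟩ | ⟨hv, rfl⟩⟩, hB⟩
    · exact h p ⟨hA, Or.inl ⟨hv, hB, hs⟩⟩
    · exact h p ⟨hA, Or.inr ⟨hv, hB, hs⟩⟩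

theorem linePoints_inter_finite {A : Set (Sphere d × ℝ)} {u : Sphere d} {B : Set ℝ}
    (h : (A ∩ slab u B).Finite) : (linePoints A u ∩ B).Finite := by
  refine ((h.image Prod.snd).union (h.image fun p => -p.2)).subset ?_
  rintro s ⟨⟨p, hA, hs, ⟨hv, rfl⟩ | ⟨hv, rfl⟩⟩, hB⟩
  · exact Or.inl ⟨p, ⟨hA, Or.inl ⟨hv, hB, hs⟩⟩, rfl⟩
  · exact Or.inr ⟨p, ⟨hA, Or.inr ⟨hv, hB, hs⟩⟩, rfl⟩

theorem measurableSet_slab (u : Sphere d) {B : Set ℝ} (hB : MeasurableSet B) :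
    MeasurableSet (slab u B) :=
  ((measurableSet_singleton _).prod (hB.inter measurableSet_Ioi)).union
    ((measurableSet_singleton _).prod (hB.neg.inter measurableSet_Ioi))

theorem slab_subset_fst (u : Sphere d) (B : Set ℝ) :
    slab u B ⊆ {p | p.1 = u ∨ p.1 = -u} := by
  rintro p (⟨h, -⟩ | ⟨h, -⟩)
  exacts [Or.inl h, Or.inr h]

theorem ne_neg_sphere (u : Sphere d) : u ≠ -u := by
  intro h
  have h1 : (u : Space d) = -u := congrArg Subtype.val h
  have h2 : ‖(u : Space d)‖ = 1 := by simp
  have h3 : (2 : ℝ) • (u : Space d) = 0 := by rw [two_smul]; exact add_eq_zero_iff_eq_neg.2 h1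
  rw [(smul_eq_zero.1 h3).resolve_left two_ne_zero, norm_zero] at h2
  exact zero_ne_one h2

theorem disjoint_slab (u : Sphere d) {B B' : Set ℝ} (h : Disjoint B B') :
    Disjoint (slab u B) (slab u B') := by
  rw [disjoint_left]
  rintro p (⟨hv, hB, -⟩ | ⟨hv, hB, -⟩) (⟨hv', hB', -⟩ | ⟨hv', hB', -⟩)
  · exact disjoint_left.1 h hB hB'
  · exact ne_neg_sphere u (hv.symm.trans hv')
  · exact ne_neg_sphere u (hv'.symm.trans hv)
  · exact disjoint_left.1 h hB hB'

/-- Evenness glues the half-lines belonging to `u` and `-u` into a full line with a single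
intensity; the missing origin is a null set. -/
theorem hyperplaneIntensity_slab (γ : ℝ) {φ : Measure (Sphere d)} [IsFiniteMeasure φ]
    {u : Sphere d} (hu : φ {-u} = φ {u}) {B : Set ℝ} (hB : MeasurableSet B) :
    hyperplaneIntensity γ φ (slab u B) = ENNReal.ofReal γ * φ {u} * volume B := by
  have hdisj : Disjoint (({u} : Set (Sphere d)) ×ˢ (B ∩ Ioi (0 : ℝ))) ({-u} ×ˢ (-B ∩ Ioi 0)) :=
    disjoint_left.2 fun p hp hp' => ne_neg_sphere u (hp.1.symm.trans hp'.1)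
  have hpos : (volume.restrict (Ioi (0 : ℝ))) (B ∩ Ioi 0) = volume (B ∩ Ioi 0) := by
    rw [Measure.restrict_apply (hB.inter measurableSet_Ioi), inter_assoc, inter_self]
  have hneg : (volume.restrict (Ioi (0 : ℝ))) (-B ∩ Ioi 0) = volume (B \ Ioi 0) := by
    rw [Measure.restrict_apply (hB.neg.inter measurableSet_Ioi), inter_assoc, inter_self,
      ← Measure.measure_neg volume (-B ∩ Ioi 0)]
    have h1 : -(-B ∩ Ioi (0 : ℝ)) = (B \ Ioi 0) \ {0} := by
      ext x
      simp only [Set.mem_neg, mem_inter_iff, neg_neg, mem_Ioi, Set.mem_sdiff, mem_singleton_iff,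
        Left.neg_pos_iff, not_lt]
      constructor
      · rintro ⟨h1, h2⟩
        exact ⟨⟨h1, h2.le⟩, h2.ne⟩
      · rintro ⟨⟨h1, h2⟩, h3⟩
        exact ⟨h1, lt_of_le_of_ne h2 h3⟩
    rw [h1, measure_sdiff_null (measure_singleton _)]
  rw [hyperplaneIntensity, Measure.smul_apply, slab, measure_union hdisj
    ((measurableSet_singleton _).prod (hB.neg.inter measurableSet_Ioi)), Measure.prod_prod,
    Measure.prod_prod, hu, ← mul_add, hpos, hneg, measure_inter_add_sdiff B measurableSet_Ioi,
    smul_eq_mul, mul_assoc]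

/-! ### Void events and local finiteness of Poisson processes -/

section Poisson

variable {α : Type*} [MeasurableSpace Ω] [MeasurableSpace α] {P : Measure Ω} {η : Ω → Set α}
  {L : Measure α}

theorem IsPoissonProcess.measure_void (hη : IsPoissonProcess P η L) {B : Set α}
    (hB : MeasurableSet B) (hL : L B ≠ ∞) :
    P {ω | (η ω ∩ B).encard = 0} = ENNReal.ofReal (Real.exp (-(L B).toReal)) := by
  have h1 : P {ω | (η ω ∩ B).encard = 0} = P.map (fun ω => (η ω ∩ B).encard) {0} := by
    rw [Measure.map_apply (hη.measurable_count B hB) (measurableSet_singleton _)]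
    rfl
  have h2 : (fun k : ℕ => (k : ℕ∞)) ⁻¹' {0} = {0} := by
    ext k; simp
  rw [h1, hη.law_count B hB hL, Measure.map_apply .of_discrete (measurableSet_singleton _), h2,
    poissonMeasure_singleton]
  simp [ENNReal.coe_toNNReal_eq_toReal]

theorem IsPoissonProcess.ae_finite (hη : IsPoissonProcess P η L) {B : Set α}
    (hB : MeasurableSet B) (hL : L B ≠ ∞) : ∀ᵐ ω ∂P, (η ω ∩ B).Finite := by
  have h1 : P.map (fun ω => (η ω ∩ B).encard) {⊤} = 0 := by
    have h2 : (fun k : ℕ => (k : ℕ∞)) ⁻¹' {⊤} = ∅ := by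
      ext k; simp
    rw [hη.law_count B hB hL, Measure.map_apply .of_discrete (measurableSet_singleton _), h2,
      measure_empty]
  rw [Measure.map_apply (hη.measurable_count B hB) (measurableSet_singleton _)] at h1
  refine measure_mono_null (fun ω hω => ?_) h1
  by_contra hne
  exact hω (encard_ne_top_iff.1 hne)

theorem IsPoissonProcess.ae_inter_eq_empty [IsProbabilityMeasure P] (hη : IsPoissonProcess P η L)
    {B : Set α} (hB : MeasurableSet B) (hL : L B = 0) : ∀ᵐ ω ∂P, η ω ∩ B = ∅ := by
  have h1 := hη.measure_void hB (by rw [hL]; exact ENNReal.zero_ne_top)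
  rw [hL, ENNReal.toReal_zero, neg_zero, Real.exp_zero, ENNReal.ofReal_one] at h1
  have hm : MeasurableSet {ω | (η ω ∩ B).encard = 0} :=
    hη.measurable_count B hB (measurableSet_singleton 0)
  have h2 := (prob_compl_eq_zero_iff hm).2 h1
  refine measure_mono_null (fun ω hω => ?_) h2
  exact fun h0 => hω (encard_eq_zero.1 h0)

theorem IsPoissonProcess.iIndepSet_void (hη : IsPoissonProcess P η L) {J : Type*} [Fintype J]
    {B : J → Set α} (hB : ∀ j, MeasurableSet (B j)) (hd : Pairwise fun i j => Disjoint (B i) (B j)) :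
    iIndepSet (fun j => {ω | (η ω ∩ B j).encard = 0}) P := by
  have e := Fintype.equivFin J
  have h1 := hη.indep_count (Fintype.card J) (fun k => B (e.symm k)) (fun k => hB _)
    fun i j hij => hd (e.symm.injective.ne hij)
  have h2 := h1.precomp e.injective
  simp only [Equiv.symm_apply_apply] at h2
  refine (iIndepSet_iff_meas_biInter fun j =>
    hη.measurable_count _ (hB j) (measurableSet_singleton 0)).2 fun s => ?_
  exact h2.measure_inter_preimage_eq_mul s (sets := fun _ => {0})
    fun _ _ => measurableSet_singleton _

end Poisson

variable [MeasurableSpace Ω] [Fintype ι] {P : Measure Ω} [IsProbabilityMeasure P]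
  {η : Ω → Set (Sphere d × ℝ)} {γ : ℝ} {φ : Measure (Sphere d)} [IsProbabilityMeasure φ]
  {u : ι → Sphere d}

theorem isSparse_of_forall_nat {N : Set ℝ} (h : ∀ n : ℕ, (N ∩ Icc (-n : ℝ) n).Finite) :
    IsSparse N := by
  intro a b
  obtain ⟨n, hn⟩ := exists_nat_ge (max (-a) b)
  refine (h n).subset (inter_subset_inter_right _ (Icc_subset_Icc ?_ ?_))
  · linarith [le_max_left (-a) b]
  · exact (le_max_right _ _).trans hn

/-- Injectivity of `direction u` makes the slabs of different classes disjoint, so independence over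
disjoint sets of hyperplanes becomes independence of the processes on the lines. -/
theorem IsPoissonProcess.isPoissonSystem (hη : IsPoissonProcess P η (hyperplaneIntensity γ φ))
    (hγ : 0 < γ) (hu : Function.Injective (direction u)) (hφ : ∀ i, φ {-u i} = φ {u i}) :
    IsPoissonSystem P (fun ω i => linePoints (η ω) (u i)) fun i => γ * φ.real {u i} where
  measurableSet_void i A hA := by
    simp only [linePoints_inter_eq_empty]
    exact hη.measurable_count _ (measurableSet_slab _ hA) (measurableSet_singleton 0)
  measure_void i A hA hv := by
    simp only [linePoints_inter_eq_empty]
    have hL := hyperplaneIntensity_slab γ (hφ i) hA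
    rw [hη.measure_void (measurableSet_slab _ hA), hL]
    · simp [ENNReal.toReal_mul, ENNReal.toReal_ofReal hγ.le, Measure.real]
    · rw [hL]
      exact ENNReal.mul_ne_top (ENNReal.mul_ne_top ENNReal.ofReal_ne_top (measure_ne_top _ _)) hv
  iIndepSet_void A hA hd := by
    simp only [linePoints_inter_eq_empty]
    refine hη.iIndepSet_void (B := fun j : ι × Fin 3 => slab (u j.1) (A j.1 j.2))
      (fun j => measurableSet_slab _ (hA j.1 j.2)) ?_
    rintro ⟨i, k⟩ ⟨i', k'⟩ hne
    by_cases hi : i = i'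
    · subst hi
      exact disjoint_slab _ (hd i fun hk => hne (Prod.ext rfl hk))
    · rw [disjoint_left]
      intro p hp hp'
      have key : ∀ b b', direction u (i, b) ≠ direction u (i', b') := fun b b' h =>
        hi (congrArg Prod.fst (hu h))
      have k1 := key true true
      have k2 := key true false
      have k3 := key false true
      have k4 := key false false
      simp only [direction, if_true, Bool.false_eq_true, if_false] at k1 k2 k3 k4
      rcases slab_subset_fst _ _ hp with h | h <;> rcases slab_subset_fst _ _ hp' with h' | h' <;>
        rw [h] at h' <;> contradiction
  ae_isSparse := by
    have : ∀ᵐ ω ∂P, ∀ i, ∀ n : ℕ, (η ω ∩ slab (u i) (Icc (-n : ℝ) n)).Finite := by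
      rw [ae_all_iff]
      intro i
      rw [ae_all_iff]
      intro n
      refine hη.ae_finite (measurableSet_slab _ measurableSet_Icc) ?_
      rw [hyperplaneIntensity_slab γ (hφ i) measurableSet_Icc]
      exact ENNReal.mul_ne_top (ENNReal.mul_ne_top ENNReal.ofReal_ne_top (measure_ne_top _ _))
        measure_Icc_lt_top.ne
    filter_upwards [this] with ω hω i
    exact isSparse_of_forall_nat fun n => linePoints_inter_finite (hω i n)

/-- A Poisson process on the line meets every set of infinite length. -/
theorem IsPoissonSystem.ae_inter_nonempty {N : Ω → ι → Set ℝ} {l : ι → ℝ}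
    (hN : IsPoissonSystem P N l) (hl : ∀ i, 0 < l i) (i : ι) {A : Set ℝ}
    (hA : ∀ n : ℕ, ∃ B ⊆ A, MeasurableSet B ∧ volume B = n) :
    ∀ᵐ ω ∂P, (N ω i ∩ A).Nonempty := by
  have hle : ∀ n : ℕ, P {ω | ¬(N ω i ∩ A).Nonempty} ≤ ENNReal.ofReal (Real.exp (-(l i * n))) := by
    intro n
    obtain ⟨B, hBA, hB, hv⟩ := hA n
    have := hN.measure_void i B hB (by rw [hv]; exact ENNReal.natCast_ne_top n)
    rw [hv, ENNReal.toReal_natCast] at this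
    rw [← this]
    refine measure_mono fun ω hω => ?_
    have hω : ¬(N ω i ∩ A).Nonempty := hω
    rw [not_nonempty_iff_eq_empty] at hω
    exact subset_eq_empty (inter_subset_inter_right _ hBA) hω
  have hlim : Tendsto (fun n : ℕ => ENNReal.ofReal (Real.exp (-(l i * n)))) atTop (𝓝 0) := by
    have h1 : Tendsto (fun n : ℕ => Real.exp (-(l i * n))) atTop (𝓝 0) :=
      Real.tendsto_exp_neg_atTop_nhds_zero.comp
        (tendsto_natCast_atTop_atTop.const_mul_atTop (hl i))
    have h2 := (ENNReal.continuous_ofReal.tendsto 0).comp h1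
    rwa [ENNReal.ofReal_zero] at h2
  exact le_zero_iff.1 (ge_of_tendsto' hlim hle)

/-- The regular realizations of the hyperplane process: the hyperplanes avoid the origin and have
the directions `± u i`, and the hyperplanes of each direction form a locally finite set that is
unbounded in both directions. -/
structure IsRegular (u : ι → Sphere d) (A : Set (Sphere d × ℝ)) : Prop where
  pos : ∀ p ∈ A, 0 < p.2
  exists_direction : ∀ p ∈ A, ∃ j, p.1 = direction u j
  isSparse : ∀ i, IsSparse (linePoints A (u i))
  exists_gt : ∀ i (x : ℝ), ∃ s ∈ linePoints A (u i), x < s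
  exists_lt : ∀ i (x : ℝ), ∃ s ∈ linePoints A (u i), s < x

theorem IsPoissonProcess.ae_isRegular (hη : IsPoissonProcess P η (hyperplaneIntensity γ φ))
    (hγ : 0 < γ) (hu : Function.Injective (direction u)) (hφ : ∀ i, φ {-u i} = φ {u i})
    (hφ0 : ∀ i, φ {u i} ≠ 0) (hran : φ (range (direction u))ᶜ = 0) :
    ∀ᵐ ω ∂P, IsRegular u (η ω) := by
  have hN := hη.isPoissonSystem hγ hu hφ
  have hl : ∀ i, 0 < γ * φ.real {u i} := fun i =>
    mul_pos hγ (ENNReal.toReal_pos (hφ0 i) (measure_ne_top _ _))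
  have hbad : ∀ᵐ ω ∂P, η ω ∩ {p | p.1 ∈ range (direction u) ∧ 0 < p.2}ᶜ = ∅ := by
    have hm : MeasurableSet (range (direction u)) := (finite_range _).measurableSet
    refine hη.ae_inter_eq_empty ((measurable_fst hm).inter
      (measurable_snd measurableSet_Ioi)).compl ?_
    have hsub : ({p : Sphere d × ℝ | p.1 ∈ range (direction u) ∧ 0 < p.2}ᶜ) ⊆
        ((range (direction u))ᶜ ×ˢ univ) ∪ (univ ×ˢ (Ioi 0)ᶜ) := by
      rintro p hp
      by_cases h1 : p.1 ∈ range (direction u)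
      · exact Or.inr ⟨mem_univ _, fun h2 => hp ⟨h1, h2⟩⟩
      · exact Or.inl ⟨h1, mem_univ _⟩
    refine measure_mono_null hsub (measure_union_null ?_ ?_)
    · simp [hyperplaneIntensity, Measure.prod_prod, hran]
    · rw [hyperplaneIntensity, Measure.smul_apply, Measure.prod_prod,
        Measure.restrict_apply measurableSet_Ioi.compl, compl_inter_self, measure_empty, mul_zero,
        smul_zero]
  have hgt : ∀ᵐ ω ∂P, ∀ i, ∀ n : ℕ, (linePoints (η ω) (u i) ∩ Ioi (n : ℝ)).Nonempty := by
    rw [ae_all_iff]; intro i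
    rw [ae_all_iff]; intro n
    refine hN.ae_inter_nonempty hl i fun k => ⟨Ioc n (n + k), fun x hx => hx.1, measurableSet_Ioc, ?_⟩
    rw [Real.volume_Ioc, add_sub_cancel_left, ENNReal.ofReal_natCast]
  have hlt : ∀ᵐ ω ∂P, ∀ i, ∀ n : ℕ, (linePoints (η ω) (u i) ∩ Iio (-n : ℝ)).Nonempty := by
    rw [ae_all_iff]; intro i
    rw [ae_all_iff]; intro n
    refine hN.ae_inter_nonempty hl i fun k =>
      ⟨Ico (-n - k) (-n), fun x hx => hx.2, measurableSet_Ico, ?_⟩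
    rw [Real.volume_Ico, sub_sub_cancel, ENNReal.ofReal_natCast]
  filter_upwards [hbad, hgt, hlt, hN.ae_isSparse] with ω h1 h2 h3 h4
  have h1' : ∀ p ∈ η ω, p.1 ∈ range (direction u) ∧ 0 < p.2 := fun p hp => by
    by_contra hcon
    exact (h1 ▸ (⟨hp, hcon⟩ : p ∈ η ω ∩ {p | p.1 ∈ range (direction u) ∧ 0 < p.2}ᶜ) :
      p ∈ (∅ : Set (Sphere d × ℝ)))
  refine ⟨fun p hp => (h1' p hp).2, fun p hp => (h1' p hp).1.imp fun _ h => h.symm, h4,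
    fun i x => ?_, fun i x => ?_⟩
  · obtain ⟨n, hn⟩ := exists_nat_ge x
    obtain ⟨s, hs, hns⟩ := h2 i n
    exact ⟨s, hs, hn.trans_lt hns⟩
  · obtain ⟨n, hn⟩ := exists_nat_ge (-x)
    obtain ⟨s, hs, hns⟩ := h3 i n
    have : s < -n := hns
    exact ⟨s, hs, by linarith⟩

end Classes

/-! ### The cells of a regular realization -/

section Cells

variable {d : ℕ} {ι : Type*} [Fintype ι] {u : ι → Sphere d} {A : Set (Sphere d × ℝ)}
  {l : ι × Bool → ℝ}

/-- The facet normals `± u i` as vectors. -/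
def normal (u : ι → Sphere d) (j : ι × Bool) : Space d := direction u j

theorem normal_true (u : ι → Sphere d) (i : ι) : normal u (i, true) = u i := by
  simp [normal, direction]

theorem normal_false (u : ι → Sphere d) (i : ι) : normal u (i, false) = -(u i : Space d) := by
  simp [normal, direction]

theorem forall_inner_normal_lt {x : Space d} {t : ι × Bool → ℝ} :
    (∀ j, inner ℝ x (normal u j) < t j) ↔
      ∀ i, -t (i, false) < inner ℝ x (u i : Space d) ∧ inner ℝ x (u i : Space d) < t (i, true) := by
  simp only [Prod.forall, Bool.forall_bool, normal_true, normal_false, inner_neg_right]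
  exact forall_congr' fun i => and_congr_left fun _ => neg_lt

theorem IsRegular.mem_offHyperplanes (hA : IsRegular u A) {x : Space d} :
    x ∈ offHyperplanes A ↔ ∀ i, inner ℝ x (u i : Space d) ∉ linePoints A (u i) := by
  simp only [offHyperplanes, mem_compl_iff, mem_iUnion, not_exists]
  constructor
  · rintro h i ⟨p, hp, -, ⟨h1, h2⟩ | ⟨h1, h2⟩⟩
    · refine h p hp ?_
      change inner ℝ x (p.1 : Space d) = p.2
      rw [h1, h2]
    · refine h p hp ?_
      change inner ℝ x (p.1 : Space d) = p.2
      rw [h1]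
      change inner ℝ x (-(u i : Space d)) = p.2
      rw [inner_neg_right]
      linarith
  · intro h p hp hx
    change inner ℝ x (p.1 : Space d) = p.2 at hx
    obtain ⟨⟨i, b⟩, hj⟩ := hA.exists_direction p hp
    refine h i ⟨p, hp, hA.pos p hp, ?_⟩
    cases b
    · right
      have h1 : p.1 = -u i := by simpa [direction] using hj
      refine ⟨h1, ?_⟩
      rw [← hx, h1]
      change -inner ℝ x (-(u i : Space d)) = _
      rw [inner_neg_right, neg_neg]
    · left
      have h1 : p.1 = u i := by simpa [direction] using hj
      exact ⟨h1, by rw [← hx, h1]⟩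

theorem IsSparse.exists_isGap_around {N : Set ℝ} (hN : IsSparse N) (hgt : ∀ x, ∃ s ∈ N, x < s)
    (hlt : ∀ x, ∃ s ∈ N, s < x) {x : ℝ} (hx : x ∉ N) : ∃ a b, IsGap N a b ∧ a < x ∧ x < b := by
  obtain ⟨r, hr, hrx⟩ := hlt x
  obtain ⟨s, hs, hxs⟩ := hgt x
  obtain ⟨a, ha, b, hb, hab⟩ := hN.exists_isGap (a₁ := r) (a₂ := x) (b₁ := x) (b₂ := s)
    ⟨r, hr, le_rfl, hrx⟩ (by rw [Icc_self, inter_singleton_eq_empty]; exact hx)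
    ⟨s, hs, hxs, le_rfl⟩ le_rfl
  exact ⟨a, b, hab, ha.2, hb.1⟩

/-- The open intersection of slabs is convex and avoids the hyperplanes, so it lies in the
component. Conversely, the image of the component under `⟨·, u i⟩` is an interval that avoids the
end points of the gap. -/
theorem IsRegular.connectedComponentIn_eq (hA : IsRegular u A) {t : ι × Bool → ℝ}
    (ht : t ∈ gapParams fun i => linePoints A (u i)) {x : Space d}
    (hx : ∀ j, inner ℝ x (normal u j) < t j) :
    x ∈ offHyperplanes A ∧ connectedComponentIn (offHyperplanes A) x =
      {y | ∀ j, inner ℝ y (normal u j) < t j} := by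
  have hsub : {y | ∀ j, inner ℝ y (normal u j) < t j} ⊆ offHyperplanes A := by
    intro y hy
    rw [hA.mem_offHyperplanes]
    exact fun i hi => (ht i).2.2.2 _ hi (forall_inner_normal_lt.1 hy i)
  have hconv : Convex ℝ {y | ∀ j, inner ℝ y (normal u j) < t j} := by
    simp only [ofPred_forall]
    refine convex_iInter fun j => convex_halfSpace_lt (f := fun y => inner ℝ y (normal u j)) ?_ _
    exact ⟨fun y z => inner_add_left _ _ _, fun c y => real_inner_smul_left _ _ _⟩
  have hxo : x ∈ offHyperplanes A := hsub hx
  refine ⟨hxo, Subset.antisymm (fun y hy => ?_)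
    (hconv.isPreconnected.subset_connectedComponentIn hx hsub)⟩
  refine forall_inner_normal_lt.2 fun i => ?_
  have himg : ((fun y : Space d => inner ℝ y (u i : Space d)) ''
      connectedComponentIn (offHyperplanes A) x).OrdConnected :=
    (isPreconnected_connectedComponentIn.image _ (by fun_prop)).ordConnected
  have hxm : inner ℝ x (u i : Space d) ∈ (fun y : Space d => inner ℝ y (u i : Space d)) ''
      connectedComponentIn (offHyperplanes A) x :=
    mem_image_of_mem _ (mem_connectedComponentIn hxo)
  have hym := mem_image_of_mem (fun y : Space d => inner ℝ y (u i : Space d)) hy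
  have hnot : ∀ s ∈ linePoints A (u i), s ∉ (fun y : Space d => inner ℝ y (u i : Space d)) ''
      connectedComponentIn (offHyperplanes A) x := by
    rintro _ hs ⟨z, hz, rfl⟩
    exact hA.mem_offHyperplanes.1 (connectedComponentIn_subset _ _ hz) i hs
  obtain ⟨h1, h2⟩ := forall_inner_normal_lt.1 hx i
  constructor
  · by_contra! hcon
    exact hnot _ (ht i).1 (himg.out hym hxm ⟨hcon, h1.le⟩)
  · by_contra! hcon
    exact hnot _ (ht i).2.1 (himg.out hxm hym ⟨h2.le, hcon⟩)

theorem closure_interior_polytope {J : Type*} [Fintype J] {v : J → Space d} {l : J → ℝ}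
    (h : IsBalanced v l) {t : J → ℝ} (ht : t ∈ solid v) :
    closure {y | ∀ j, inner ℝ y (v j) < t j} = polytope v t := by
  have hne : (interior (polytope v t)).Nonempty := by rw [interior_polytope h]; exact ht
  rw [← interior_polytope h, (convex_polytope v t).closure_interior_eq_closure_of_nonempty_interior
    hne, (isClosed_polytope v t).closure_eq]

/-- The cells are the polytopes of the systems of gaps. -/
theorem IsRegular.cells_eq (hA : IsRegular u A) (h : IsBalanced (normal u) l) :
    cells A = body (normal u) ''
      ((gapParams fun i => linePoints A (u i)) ∩ solid (normal u)) := by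
  ext K
  constructor
  · rintro ⟨x, hx, hK⟩
    choose a b hab hax hxb using fun i => (hA.isSparse i).exists_isGap_around (hA.exists_gt i)
      (hA.exists_lt i) (hA.mem_offHyperplanes.1 hx i)
    set t : ι × Bool → ℝ := fun j => if j.2 then b j.1 else -a j.1 with htdef
    have ht : t ∈ gapParams fun i => linePoints A (u i) := fun i => by simpa [htdef] using hab i
    have hxt : ∀ j, inner ℝ x (normal u j) < t j :=
      forall_inner_normal_lt.2 fun i => by simpa [htdef] using ⟨hax i, hxb i⟩
    refine ⟨t, ⟨ht, x, hxt⟩, Subtype.ext (ConvexBody.ext ?_)⟩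
    rw [hK, (hA.connectedComponentIn_eq ht hxt).2, coe_body h ⟨x, hxt⟩,
      closure_interior_polytope h ⟨x, hxt⟩]
  · rintro ⟨t, ⟨ht, x, hxt⟩, rfl⟩
    obtain ⟨h1, h2⟩ := hA.connectedComponentIn_eq ht hxt
    refine ⟨x, h1, ?_⟩
    rw [h2, coe_body h ⟨x, hxt⟩, closure_interior_polytope h ⟨x, hxt⟩]

/-- Redundant constraints destroy injectivity of `body` on general parameters. For gap systems, an
interior point of the common polytope lies inside both `i`-th gaps, and gaps with a common inner
point coincide. -/
theorem injOn_body_gapParams {N : ι → Set ℝ} (h : IsBalanced (normal u) l) :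
    InjOn (body (normal u)) (gapParams N ∩ solid (normal u)) := by
  rintro s ⟨hs, hs'⟩ t ⟨ht, ht'⟩ hst
  have h1 : polytope (normal u) s = polytope (normal u) t := by
    rw [← coe_body h hs', ← coe_body h ht', hst]
  obtain ⟨x, hx⟩ := id hs'
  have hxt : ∀ j, inner ℝ x (normal u j) < t j := by
    have : x ∈ interior (polytope (normal u) s) := by rw [interior_polytope h]; exact hx
    rwa [h1, interior_polytope h] at this
  have hx := forall_inner_normal_lt.1 hx
  have hxt := forall_inner_normal_lt.1 hxt
  ext ⟨i, b⟩
  have := (hs i).eq_of_lt_of_lt (ht i) (hx i).1 (hx i).2 (hxt i).1 (hxt i).2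
  cases b
  · linarith [this.1]
  · exact this.2

theorem IsRegular.mosaic_apply (hA : IsRegular u A) (h : IsBalanced (normal u) l)
    {D : Set (FatBody d)} (hD : MeasurableSet D) :
    mosaic A D = (((gapParams fun i => linePoints A (u i)) ∩
      (solid (normal u) ∩ body (normal u) ⁻¹' D)).encard : ℝ≥0∞) := by
  rw [mosaic, sum_dirac_apply _ hD, hA.cells_eq h, ← inter_assoc, ← image_inter_preimage,
    ((injOn_body_gapParams h).mono inter_subset_left).encard_image]

/-- The parameters of polytopes with interior points come from intervals of positive length. -/
theorem add_pos_of_mem_solid {t : ι × Bool → ℝ} (ht : t ∈ solid (normal u)) (i : ι) :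
    0 < t (i, false) + t (i, true) := by
  obtain ⟨x, hx⟩ := ht
  have := forall_inner_normal_lt.1 hx i
  linarith [this.1, this.2]

variable {Ω : Type*} [MeasurableSpace Ω] {P : Measure Ω} [IsProbabilityMeasure P]
  {η : Ω → Set (Sphere d × ℝ)} {γ : ℝ} {φ : Measure (Sphere d)} [IsProbabilityMeasure φ]

/-- The mean number of cells with a given property. -/
theorem IsPoissonProcess.mosaicIntensity_apply
    (hη : IsPoissonProcess P η (hyperplaneIntensity γ φ)) (hγ : 0 < γ)
    (hu : Function.Injective (direction u)) (hφ : ∀ i, φ {-u i} = φ {u i})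
    (hφ0 : ∀ i, φ {u i} ≠ 0) (hran : φ (range (direction u))ᶜ = 0)
    (h : IsBalanced (normal u) l) {D : Set (FatBody d)} (hD : MeasurableSet D) :
    mosaicIntensity P η D = gapIntensity (fun i => γ * φ.real {u i})
      (solid (normal u) ∩ body (normal u) ⁻¹' D) := by
  have hN := hη.isPoissonSystem hγ hu hφ
  have hl : ∀ i, 0 < γ * φ.real {u i} := fun i =>
    mul_pos hγ (ENNReal.toReal_pos (hφ0 i) (measure_ne_top _ _))
  have hreg := hη.ae_isRegular hγ hu hφ hφ0 hran
  -- The regular realizations have full measure but are not known to form a measurable set, so a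
  -- measurable null set containing the others is removed.
  set Z := toMeasurable P {ω | ¬IsRegular u (η ω)} with hZ
  have hZ0 : P Z = 0 := by rw [hZ, measure_toMeasurable]; exact hreg
  have hΩ₀ : MeasurableSet Zᶜ := (measurableSet_toMeasurable _ _).compl
  have hΩ₀P : P Zᶜᶜ = 0 := by rwa [compl_compl]
  have hΩ₀R : ∀ ω ∈ Zᶜ, IsRegular u (η ω) := fun ω hω => by
    by_contra hcon
    exact hω (subset_toMeasurable P _ hcon)
  have key := fun (D : Set (FatBody d)) (hD : MeasurableSet D) =>
    hN.lintegral_encard hl hΩ₀ hΩ₀P (fun ω hω i => (hΩ₀R ω hω).isSparse i)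
      ((isOpen_solid (normal u)).measurableSet.inter (measurable_body h hD))
      fun t ht i => add_pos_of_mem_solid ht.1 i
  have hfun : ∀ D : Set (FatBody d), MeasurableSet D →
      (fun ω => Zᶜ.indicator (fun ω => ((gapParams (fun i => linePoints (η ω) (u i)) ∩
        (solid (normal u) ∩ body (normal u) ⁻¹' D)).encard : ℝ≥0∞)) ω) =
      fun ω => Zᶜ.indicator (fun ω => mosaic (η ω)) ω D := by
    intro D hD
    ext ω
    by_cases hω : ω ∈ Zᶜ
    · rw [indicator_of_mem hω, indicator_of_mem hω, (hΩ₀R ω hω).mosaic_apply h hD]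
    · rw [indicator_of_notMem hω, indicator_of_notMem hω]
      rfl
  have hmeas : Measurable fun ω => Zᶜ.indicator (fun ω => mosaic (η ω)) ω :=
    Measure.measurable_of_measurable_coe _ fun D hD => by
      rw [← hfun D hD]
      exact (key D hD).1
  have hae : (fun ω => mosaic (η ω)) =ᵐ[P] fun ω => Zᶜ.indicator (fun ω => mosaic (η ω)) ω := by
    have : ∀ᵐ ω ∂P, ω ∈ Zᶜ := hΩ₀P
    filter_upwards [this] with ω hω
    rw [indicator_of_mem hω]
  rw [mosaicIntensity, Measure.bind_apply hD (hmeas.aemeasurable.congr hae.symm)]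
  have hae' : (fun ω => mosaic (η ω) D) =ᵐ[P]
      fun ω => Zᶜ.indicator (fun ω => mosaic (η ω)) ω D := by
    filter_upwards [hae] with ω hω
    rw [hω]
  rw [lintegral_congr_ae hae', ← hfun D hD, (key D hD).2]

end Cells

/-! ### Directional distributions with finite support -/

section Directions

variable {d : ℕ} {φ : Measure (Sphere d)}

/-- Removing the other points of the finite carrier leaves a neighbourhood of `w` in which only `w`
can be charged. -/
theorem measure_singleton_ne_zero_of_mem_support {F : Set (Sphere d)} (hF : F.Finite)
    (hφ : φ Fᶜ = 0) {w : Sphere d} (hw : w ∈ φ.support) : φ {w} ≠ 0 := by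
  intro h0
  have hU : (F \ {w})ᶜ ∈ 𝓝 w := (hF.subset sdiff_subset).isClosed.isOpen_compl.mem_nhds (by simp)
  have h1 := (Measure.mem_support_iff_forall w).1 hw _ hU
  refine h1.ne' (measure_mono_null (t := Fᶜ ∪ {w}) (fun x hx => ?_) (measure_union_null hφ h0))
  by_cases hxF : x ∈ F
  · by_contra hcon
    exact hx ⟨hxF, fun hxw => hcon (Or.inr hxw)⟩
  · exact Or.inl hxF

theorem finite_support {F : Set (Sphere d)} (hF : F.Finite) (hφ : φ Fᶜ = 0) : φ.support.Finite :=
  hF.subset (Measure.support_subset_of_isClosed hF.isClosed (mem_ae_iff.2 hφ))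

theorem measure_neg_singleton (heven : φ.map (fun u => -u) = φ) (w : Sphere d) :
    φ {-w} = φ {w} := by
  conv_rhs => rw [← heven]
  rw [Measure.map_apply (by fun_prop) (measurableSet_singleton _)]
  congr 1
  ext x
  simp

/-- An even measure with finite support is carried by finitely many pairs of directions. -/
theorem exists_direction_range_eq_support (heven : φ.map (fun u => -u) = φ)
    {F : Set (Sphere d)} (hF : F.Finite) (hφ : φ Fᶜ = 0) :
    ∃ (ι : Type) (_ : Fintype ι) (u : ι → Sphere d), Function.Injective (direction u) ∧
      range (direction u) = φ.support := by
  -- The lexicographic order of coordinates selects one vector from each antipodal pair.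
  let key : Sphere d → Lex (Fin d → ℝ) := fun w => toLex fun i => (w : Space d) i
  have hkey : Function.Injective key := fun w w' h => by
    apply Subtype.ext
    ext i
    exact congrFun (toLex.injective h) i
  let H : Set (Sphere d) := {w | w ∈ φ.support ∧ key (-w) < key w}
  have hH : H.Finite := (finite_support hF hφ).subset fun w hw => hw.1
  have hneg : ∀ w ∈ φ.support, -w ∈ φ.support := by
    intro w hw
    rw [Measure.mem_support_iff_forall]
    intro U hU
    have h0 := measure_singleton_ne_zero_of_mem_support hF hφ hw
    rw [← measure_neg_singleton heven] at h0
    exact (pos_iff_ne_zero.2 h0).trans_le (measure_mono (singleton_subset_iff.2 (mem_of_mem_nhds hU)))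
  have hasymm : ∀ w ∈ H, -w ∉ H := fun w hw hw' => by
    have := hw'.2
    rw [neg_neg] at this
    exact lt_asymm this hw.2
  refine ⟨H, hH.fintype, fun w => w, ?_, ?_⟩
  · rintro ⟨⟨w, hw⟩, b⟩ ⟨⟨w', hw'⟩, b'⟩ h
    cases b <;> cases b' <;>
      simp only [direction, if_true, Bool.false_eq_true, if_false] at h
    · obtain rfl : w = w' := neg_injective h
      rfl
    · exact absurd (h ▸ hw') (hasymm w hw)
    · exact absurd (h ▸ hw) (hasymm w' hw')
    · obtain rfl : w = w' := h
      rfl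
  · ext w
    constructor
    · rintro ⟨⟨⟨w, hw⟩, b⟩, rfl⟩
      cases b
      · exact hneg w hw.1
      · exact hw.1
    · intro hw
      rcases lt_or_gt_of_ne (hkey.ne (ne_neg_sphere w).symm) with h | h
      · exact ⟨(⟨w, hw, h⟩, true), rfl⟩
      · exact ⟨(⟨-w, hneg w hw, by rwa [neg_neg]⟩, false), neg_neg w⟩

variable {ι : Type*} [Fintype ι] {u : ι → Sphere d}

theorem isBalanced_normal (hu : Function.Injective (direction u)) {l : ι → ℝ}
    (hl : ∀ i, 0 < l i)
    (hspan : ∀ x : Space d, x ≠ 0 → ∃ w ∈ range (direction u), inner ℝ (w : Space d) x ≠ 0) :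
    IsBalanced (normal u) fun j => l j.1 where
  norm_eq j := by simp [normal]
  injective := Subtype.val_injective.comp hu
  pos j := hl j.1
  sum_smul := by
    rw [Fintype.sum_prod_type]
    refine Finset.sum_eq_zero fun i _ => ?_
    rw [Fintype.sum_bool, normal_true, normal_false, smul_neg, add_neg_cancel]
  span x hx := by
    obtain ⟨_, ⟨j, rfl⟩, hj⟩ := hspan x hx
    exact ⟨j, by rwa [real_inner_comm]⟩

/-- The functionals `⟨·, u i⟩` separate points, so there are at least `d` pairs; hence `2 * card ι -
d ≥ d`, and the Gamma exponent is positive. -/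
theorem card_directions {l : ι × Bool → ℝ} (h : IsBalanced (normal u) l) (hd : 2 ≤ d) :
    ∃ m, 1 ≤ m ∧ Fintype.card (ι × Bool) = m + d := by
  let T : Space d →ₗ[ℝ] (ι → ℝ) :=
    { toFun := fun x i => inner ℝ x (u i : Space d)
      map_add' := fun x y => by ext i; simp [inner_add_left]
      map_smul' := fun r x => by ext i; simp [real_inner_smul_left] }
  have hT : Function.Injective T := by
    rw [← LinearMap.ker_eq_bot, LinearMap.ker_eq_bot']
    intro x hx
    by_contra hne
    obtain ⟨⟨i, b⟩, hj⟩ := h.span x hne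
    have h0 : inner ℝ x (u i : Space d) = 0 := congrFun hx i
    cases b
    · rw [normal_false, inner_neg_right, h0, neg_zero] at hj
      exact hj rfl
    · rw [normal_true] at hj
      exact hj h0
  have := LinearMap.finrank_le_finrank_of_injective hT
  rw [finrank_euclideanSpace, Fintype.card_fin, Module.finrank_fintype_fun_eq_card] at this
  refine ⟨2 * Fintype.card ι - d, by omega, ?_⟩
  rw [Fintype.card_prod, Fintype.card_bool]
  omega

theorem content_eq_mul_phiContent [IsProbabilityMeasure φ] {γ : ℝ}
    (hu : Function.Injective (direction u))
    (hφ : ∀ i, φ {-u i} = φ {u i}) (hran : φ (range (direction u))ᶜ = 0)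
    (K : ConvexBody (Space d)) :
    content (normal u) (fun j => γ * φ.real {u j.1}) K = γ * phiContent φ K := by
  classical
  set s : Finset (Sphere d) := Finset.univ.image (direction u) with hs
  have hsr : (s : Set (Sphere d)) = range (direction u) := by simp [hs]
  have hres : φ.restrict s = φ := Measure.restrict_eq_self_of_ae_mem (by
    rw [hsr]; exact hran)
  have h1 : phiContent φ K = ∑ w ∈ s, φ.real {w} * supportFn K w := by
    rw [phiContent]
    conv_lhs => rw [← hres]
    rw [setIntegral_finset s IntegrableOn.finset]
    simp
  rw [h1, hs, Finset.sum_image hu.injOn, Finset.mul_sum, content]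
  refine Finset.sum_congr rfl fun j _ => ?_
  have : φ.real {direction u j} = φ.real {u j.1} := by
    obtain ⟨i, b⟩ := j
    cases b
    · simp only [direction, Bool.false_eq_true, if_false, Measure.real, hφ]
    · simp [direction]
  rw [this, mul_assoc]
  rfl

end Directions

/-! ### The law of the typical cell -/

section TypicalCell

variable {d : ℕ} {J : Type*} [Fintype J] {v : J → Space d} {l : J → ℝ} {c : FatBody d → Space d}

/-- The parameters of polytopes with interior points and a given property. -/
def solidWith (v : J → Space d) (D : Set (FatBody d)) : Set (J → ℝ) :=
  {t | t ∈ solid v ∧ body v t ∈ D}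

theorem isHomothetic_solidWith (h : IsBalanced v l) {D : Set (FatBody d)} (hD : MeasurableSet D)
    (hinv : ∀ (r : ℝ) (hr : 0 < r) (x : Space d), ∀ K ∈ D, FatBody.smulAdd r hr x K ∈ D) :
    IsHomothetic v (solidWith v D) where
  measurableSet := (isOpen_solid v).measurableSet.inter (measurable_body h hD)
  subset_solid _ ht := ht.1
  smul_add_shift_mem r hr x t ht :=
    ⟨smul_add_shift_mem_solid hr x ht.1, by
      rw [body_smul_add_shift h ht.1 hr]; exact hinv r hr x _ ht.2⟩

theorem IsHomothetic.inter_irredundant {B : Set (J → ℝ)} (hB : IsHomothetic v B) :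
    IsHomothetic v (B ∩ irredundant v) where
  measurableSet := hB.measurableSet.inter (isOpen_irredundant v).measurableSet
  subset_solid _ ht := hB.subset_solid ht.1
  smul_add_shift_mem r hr x t ht :=
    ⟨hB.smul_add_shift_mem r hr x t ht.1, smul_add_shift_mem_irredundant hr x ht.2⟩

/-- The tail asymptotics produce touching constraints, while the number of facets sees irredundant
ones; the difference is null. -/
theorem IsHomothetic.volume_levelSet_irredundant {B : Set (J → ℝ)} (hB : IsHomothetic v B)
    (A : Set (Space d)) (r : ℝ) :
    volume (levelSet v l c (B ∩ irredundant v) A r) = volume (levelSet v l c (B ∩ tight v) A r) := by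
  refine le_antisymm (measure_mono fun t ht => ?_) ?_
  · exact ⟨⟨ht.1.1, irredundant_subset_tight ⟨hB.subset_solid ht.1.1, ht.1.2⟩⟩, ht.2⟩
  · refine (measure_mono (t := levelSet v l c (B ∩ irredundant v) A r ∪
      ((solid v ∩ tight v) \ irredundant v)) fun t ht => ?_).trans ((measure_union_le _ _).trans ?_)
    · by_cases hi : t ∈ irredundant v
      · exact Or.inl ⟨⟨ht.1.1, hi⟩, ht.2⟩
      · exact Or.inr ⟨⟨hB.subset_solid ht.1.1, ht.1.2⟩, hi⟩
    · rw [volume_tight_diff_irredundant, add_zero]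

theorem solidWith_univ : solidWith v univ = solid v := by
  ext t; simp [solidWith]

theorem isHomothetic_solid (h : IsBalanced v l) : IsHomothetic v (solid v) := by
  rw [← solidWith_univ]
  exact isHomothetic_solidWith h MeasurableSet.univ fun _ _ _ _ _ => mem_univ _

/-- If the volume vanished for the cube, the proportionality constant would be zero. The level set
with unrestricted centers would then be null as well, although it contains a non-empty open set. -/
theorem volume_levelSet_irredundant_ne_zero (h : IsBalanced v l) (hc : IsCenterFunction c) :
    volume (levelSet v l c (solid v ∩ irredundant v) (cube d) 1) ≠ 0 := by
  intro h0
  obtain ⟨C, hC⟩ := (isHomothetic_solid h).inter_irredundant.exists_volume_levelSet h hc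
  rw [hC _ measurableSet_cube, mul_eq_zero] at h0
  have hCz := h0.resolve_right volume_cube_ne_zero
  have h1 := hC univ MeasurableSet.univ
  rw [hCz, zero_mul] at h1
  have hopen : IsOpen {t : J → ℝ | t ∈ solid v ∩ irredundant v ∧ level l t < 1} :=
    ((isOpen_solid v).inter (isOpen_irredundant v)).inter
      (isOpen_lt (continuous_level l) continuous_const)
  have hne : {t : J → ℝ | t ∈ solid v ∩ irredundant v ∧ level l t < 1}.Nonempty := by
    obtain ⟨h1, h2⟩ := one_mem_irredundant h
    -- The parameter `1` is solid and irredundant but may have large level; scaling by `r` brings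
    -- the level below one.
    set r : ℝ := (1 + |level l (1 : J → ℝ)|)⁻¹ with hr
    have hr0 : 0 < r := by positivity
    refine ⟨r • (1 : J → ℝ) + shift v 0, ⟨smul_add_shift_mem_solid hr0 0 h1,
      smul_add_shift_mem_irredundant hr0 0 h2⟩, ?_⟩
    rw [level_smul_add_shift h, hr, inv_mul_lt_iff₀ (by positivity), mul_one]
    linarith [le_abs_self (level l (1 : J → ℝ))]
  refine (hopen.measure_pos volume hne).ne' (measure_mono_null (fun t ht => ?_) h1)
  exact ⟨ht.1, mem_univ _, ht.2.le⟩

theorem gammaTotal_ne_zero {m : ℕ} (hm : 1 ≤ m) : gammaTotal m ≠ 0 := fun h0 =>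
  gammaTail_ne_zero hm 0 (le_zero_iff.1 (h0 ▸ gammaTail_le_gammaTotal 0))

theorem inv_div_mul_div {x y M : ℝ≥0∞} (h0 : M ≠ 0) (htop : M ≠ ∞) :
    (x / M)⁻¹ * (y / M) = y / x := by
  rw [ENNReal.inv_div (Or.inl htop) (Or.inl h0), div_eq_mul_inv, div_eq_mul_inv, div_eq_mul_inv,
    mul_comm, mul_assoc, ← mul_assoc M⁻¹, ENNReal.inv_mul_cancel h0 htop, one_mul]

/-- The bodies that are the polytope of their support function. -/
def polytopes (v : J → Space d) : Set (FatBody d) :=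
  {K | (fun j => supportFn K.1 (v j)) ∈ solid v ∧ body v (fun j => supportFn K.1 (v j)) = K}

theorem measurable_supportFns (v : J → Space d) :
    Measurable fun K : FatBody d => fun j => supportFn K.1 (v j) :=
  measurable_pi_lambda _ fun j => (continuous_supportFn (v j)).measurable.comp measurable_subtype_coe

theorem measurableSet_polytopes (h : IsBalanced v l) : MeasurableSet (polytopes v) :=
  (measurable_supportFns v (isOpen_solid v).measurableSet).inter
    (measurableSet_eq_fun ((measurable_body h).comp (measurable_supportFns v)) measurable_id)

theorem body_mem_polytopes (h : IsBalanced v l) {t : J → ℝ} (ht : t ∈ solid v) :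
    body v t ∈ polytopes v :=
  body_supportFn h ht

theorem centered_body (h : IsBalanced v l) {t : J → ℝ} (ht : t ∈ solid v) :
    (1 : ℝ) • t + shift v (-(c (body v t))) ∈ solid v ∧
      centered c (body v t) = body v ((1 : ℝ) • t + shift v (-(c (body v t)))) :=
  ⟨smul_add_shift_mem_solid one_pos _ ht, (body_smul_add_shift h ht one_pos _).symm⟩

theorem smul_add_shift_mem_irredundant_iff {t : J → ℝ} (x : Space d) :
    (1 : ℝ) • t + shift v x ∈ irredundant v ↔ t ∈ irredundant v := by
  refine ⟨fun ht => ?_, smul_add_shift_mem_irredundant one_pos x⟩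
  have := smul_add_shift_mem_irredundant one_pos (-x) ht
  rwa [one_smul, one_smul, add_assoc, ← shift_add, add_neg_cancel,
    show shift v (0 : Space d) = 0 by ext j; simp [shift], add_zero] at this

/-- A law on convex bodies that is given by normalized masses of parameters. -/
structure IsPolytopeLaw (v : J → Space d) (l : J → ℝ) (c : FatBody d → Space d)
    (Q : Measure (FatBody d)) : Prop where
  apply_eq : ∀ D, MeasurableSet D →
    Q D = mass v l c {t | t ∈ solid v ∧ centered c (body v t) ∈ D} / mass v l c (solid v)

section

variable [Nonempty J] (h : IsBalanced v l) (hc : IsCenterFunction c) {m : ℕ}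
  (hm : Fintype.card J = m + d) (hm1 : 1 ≤ m) {Q : Measure (FatBody d)}
  (hQ : IsPolytopeLaw v l c Q)

include h hc hm hm1

theorem mass_solid_ne_zero : mass v l c (solid v) ≠ 0 := by
  rw [(isHomothetic_solid h).mass_eq h hc hm hm1]
  refine mul_ne_zero (fun h0 => volume_levelSet_irredundant_ne_zero h hc ?_) (gammaTotal_ne_zero hm1)
  refine measure_mono_null ?_ h0
  exact fun t ht => ⟨ht.1.1, ht.2⟩

theorem mass_solid_ne_top : mass v l c (solid v) ≠ ∞ := by
  rw [(isHomothetic_solid h).mass_eq h hc hm hm1]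
  exact ENNReal.mul_ne_top (volume_levelSet_lt_top h hc subset_rfl isBounded_cube 1).ne
    gammaTotal_lt_top.ne

include hQ

theorem IsPolytopeLaw.isProbabilityMeasure : IsProbabilityMeasure Q := ⟨by
  rw [hQ.apply_eq _ MeasurableSet.univ]
  simp only [mem_univ, and_true]
  exact ENNReal.div_self (mass_solid_ne_zero h hc hm hm1) (mass_solid_ne_top h hc hm hm1)⟩

omit [Nonempty J] hc hm hm1 in
theorem IsPolytopeLaw.ae_mem_polytopes : ∀ᵐ K ∂Q, K ∈ polytopes v := by
  change Q (polytopes v)ᶜ = 0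
  rw [hQ.apply_eq _ (measurableSet_polytopes h).compl]
  have : {t | t ∈ solid v ∧ centered c (body v t) ∈ (polytopes v)ᶜ} = ∅ := by
    rw [eq_empty_iff_forall_notMem]
    rintro t ⟨ht, hn⟩
    obtain ⟨h1, h2⟩ := centered_body (c := c) h ht
    exact hn (h2 ▸ body_mem_polytopes h h1)
  rw [this, mass]
  simp

omit [Nonempty J] hc hm hm1 in
theorem IsPolytopeLaw.ae_facetNumber_le (hd : 2 ≤ d) :
    ∀ᵐ K ∂Q, facetNumber K.1 ≤ Fintype.card J := by
  filter_upwards [hQ.ae_mem_polytopes h] with K hK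
  rw [← hK.2]
  exact facetNumber_body_le hd h hK.1

/-- Almost surely the body is the polytope of its own support values. The facet event can then be
replaced by irredundancy of these values, which is visibly measurable and unaffected by centering.
-/
theorem IsPolytopeLaw.apply_facetNumber_inter (hd : 2 ≤ d) {D : Set (FatBody d)}
    (hD : MeasurableSet D)
    (hinv : ∀ (r : ℝ) (hr : 0 < r) (x : Space d) (K : FatBody d),
      FatBody.smulAdd r hr x K ∈ D ↔ K ∈ D) :
    Q ({K | facetNumber K.1 = Fintype.card J} ∩ D) =
      volume (levelSet v l c (solidWith v D ∩ tight v) (cube d) 1) * gammaTotal m /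
        mass v l c (solid v) := by
  have hW : MeasurableSet ({K : FatBody d | (fun j => supportFn K.1 (v j)) ∈ irredundant v} ∩ D) :=
    (measurable_supportFns v (isOpen_irredundant v).measurableSet).inter hD
  have hfac : ∀ K ∈ polytopes v, facetNumber K.1 = Fintype.card J ↔
      (fun j => supportFn K.1 (v j)) ∈ irredundant v := fun K hK => by
    rw [← facetNumber_body_eq_iff hd h hK.1, hK.2]
  have hae : ({K : FatBody d | facetNumber K.1 = Fintype.card J} ∩ D : Set (FatBody d)) =ᵐ[Q]
      ({K | (fun j => supportFn K.1 (v j)) ∈ irredundant v} ∩ D : Set (FatBody d)) := by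
    filter_upwards [hQ.ae_mem_polytopes h] with K hK
    exact propext (and_congr_left fun _ => hfac K hK)
  have hB := isHomothetic_solidWith h hD fun r hr x K hK => (hinv r hr x K).2 hK
  rw [measure_congr hae, hQ.apply_eq _ hW, ← hB.volume_levelSet_irredundant,
    ← hB.inter_irredundant.mass_eq h hc hm hm1]
  congr 2
  ext t
  simp only [solidWith, mem_inter_iff, mem_ofPred_eq, and_assoc]
  refine and_congr_right fun ht => ?_
  obtain ⟨h1, h2⟩ := centered_body (c := c) h ht
  have h3 : centered c (body v t) ∈ D ↔ body v t ∈ D := hinv 1 one_pos _ _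
  rw [← h3, and_comm]
  refine and_congr_right fun _ => ?_
  rw [← hfac _ (h2 ▸ body_mem_polytopes h h1), h2, facetNumber_body_eq_iff hd h h1,
    smul_add_shift_mem_irredundant_iff]

theorem IsPolytopeLaw.apply_facetNumber_pos (hd : 2 ≤ d) :
    0 < Q {K | facetNumber K.1 = Fintype.card J} := by
  have h1 := hQ.apply_facetNumber_inter h hc hm hm1 hd (D := univ) MeasurableSet.univ (by simp)
  rw [inter_univ] at h1
  rw [h1, solidWith_univ, ← (isHomothetic_solid h).volume_levelSet_irredundant]
  exact ENNReal.div_pos (mul_ne_zero (volume_levelSet_irredundant_ne_zero h hc)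
    (gammaTotal_ne_zero hm1)) (mass_solid_ne_top h hc hm hm1)

omit [Nonempty J] hc hm hm1 in
theorem IsPolytopeLaw.apply_content_inter {D : Set (FatBody d)} (hD : MeasurableSet D)
    (hinv : ∀ (r : ℝ) (hr : 0 < r) (x : Space d) (K : FatBody d),
      FatBody.smulAdd r hr x K ∈ D ↔ K ∈ D) (a : ℝ) :
    Q ({K | a ≤ content v l K.1} ∩ D) =
      mass v l c {t | t ∈ solidWith v D ∧ a ≤ content v l (body v t).1} /
        mass v l c (solid v) := by
  have hm : MeasurableSet {K : FatBody d | a ≤ content v l K.1} :=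
    measurableSet_le measurable_const
      ((continuous_content v l).measurable.comp measurable_subtype_coe)
  rw [hQ.apply_eq _ (hm.inter hD)]
  congr 2
  ext t
  simp only [solidWith, mem_inter_iff, mem_ofPred_eq, and_assoc]
  refine and_congr_right fun ht => ?_
  have h3 : centered c (body v t) ∈ D ↔ body v t ∈ D := hinv 1 one_pos _ _
  have h4 : content v l (centered c (body v t)).1 = content v l (body v t).1 := by
    change content v l (smulAdd 1 _ _) = _
    rw [content_smulAdd h zero_le_one, one_mul]
  rw [h3, h4, and_comm]

/-- Touching parameters have content equal to level, so their mass, a positive volume times a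
positive Gamma tail, is a lower bound. -/
theorem IsPolytopeLaw.apply_content_pos (a : ℝ) : 0 < Q {K | a ≤ content v l K.1} := by
  have h1 := hQ.apply_content_inter h (D := univ) MeasurableSet.univ (by simp) a
  rw [inter_univ, solidWith_univ] at h1
  rw [h1]
  refine ENNReal.div_pos (fun h0 => ?_) (mass_solid_ne_top h hc hm hm1)
  have h2 := (isHomothetic_solid h).inter_tight h |>.mass_level_ge h hc hm hm1 a
  have h3 : mass v l c {t | t ∈ solid v ∩ tight v ∧ a ≤ level l t} = 0 := by
    refine le_zero_iff.1 (h0 ▸ mass_mono fun t ht => ⟨ht.1.1, ?_⟩)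
    rw [(content_body_eq_iff h ht.1.1).2 ht.1.2]
    exact ht.2
  rw [h3, eq_comm, mul_eq_zero] at h2
  refine volume_levelSet_irredundant_ne_zero h hc ?_
  rw [(isHomothetic_solid h).volume_levelSet_irredundant]
  exact h2.resolve_right (gammaTail_ne_zero hm1 a)

/-- The conditional law of homothety-invariant properties of large polytopes converges to the
conditional law given the maximal number of facets. -/
theorem IsPolytopeLaw.tendsto_cond (hd : 2 ≤ d) {D : Set (FatBody d)} (hD : MeasurableSet D)
    (hinv : ∀ (r : ℝ) (hr : 0 < r) (x : Space d) (K : FatBody d),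
      FatBody.smulAdd r hr x K ∈ D ↔ K ∈ D) :
    Tendsto (fun a => Q[D | {K | a ≤ content v l K.1}]) atTop
      (𝓝 (Q[D | {K | facetNumber K.1 = Fintype.card J}])) := by
  have hM0 := mass_solid_ne_zero h hc hm hm1
  have hMt := mass_solid_ne_top h hc hm hm1
  have hB := isHomothetic_solidWith h hD fun r hr x K hK => (hinv r hr x K).2 hK
  have hU := isHomothetic_solid h
  set V := volume (levelSet v l c (solidWith v D ∩ tight v) (cube d) 1) with hV
  set V₁ := volume (levelSet v l c (solid v ∩ tight v) (cube d) 1) with hV₁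
  have hV₁0 : V₁ ≠ 0 := by
    rw [hV₁, ← hU.volume_levelSet_irredundant]
    exact volume_levelSet_irredundant_ne_zero h hc
  have hV₁t : V₁ ≠ ∞ :=
    (volume_levelSet_lt_top h hc (fun t ht => ht.1) isBounded_cube 1).ne
  have hfacet : Q[D | {K | facetNumber K.1 = Fintype.card J}] = V / V₁ := by
    have h1 := hQ.apply_facetNumber_inter h hc hm hm1 hd (D := univ) MeasurableSet.univ (by simp)
    rw [inter_univ, solidWith_univ] at h1
    rw [cond_apply' hD, h1, hQ.apply_facetNumber_inter h hc hm hm1 hd hD hinv,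
      inv_div_mul_div hM0 hMt, ENNReal.mul_div_mul_right _ _ (gammaTotal_ne_zero hm1)
        gammaTotal_lt_top.ne]
  -- The normalization of `Q` cancels; numerator and denominator are then divided by the same Gamma
  -- tail so that each converges.
  have hcond : ∀ a, Q[D | {K | a ≤ content v l K.1}] =
      (mass v l c {t | t ∈ solidWith v D ∧ a ≤ content v l (body v t).1} / gammaTail m a) /
        (mass v l c {t | t ∈ solid v ∧ a ≤ content v l (body v t).1} / gammaTail m a) := by
    intro a
    have h1 := hQ.apply_content_inter h (D := univ) MeasurableSet.univ (by simp) a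
    rw [inter_univ, solidWith_univ] at h1
    rw [cond_apply' hD, h1, hQ.apply_content_inter h hD hinv, inv_div_mul_div hM0 hMt,
      ← inv_div_mul_div (gammaTail_ne_zero hm1 a) (gammaTail_ne_top a), mul_comm]
    rfl
  rw [hfacet]
  simp only [hcond]
  exact ENNReal.Tendsto.div (hB.tendsto_mass_div h hc hm hm1) (Or.inr hV₁0)
    (hU.tendsto_mass_div h hc hm hm1) (Or.inl hV₁t)

end

variable {ι : Type*} [Fintype ι] {u : ι → Sphere d} {Ω : Type*} [MeasurableSpace Ω]
  {P : Measure Ω} [IsProbabilityMeasure P]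
  {η : Ω → Set (Sphere d × ℝ)} {γ : ℝ} {φ : Measure (Sphere d)} [IsProbabilityMeasure φ]

/-- The law of the typical cell of a Poisson hyperplane mosaic. -/
theorem IsPoissonProcess.isPolytopeLaw
    (hη : IsPoissonProcess P η (hyperplaneIntensity γ φ)) (hγ : 0 < γ)
    (hu : Function.Injective (direction u)) (hφ : ∀ i, φ {-u i} = φ {u i})
    (hφ0 : ∀ i, φ {u i} ≠ 0) (hran : φ (range (direction u))ᶜ = 0)
    (h : IsBalanced (normal u) fun j => γ * φ.real {u j.1}) (hc : IsCenterFunction c) :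
    IsPolytopeLaw (normal u) (fun j => γ * φ.real {u j.1}) c (typicalCellLaw P η c) where
  apply_eq D hD := by
    have hcube : MeasurableSet (centerInCube c) := hc.measurable measurableSet_cube
    have hC : MeasurableSet (centered c ⁻¹' D) := measurable_centered hc hD
    -- The constant factor of the gap intensity occurs in both numerator and denominator of the
    -- typical-cell law and cancels.
    set k := ENNReal.ofReal (∏ j : ι × Bool, γ * φ.real {u j.1}) with hk
    have hk0 : k ≠ 0 := by
      rw [hk, ne_eq, ENNReal.ofReal_eq_zero, not_le]
      exact Finset.prod_pos fun j _ => h.pos j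
    have hkt : k ≠ ∞ := ENNReal.ofReal_ne_top
    have key : ∀ E : Set (FatBody d), MeasurableSet E → mosaicIntensity P η (E ∩ centerInCube c) =
        k * mass (normal u) (fun j => γ * φ.real {u j.1}) c
          {t | t ∈ solid (normal u) ∧ body (normal u) t ∈ E} := by
      intro E hE
      have hm := (isOpen_solid (normal u)).measurableSet.inter
        (measurable_body h (hE.inter hcube))
      rw [hη.mosaicIntensity_apply hγ hu hφ hφ0 hran h (hE.inter hcube), gapIntensity,
        Measure.smul_apply, withDensity_apply _ hm, smul_eq_mul, mass]
      congr 3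
      ext t
      simp only [mem_inter_iff, mem_preimage, mem_ofPred_eq, and_assoc]
      rfl
    have h1 := key univ MeasurableSet.univ
    simp only [univ_inter, mem_univ, and_true] at h1
    rw [typicalCellLaw, Measure.smul_apply, Measure.map_apply (measurable_centered hc) hD,
      Measure.restrict_apply hC, key _ hC, h1, smul_eq_mul, mul_comm, ← div_eq_mul_inv]
    exact ENNReal.mul_div_mul_left _ _ hk0 hkt

end TypicalCell

end HyperplaneMosaic

end

open HyperplaneMosaic in
/-- The typical cell `Z` is the identity on the probability space `(FatBody d, Q)`, where `Q` is
the law of the typical cell; `nmax` is the number of points on which `φ` is concentrated. -/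
theorem theorem1p6 {d : ℕ} (hd : 2 ≤ d)
    (φ : Measure (Sphere d)) [IsProbabilityMeasure φ]
    (heven : φ.map (fun u => -u) = φ)
    (hspan : ∀ v : Space d, v ≠ 0 → ∃ u ∈ φ.support, inner ℝ (u : Space d) v ≠ 0)
    (hfin : ∃ F : Set (Sphere d), F.Finite ∧ φ Fᶜ = 0)
    (nmax : ℕ) (hnmax : nmax = φ.support.ncard)
    (γ : ℝ) (hγ : 0 < γ)
    {Ω : Type*} [MeasurableSpace Ω] (P : Measure Ω) [IsProbabilityMeasure P]
    (η : Ω → Set (Sphere d × ℝ)) (hη : IsPoissonProcess P η (hyperplaneIntensity γ φ))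
    (c : FatBody d → Space d) (hc : IsCenterFunction c)
    (Q : Measure (FatBody d)) (hQ : Q = typicalCellLaw P η c) :
    IsProbabilityMeasure Q ∧
    (∀ᵐ Z ∂Q, facetNumber Z.1 ≤ (nmax : ℕ∞)) ∧
    0 < Q {Z | facetNumber Z.1 = (nmax : ℕ∞)} ∧
    (∀ a : ℝ, 0 < Q {Z | a ≤ phiContent φ Z.1}) ∧
    ∀ S : Set (ConvexBody (Space d)), MeasurableSet S →
      Tendsto (fun a : ℝ => Q[{Z | shape φ c Z ∈ S} | {Z | a ≤ phiContent φ Z.1}]) atTop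
        (𝓝 (Q[{Z | shape φ c Z ∈ S} | {Z | facetNumber Z.1 = (nmax : ℕ∞)}])) := by
  subst hQ
  obtain ⟨F, hF, hφF⟩ := hfin
  obtain ⟨ι, _, u, hu, hrange⟩ := exists_direction_range_eq_support heven hF hφF
  have hsupp : ∀ j, direction u j ∈ φ.support := fun j => hrange ▸ mem_range_self j
  have hφ : ∀ i, φ {-u i} = φ {u i} := fun i => measure_neg_singleton heven (u i)
  have hφ0 : ∀ i, φ {u i} ≠ 0 := fun i =>
    measure_singleton_ne_zero_of_mem_support hF hφF (hsupp (i, true))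
  have hran : φ (range (direction u))ᶜ = 0 := by
    rw [hrange]
    exact Measure.measure_compl_support
  have hl : ∀ i, 0 < γ * φ.real {u i} := fun i =>
    mul_pos hγ (ENNReal.toReal_pos (hφ0 i) (measure_ne_top _ _))
  have h : IsBalanced (normal u) fun j => γ * φ.real {u j.1} :=
    isBalanced_normal hu hl (by rwa [hrange])
  obtain ⟨m, hm1, hm⟩ := card_directions h hd
  have hne : Nonempty (ι × Bool) := Fintype.card_pos_iff.1 (by omega)
  have hcard : nmax = Fintype.card (ι × Bool) := by
    rw [hnmax, ← hrange, ← image_univ, ncard_image_of_injective _ hu, ncard_univ,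
      Nat.card_eq_fintype_card]
  have hcontent := content_eq_mul_phiContent (γ := γ) hu hφ hran
  have hphi : ∀ K, phiContent φ K = γ⁻¹ * content (normal u) (fun j => γ * φ.real {u j.1}) K :=
    fun K => by rw [hcontent, ← mul_assoc, inv_mul_cancel₀ hγ.ne', one_mul]
  have hphiscale : ∀ (t : ℝ) (_ : 0 ≤ t) (x : Space d) (K : ConvexBody (Space d)),
      phiContent φ (smulAdd t x K) = t * phiContent φ K := fun t ht x K => by
    rw [hphi, content_smulAdd h ht, hphi, mul_left_comm]
  have hphimeas : Measurable fun K : ConvexBody (Space d) => phiContent φ K := by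
    simp only [hphi]
    exact (continuous_content _ _).measurable.const_mul _
  have hQ := hη.isPolytopeLaw hγ hu hφ hφ0 hran h hc
  have hset : ∀ a : ℝ, {Z : FatBody d | a ≤ phiContent φ Z.1} =
      {Z | γ * a ≤ content (normal u) (fun j => γ * φ.real {u j.1}) Z.1} := fun a => by
    ext Z
    simp only [mem_ofPred_eq, hcontent, mul_le_mul_iff_right₀ hγ]
  rw [hcard]
  refine ⟨hQ.isProbabilityMeasure h hc hm hm1, hQ.ae_facetNumber_le h hd,
    hQ.apply_facetNumber_pos h hc hm hm1 hd, fun a => ?_, fun S hS => ?_⟩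
  · rw [hset]
    exact hQ.apply_content_pos h hc hm hm1 _
  · simp only [hset]
    -- The content equals `γ * Φ`, so the threshold `a` for `Φ` becomes `γ * a`, which still tends
    -- to infinity.
    refine (hQ.tendsto_cond h hc hm hm1 hd (measurable_shape hc hphimeas hS) ?_).comp
      (tendsto_id.const_mul_atTop hγ)
    intro r hr x K
    simp only [mem_preimage, shape_smulAdd hc hphiscale]
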